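/- **Setting.** Fix $d\ge 0$ and $T>0$; integrals without a specified domain are over $\mathbb R^d$ with Lebesgue measure. The generator of a family $(S_t)_{t\ge0}$ of integral operators is $\mathcal Lf=\lim_{h\downarrow0}(S_hf-f)/h$, and $\operatorname{Dom}(\mathcal L)$ is the set of bounded measurable $f$ for which this limit exists in the supremum norm. (a) $(P_t)_{t\ge 0}$ is a semigroup, $P_0=I$, $P_{s+t}=P_sP_t$, on bounded measurable functions, of the form $P_tf(x)=\int f(y)\,P_t(x,dy)$ with finite signed measures $P_t(x,\cdot)$. For $f\in C_c^\infty(\mathbb R^d)$, $(t,x)\mapsto P_tf(x)$ is measurable on $[0,T]\times\mathbb R^d$, $\|P_tf\|_\infty\le\|f\|_\infty$ for $t\in[0,T]$, and $f\in\operatorname{Dom}(L)$, where $L$ is the generator of $(P_t)$. (b) For every $z\in\mathbb R^d$, $p^z_t(x,y)$, $t\in(0,T]$, is a probability density in $y$ ($p^z_t\ge 0$, $\int p_t^z(x,y)\,dy=1$), continuous in $(t,x,y)\in(0,T]\times\mathbb R^d\times\mathbb R^d$, jointly measurable in $(t,z,x,y)$, and satisfying the Chapman–Kolmogorov equation $p^z_{s+t}(x,y)=\int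 p^z_s(x,w)p^z_t(w,y)\,dw$ for all $x,y$ and $s,t>0$, $s+t\le T$. Put $P^z_tf(x)=\int f(y)p^z_t(x,y)\,dy$, with generator $L^z$; $C_c^\infty(\mathbb R^d)\subseteq\operatorname{Dom}(L^z)$. Put $\phi^z_t(x)=p^z_t(x,z)$ and $C_t(z)=\int\phi^z_t(x)\,dx$. (c) $Lf(z)=L^zf(z)$ for all $z\in\mathbb R^d$ and all $f\in C_c^\infty(\mathbb R^d)$ as well as all $f=\phi^w_t$, $t\in(0,T]$, $w\in\mathbb R^d$. (d) (A0ast) $\int p^y_t(x,y)\,dy$ and $\int p^y_t(x,y)\,dx$ are bounded uniformly in $t\in(0,T]$ and in $x$, respectively $y$. For $g,h\in C_c^\infty(\mathbb R^d)$ and $z,w\in\mathbb R^d$: $\int g(x)p^z_t(x,w)\,dx\to\int g(x)p^z_T(x,w)\,dx$ as $t\to T$, $t\le T$, and $\int h(z)\phi^z_\varepsilon(w)\,dz\to h(w)$ as $\varepsilon\downarrow0$. Moreover $\phi^z_t\in\operatorname{Dom}(L)\cap\bigcap_{y}\operatorname{Dom}(L^y)$ for all $t\in(0,T]$, $z\in\mathbb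 R^d$. (e) (A1ast) $\hat\theta$ is a continuous function on $(0,T]\times\mathbb R^d\times\mathbb R^d$ with $(L^{y_1}\phi^y_t)(y_1)-(L^{y}\phi^y_t)(y_1)=\hat\theta_t(y_1,y)\phi^y_t(y_1)$ for all $t\in(0,T]$ and $y_1,y\in\mathbb R^d$, and $y_1\mapsto\hat\theta_t(y_1,y)\phi^y_t(y_1)$ is integrable with respect to $P_s(x,dy_1)$ for all $s\in[0,T]$, $x,y\in\mathbb R^d$, $t\in(0,T]$. (f) There are $\rho\in[0,1)$, $C>0$, $\zeta>1$ with $\zeta\rho<1$, and measurable functions $\gamma_t\ge0$ on $\mathbb R^d\times\mathbb R^d$ such that $|\hat\theta_t(y,x)\phi^x_t(y)|\le Ct^{-\rho}\gamma_t(x,y)$ for $t\in(0,T]$, $x,y\in\mathbb R^d$; $\sup_{t,x}\int\gamma_t(x,y)\,dy<\infty$; $\sup_{t,y}\int\gamma_t(x,y)\,dx<\infty$; and $\sup_{t,y}\int_{\{|x|\le R\}}\gamma_t(x,y)^\zeta\,dx<\infty$ for every $R>0$ (suprema over $t\in(0,T]$ and the indicated space variable in $\mathbb R^d$). (g) (HMCB)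 Let $0=\tau_0<\tau_1<\tau_2<\cdots$ be the jump times of a Poisson process of parameter $1$, $J_T$ its number of jumps in $[0,T]$, and $\tau_T:=\tau_{J_T}$. A *backward scheme* is a process $X=(X_t)_{t\in[0,T]}$ in $\mathbb R^d$ whose initial value is independent of $(\tau_j)_j$ and such that for every $k\ge0$, on $\{\tau_k<T\}$, the conditional law of $X_{\tau_{k+1}\wedge T}$ given $(\tau_j)_{j\ge0}$ and $X_{\tau_i\wedge T}$, $i\le k$, is $C_\delta(y_1)^{-1}\phi^{y_1}_\delta(y_2)\,dy_2$ with $y_1=X_{\tau_k}$ and $\delta=(\tau_{k+1}\wedge T)-\tau_k$. For every $y\in\mathbb R^d$ let $X^{*,\pi}(y)$ be a backward scheme with $X_0^{*,\pi}(y)=y$. For a backward scheme $X^{*,\pi}(\cdot)$ started at $y$ (or at a random variable $Z$, in place of $y$) let $$\Gamma^*_T(y)=C_{T-\tau_T}\bigl(X^{*,\pi}_{\tau_T}(y)\bigr)\prod_{j=0}^{J_T-1}C_{\tau_{j+1}-\tau_j}\bigl(X^{*,\pi}_{\tau_j}(y)\bigr)\,\hat\theta_{\tau_{j+1}-\tau_j}\bigl(X^{*,\pi}_{\tau_{j+1}}(y),X^{*,\pi}_{\tau_j}(y)\bigr)$$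 (so $\Gamma_T^*(y)=C_T(y)$ if $J_T=0$). **Theorem.** Under (a)–(g), for a.e. $x$ the measure $P_T(x,dy)$ is absolutely continuous with density $$p_T(x,y)=e^T\,\mathbb E\Bigl[C_{T-\tau_T}\bigl(X^{*,\pi}_{\tau_T}(y)\bigr)^{-1}\,p^{X^{*,\pi}_{\tau_T}(y)}_{T-\tau_T}\bigl(x,X^{*,\pi}_{\tau_T}(y)\bigr)\,\Gamma^*_T(y)\Bigr],$$ where for every $x$ the random variable in the expectation is integrable for a.e. $y$, and for a.e. $x$ the function $p_T(x,\cdot)$ is integrable. Consequently, if $Z$ is a random variable with density $h\in L^1(\mathbb R^d)$, $h\ge 0$, and $X^{*,\pi}(Z)$ is a backward scheme with initial value $Z$ (in particular $Z$ is independent of the Poisson process), then for a.e. $x$ the function $h$ is integrable with respect to $P_T(x,dy)$, the random variable below is integrable, and $$P_Th(x)=e^T\,\mathbb E\Bigl[C_{T-\tau_T}\bigl(X^{*,\pi}_{\tau_T}(Z)\bigr)^{-1}\,p^{X^{*,\pi}_{\tau_T}(Z)}_{T-\tau_T}\bigl(x,X^{*,\pi}_{\tau_T}(Z)\bigr)\,\Gamma^*_T(Z)\Bigr].$$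 -/

import Mathlib

open MeasureTheory ProbabilityTheory Set Filter Topology
open scoped ENNReal NNReal

namespace Parametrix

/-- The space `ℝ^d` with its Euclidean norm and Lebesgue measure. -/
abbrev Rd (d : ℕ) : Type := EuclideanSpace ℝ (Fin d)

variable {d : ℕ} {Ω : Type*}

/-- `f ∈ C_c^∞(ℝ^d)`. -/
def IsTest (f : Rd d → ℝ) : Prop := ContDiff ℝ (⊤ : ℕ∞) f ∧ HasCompactSupport f

/-- `f` is a bounded measurable function. -/
def IsBddMeas (f : Rd d → ℝ) : Prop := Measurable f ∧ ∃ M : ℝ, ∀ x, |f x| ≤ M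

/-! ### Semigroups and generators -/

/-- The integral operator `P_t f(x) = ∫ f(y) P_t(x, dy)` of a family of finite signed measures. -/
noncomputable def op (P : ℝ → Rd d → SignedMeasure (Rd d)) (t : ℝ) (f : Rd d → ℝ) (x : Rd d) : ℝ :=
  ∫ᵛ y, f y ∂<•(P t x)

/-- The frozen operator `P_t^z f(x) = ∫ f(y) p_t^z(x, y) dy`; here `p t z x y` is `p_t^z(x, y)`. -/
noncomputable def frozenOp (p : ℝ → Rd d → Rd d → Rd d → ℝ) (z : Rd d) (t : ℝ) (f : Rd d → ℝ)
    (x : Rd d) : ℝ :=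
  ∫ y, f y * p t z x y

/-- `f` is in the domain of the infinitesimal generator of `(S_t)`: it is a bounded measurable
function and `(S_h f - f) / h` converges in the supremum norm as `h ↓ 0`. -/
def InDom (S : ℝ → (Rd d → ℝ) → Rd d → ℝ) (f : Rd d → ℝ) : Prop :=
  IsBddMeas f ∧
    ∃ g : Rd d → ℝ, TendstoUniformly (fun (h : ℝ) (x : Rd d) => (S h f x - f x) / h) g (𝓝[>] 0)

/-- The infinitesimal generator of `(S_t)` (meaningful on its domain `InDom S`). -/
noncomputable def gen (S : ℝ → (Rd d → ℝ) → Rd d → ℝ) (f : Rd d → ℝ) (x : Rd d) : ℝ :=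
  limUnder (𝓝[>] (0 : ℝ)) (fun h : ℝ => (S h f x - f x) / h)

/-- `φ_t^z(x) = p_t^z(x, z)`: the frozen density as a function of the starting point, when the
coefficients are frozen at the arrival point. -/
def phi (p : ℝ → Rd d → Rd d → Rd d → ℝ) (t : ℝ) (z x : Rd d) : ℝ := p t z x z

/-- `(P_t)` is a semigroup of integral operators, jointly measurable and contractive (up to time
`T`) on test functions, and the test functions are in the domain of its generator. -/
structure IsSemigroup (T : ℝ) (P : ℝ → Rd d → SignedMeasure (Rd d)) : Prop where
  zero : ∀ f : Rd d → ℝ, IsBddMeas f → ∀ x, op P 0 f x = f x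
  add : ∀ s t : ℝ, 0 ≤ s → 0 ≤ t → ∀ f : Rd d → ℝ, IsBddMeas f →
    ∀ x, op P (s + t) f x = op P s (op P t f) x
  measurable : ∀ f : Rd d → ℝ, IsTest f →
    Measurable (fun q : Icc (0 : ℝ) T × Rd d => op P q.1 f q.2)
  contraction : ∀ f : Rd d → ℝ, IsTest f → ∀ M : ℝ, (∀ x, |f x| ≤ M) →
    ∀ t ∈ Icc (0 : ℝ) T, ∀ x, |op P t f x| ≤ M
  test_dom : ∀ f : Rd d → ℝ, IsTest f → InDom (op P) f

/-- For every `z`, `p^z` is a continuous transition probability density on `(0, T]` (satisfying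
the Chapman-Kolmogorov equation), jointly measurable in all variables including `z`, and the test
functions are in the domain of the generator `L^z` of the associated semigroup. -/
structure IsFrozenFamily (T : ℝ) (p : ℝ → Rd d → Rd d → Rd d → ℝ) : Prop where
  measurable :
    Measurable (fun q : Ioc (0 : ℝ) T × Rd d × Rd d × Rd d => p q.1 q.2.1 q.2.2.1 q.2.2.2)
  continuous : ∀ z, ContinuousOn (fun q : ℝ × Rd d × Rd d => p q.1 z q.2.1 q.2.2)
    (Ioc (0 : ℝ) T ×ˢ univ)
  nonneg : ∀ t ∈ Ioc (0 : ℝ) T, ∀ z x y, 0 ≤ p t z x y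
  prob : ∀ t ∈ Ioc (0 : ℝ) T, ∀ z x, ∫ y, p t z x y = 1
  chapman_kolmogorov : ∀ s t : ℝ, 0 < s → 0 < t → s + t ≤ T → ∀ z x y,
    Integrable (fun w => p s z x w * p t z w y) ∧
      p (s + t) z x y = ∫ w, p s z x w * p t z w y
  test_dom : ∀ f : Rd d → ℝ, IsTest f → ∀ z, InDom (frozenOp p z) f

/-- The generator `L` of `(P_t)` and the frozen generators agree on the diagonal,
`Lf(z) = L^z f(z)`, for test functions and for the functions `φ_t^w`. -/
structure GeneratorsAgree (T : ℝ) (P : ℝ → Rd d → SignedMeasure (Rd d))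
    (p : ℝ → Rd d → Rd d → Rd d → ℝ) : Prop where
  test : ∀ f : Rd d → ℝ, IsTest f → ∀ z, gen (op P) f z = gen (frozenOp p z) f z
  phi : ∀ t ∈ Ioc (0 : ℝ) T, ∀ w z,
    gen (op P) (phi p t w) z = gen (frozenOp p z) (phi p t w) z

/-! ### Hypotheses of the backward method -/

/-- Integrability, continuity and domain conditions on the functions `φ_t^z`. -/
structure BackwardRegular (T : ℝ) (P : ℝ → Rd d → SignedMeasure (Rd d))
    (p : ℝ → Rd d → Rd d → Rd d → ℝ) : Prop where
  integrable_bound : ∃ M : ℝ, ∀ t ∈ Ioc (0 : ℝ) T,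
    (∀ x, Integrable (fun y => p t y x y) ∧ ∫ y, p t y x y ≤ M) ∧
    (∀ y, Integrable (fun x => p t y x y) ∧ ∫ x, p t y x y ≤ M)
  adjoint_continuous : ∀ g : Rd d → ℝ, IsTest g → ∀ z w,
    Tendsto (fun t => ∫ x, g x * p t z x w) (𝓝[Ioc 0 T] T) (𝓝 (∫ x, g x * p T z x w))
  approx_identity : ∀ h : Rd d → ℝ, IsTest h → ∀ w,
    Tendsto (fun ε => ∫ z, h z * phi p ε z w) (𝓝[>] 0) (𝓝 (h w))
  phi_dom : ∀ t ∈ Ioc (0 : ℝ) T, ∀ z,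
    InDom (op P) (phi p t z) ∧ ∀ y, InDom (frozenOp p y) (phi p t z)

/-- `θ t y₁ y` is the continuous weight `θ̂_t(y₁, y)`:
`(L^{y₁} - L^y) φ_t^y (y₁) = θ̂_t(y₁, y) φ_t^y(y₁)`. -/
structure IsBackwardWeight (T : ℝ) (P : ℝ → Rd d → SignedMeasure (Rd d))
    (p : ℝ → Rd d → Rd d → Rd d → ℝ) (θ : ℝ → Rd d → Rd d → ℝ) : Prop where
  continuous : ContinuousOn (fun q : ℝ × Rd d × Rd d => θ q.1 q.2.1 q.2.2) (Ioc (0 : ℝ) T ×ˢ univ)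
  weight : ∀ t ∈ Ioc (0 : ℝ) T, ∀ y₁ y,
    gen (frozenOp p y₁) (phi p t y) y₁ - gen (frozenOp p y) (phi p t y) y₁
      = θ t y₁ y * phi p t y y₁
  integrable : ∀ s ∈ Icc (0 : ℝ) T, ∀ x, ∀ t ∈ Ioc (0 : ℝ) T, ∀ y,
    (P s x).Integrable (fun y₁ => θ t y₁ y * phi p t y y₁)

/-- The kernel `â_t(x, y) = θ̂_t(y, x) φ_t^x(y)` satisfies `|â_t(x, y)| ≤ C t^{-ρ} γ_t(x, y)` with
`ρ ∈ [0, 1)`, where `γ` has uniformly bounded marginal integrals, and `γ^ζ` has locally uniformly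
bounded integrals in its first variable for some `ζ > 1` with `ζ ρ < 1`. -/
def HasBackwardKernelBound (T : ℝ) (p : ℝ → Rd d → Rd d → Rd d → ℝ)
    (θ : ℝ → Rd d → Rd d → ℝ) : Prop :=
  ∃ (ρ C ζ : ℝ) (γ : ℝ → Rd d → Rd d → ℝ), 0 ≤ ρ ∧ ρ < 1 ∧ 0 < C ∧ 1 < ζ ∧ ζ * ρ < 1 ∧
    (∀ t ∈ Ioc (0 : ℝ) T, Measurable (fun q : Rd d × Rd d => γ t q.1 q.2)) ∧
    (∀ t ∈ Ioc (0 : ℝ) T, ∀ x y, 0 ≤ γ t x y) ∧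
    (∀ t ∈ Ioc (0 : ℝ) T, ∀ x y, |θ t y x * phi p t x y| ≤ C / t ^ ρ * γ t x y) ∧
    (∃ K : ℝ≥0, ∀ t ∈ Ioc (0 : ℝ) T, ∀ x, ∫⁻ y, ENNReal.ofReal (γ t x y) ≤ K) ∧
    (∃ K : ℝ≥0, ∀ t ∈ Ioc (0 : ℝ) T, ∀ y, ∫⁻ x, ENNReal.ofReal (γ t x y) ≤ K) ∧
    (∀ R : ℝ, 0 < R → ∃ K : ℝ≥0, ∀ t ∈ Ioc (0 : ℝ) T, ∀ y,
      ∫⁻ x in Metric.closedBall 0 R, ENNReal.ofReal (γ t x y ^ ζ) ≤ K)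

/-! ### The Poisson process, the backward scheme and the weight `Γ*` -/

/-- `τ 0 = 0 < τ 1 < τ 2 < ...` are the jump times of a Poisson process of parameter one: the
waiting times `τ (j+1) - τ j` are independent and exponentially distributed with parameter one. -/
structure IsPoissonJumpTimes [MeasurableSpace Ω] (μ : Measure Ω) (τ : ℕ → Ω → ℝ) : Prop where
  zero : ∀ ω, τ 0 ω = 0
  measurable : ∀ j, Measurable (τ j)
  indep : iIndepFun (fun (j : ℕ) (ω : Ω) => τ (j + 1) ω - τ j ω) μ
  law : ∀ j, μ.map (fun ω => τ (j + 1) ω - τ j ω) = expMeasure 1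

/-- The number `J_T` of jumps in `[0, T]`. -/
noncomputable def jumpCount (τ : ℕ → Ω → ℝ) (T : ℝ) (ω : Ω) : ℕ :=
  Set.ncard {j : ℕ | τ (j + 1) ω ≤ T}

/-- `C_t(y) = ∫ φ_t^y(x) dx`. -/
noncomputable def massC (p : ℝ → Rd d → Rd d → Rd d → ℝ) (t : ℝ) (y : Rd d) : ℝ :=
  ∫ x, phi p t y x

/-- The process `X` at the `k`-th point `τ_k ∧ T` of the random grid `π`. -/
def atGrid (τ : ℕ → Ω → ℝ) (T : ℝ) (X : ℝ → Ω → Rd d) (k : ℕ) (ω : Ω) : Rd d :=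
  X (min (τ k ω) T) ω

/-- The information given by all jump times and by `X` at the grid points of index at most `k`. -/
abbrev history (τ : ℕ → Ω → ℝ) (T : ℝ) (X : ℝ → Ω → Rd d) (k : ℕ) : MeasurableSpace Ω :=
  (⨆ j, MeasurableSpace.comap (τ j) inferInstance) ⊔
    ⨆ i : Fin (k + 1), MeasurableSpace.comap (atGrid τ T X i) inferInstance

/-- `X = X^{*,π}` is a backward scheme on the grid `π = {τ_k ∧ T}`: its initial value is independent
of the jump times and, conditionally on the jump times, its values at successive grid points form a
Markov chain which moves in time `δ` from `y₁` to a point of law `C_δ(y₁)⁻¹ φ_δ^{y₁}(y₂) dy₂`. -/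
structure IsBackwardScheme [MeasurableSpace Ω] (μ : Measure Ω) (τ : ℕ → Ω → ℝ) (T : ℝ)
    (p : ℝ → Rd d → Rd d → Rd d → ℝ) (X : ℝ → Ω → Rd d) : Prop where
  measurable : ∀ k, Measurable (atGrid τ T X k)
  indep : IndepFun (X 0) (fun ω (j : ℕ) => τ j ω) μ
  transition : ∀ (k : ℕ) (f : Rd d → ℝ), IsBddMeas f →
    μ[fun ω => f (atGrid τ T X (k + 1) ω) | history τ T X k]
      =ᵐ[μ.restrict {ω | τ k ω < T}] fun ω =>
        (massC p (min (τ (k + 1) ω) T - τ k ω) (atGrid τ T X k ω))⁻¹ *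
          ∫ y₂, f y₂ * phi p (min (τ (k + 1) ω) T - τ k ω) (atGrid τ T X k ω) y₂

/-- The weight
`Γ*_T = C_{T-τ_n}(X_{τ_n}) ∏_{j<n} C_{τ_{j+1}-τ_j}(X_{τ_j}) θ̂_{τ_{j+1}-τ_j}(X_{τ_{j+1}}, X_{τ_j})`
with `n = J_T`; it equals `C_T(X_0)` when `J_T = 0`. -/
noncomputable def GammaStar (τ : ℕ → Ω → ℝ) (T : ℝ) (p : ℝ → Rd d → Rd d → Rd d → ℝ)
    (θ : ℝ → Rd d → Rd d → ℝ) (X : ℝ → Ω → Rd d) (ω : Ω) : ℝ :=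
  massC p (T - τ (jumpCount τ T ω) ω) (X (τ (jumpCount τ T ω) ω) ω) *
    ∏ j ∈ Finset.range (jumpCount τ T ω),
      massC p (τ (j + 1) ω - τ j ω) (X (τ j ω) ω) *
        θ (τ (j + 1) ω - τ j ω) (X (τ (j + 1) ω) ω) (X (τ j ω) ω)

/-- The random variable
`C_{T-τ_T}(X_{τ_T})⁻¹ p_{T-τ_T}^{X_{τ_T}}(x, X_{τ_T}) Γ*_T`, where `τ_T = τ_{J_T}`. -/
noncomputable def bwdIntegrand (τ : ℕ → Ω → ℝ) (T : ℝ) (p : ℝ → Rd d → Rd d → Rd d → ℝ)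
    (θ : ℝ → Rd d → Rd d → ℝ) (X : ℝ → Ω → Rd d) (x : Rd d) (ω : Ω) : ℝ :=
  (massC p (T - τ (jumpCount τ T ω) ω) (X (τ (jumpCount τ T ω) ω) ω))⁻¹ *
    p (T - τ (jumpCount τ T ω) ω) (X (τ (jumpCount τ T ω) ω) ω) x (X (τ (jumpCount τ T ω) ω) ω) *
    GammaStar τ T p θ X ω

end Parametrix

/-! Write `D_t(x,y) = p_t^y(x,y)` (`diagDensity`) and `A_r(w,y) = θ̂_r(w,y) φ_r^y(w)`
(`corrKernel`), both zero outside `(0,T]`. For fixed `y` the function `r ↦ P_{u-r} φ_r^y` has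
derivative `-P_{u-r} (L - L^y) φ_r^y = -P_{u-r} A_r(·,y)`, because `L` coincides at each point `w`
with the generator frozen at `w`. Integrating over `[ε,u]`, then against `f(y) dy`, and letting `ε ↓
0` gives Duhamel's formula `P_t f = D_t f + ∫_0^t P_{t-r} A_r f dr` at almost every point
(`duhamel`). Iterating it produces the series `∑ W_n` with `W_n = D * A * ⋯ * A`, convolved in time
and composed in space. The rate `r^{-ρ}` is integrable, so under a weight `e^{-lr}` with `l` large
each convolution costs a factor `1/2` (`exists_laplace_le`). The remainder then vanishes
(`enorm_op_sub_sum_le`), and the sum of the series is the density of `P_t(x,·)`.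

Two difficulties come from the weak assumptions on `P`, which is signed and only known to be
continuous in time on the domain of `L`. First, the total variation of `P_s(x,·)` is nonincreasing
in `s`, hence continuous off a countable set of times. At its continuity points no mass escapes, so
`s ↦ P_s f(x)` is continuous for every bounded continuous `f` (`exists_countable_tendsto_op`). This
suffices for a fundamental theorem of calculus with a countable exceptional set
(`integral_eq_sub_of_right_slope`). Second, `D_u f(x)` is not known to be continuous in `u`
pointwise. The other terms of Duhamel's formula do converge, and the limit is identified by testing
against `g ∈ C_c^∞` (`ae_eq_diagOp_of_tendsto`), which is why `x` is restricted to a set of full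
measure.

On the probabilistic side, `n` exponential waiting times `s_j` followed by one exceeding the
remaining time carry the weight `e^{-s_1} ⋯ e^{-s_n} e^{-(T - ∑ s_j)} = e^{-T}`, whatever the `s_j`
are. So `e^{-T} W_n` is the expectation over the clock of a product of kernels integrated in space
(`integral_pathTerm`). The scheme draws `w` from `C⁻¹ φ^y(w)` and is weighted by `C θ̂`, which
restores the kernel `A`. Random steps can thus be traded one by one for integrated steps
(`integral_contribution_step`), until only the waiting times and the initial point remain. Almost
surely exactly one `n` contributes to the random variable (`bwdIntegrand_ae_eq_tsum`). A
deterministic start gives the density at almost every `y`, and a start with density `h` gives `P_T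
h`. -/

namespace Parametrix

/-! ### Generic measure theory -/

section Generic

/-- A functional monotone class theorem for bounded measurable functions. -/
theorem boundedMeasurable_induction {α : Type*} [m : MeasurableSpace α] {S : Set (Set α)}
    (hm : m = MeasurableSpace.generateFrom S) (hS : IsPiSystem S) {C : (α → ℝ) → Prop}
    (one : C fun _ => 1) (basic : ∀ A ∈ S, C (A.indicator fun _ => 1))
    (add : ∀ f g : α → ℝ, Measurable f → Measurable g → (∃ M, ∀ x, |f x| ≤ M) →
      (∃ M, ∀ x, |g x| ≤ M) → C f → C g → C fun x => f x + g x)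
    (smul : ∀ (c : ℝ) (f : α → ℝ), Measurable f → (∃ M, ∀ x, |f x| ≤ M) → C f →
      C fun x => c * f x)
    (lim : ∀ (F : ℕ → α → ℝ) (f : α → ℝ) (M : ℝ), (∀ n, Measurable (F n)) →
      (∀ n x, |F n x| ≤ M) → (∀ x, Tendsto (fun n => F n x) atTop (𝓝 (f x))) →
      (∀ n, C (F n)) → C f)
    (f : α → ℝ) (hf : Measurable f) (hb : ∃ M, ∀ x, |f x| ≤ M) : C f := by
  classical
  have bddind : ∀ (A : Set α) (x : α), |A.indicator (fun _ => (1 : ℝ)) x| ≤ 1 := by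
    intro A x
    by_cases hx : x ∈ A <;> simp [hx]
  have hset : ∀ A : Set α, MeasurableSet A → C (A.indicator fun _ => 1) := by
    intro A hA
    induction A, hA using MeasurableSpace.induction_on_inter hm hS with
    | empty =>
      have := smul 0 _ measurable_const ⟨1, fun _ => by simp⟩ one
      simpa using this
    | basic A hA => exact basic A hA
    | compl A hA ih =>
      have h1 := smul (-1) _ (measurable_const.indicator hA) ⟨1, bddind A⟩ ih
      have h2 := add _ _ measurable_const ((measurable_const.indicator hA).const_mul (-1))
        ⟨1, fun _ => by simp⟩ ⟨1, fun x => by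
          rw [abs_mul]; simpa using bddind A x⟩ one h1
      convert h2 using 2 with x
      by_cases hx : x ∈ A <;> simp [hx]
    | iUnion B hd hB ih =>
      have hfin : ∀ n : ℕ, C ((⋃ i ∈ Finset.range n, B i).indicator fun _ => 1) := by
        intro n
        induction n with
        | zero =>
          have := smul 0 _ measurable_const ⟨1, fun _ => by simp⟩ one
          simpa using this
        | succ n ihn =>
          have hmn : MeasurableSet (⋃ i ∈ Finset.range n, B i) :=
            Finset.measurableSet_biUnion _ fun i _ => hB i
          have := add _ _ (measurable_const.indicator hmn) (measurable_const.indicator (hB n))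
            ⟨1, bddind _⟩ ⟨1, bddind _⟩ ihn (ih n)
          convert this using 2 with x
          have hdis : Disjoint (⋃ i ∈ Finset.range n, B i) (B n) := by
            simp only [disjoint_iUnion_left]
            intro i hi
            exact hd (Finset.mem_range.1 hi).ne
          rw [Finset.range_add_one, Finset.set_biUnion_insert, union_comm,
            indicator_union_of_disjoint hdis]
      refine lim (fun n => (⋃ i ∈ Finset.range n, B i).indicator fun _ => 1) _ 1
        (fun n => measurable_const.indicator (Finset.measurableSet_biUnion _ fun i _ => hB i))
        (fun n => bddind _) (fun x => ?_) hfin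
      by_cases hx : x ∈ ⋃ i, B i
      · obtain ⟨i, hi⟩ := mem_iUnion.1 hx
        refine tendsto_const_nhds.congr' ?_
        filter_upwards [eventually_gt_atTop i] with n hn
        rw [indicator_of_mem hx, indicator_of_mem]
        exact mem_biUnion (Finset.mem_coe.2 (Finset.mem_range.2 hn)) hi
      · refine tendsto_const_nhds.congr fun n => ?_
        rw [indicator_of_notMem hx, indicator_of_notMem]
        simp only [mem_iUnion, not_exists] at hx ⊢
        exact fun i _ => hx i
  have hsimple : ∀ g : SimpleFunc α ℝ, C g := by
    intro g
    induction g using SimpleFunc.induction with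
    | const c hs =>
      convert smul c _ (measurable_const.indicator hs) ⟨1, bddind _⟩ (hset _ hs) using 2 with x
      rename_i s
      by_cases hx : x ∈ s <;> simp [hx]
    | add hd hf hg =>
      rename_i u v
      obtain ⟨M, hM⟩ := u.exists_forall_norm_le
      obtain ⟨N, hN⟩ := v.exists_forall_norm_le
      exact add _ _ u.measurable v.measurable ⟨M, hM⟩ ⟨N, hN⟩ hf hg
  obtain ⟨M, hM⟩ := hb
  -- The approximants are bounded by `‖f x‖ + ‖f x‖`, which is where `M + M` comes from.
  refine lim (fun n => SimpleFunc.approxOn f hf univ 0 (mem_univ _) n) f (M + M)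
    (fun n => SimpleFunc.measurable _) (fun n x => ?_) (fun x => ?_) (fun n => hsimple _)
  · exact (SimpleFunc.norm_approxOn_zero_le hf (mem_univ _) x n).trans (add_le_add (hM x) (hM x))
  · exact SimpleFunc.tendsto_approxOn hf (mem_univ _) (by simp)

instance isFiniteMeasure_variation {α : Type*} [MeasurableSpace α] (ν : SignedMeasure α) :
    IsFiniteMeasure ν.variation := by
  rw [← ν.totalVariation_eq_variation]; infer_instance

/-- Polar decomposition of a signed measure. -/
theorem exists_sign_integral_eq {α : Type*} [MeasurableSpace α] (ν : SignedMeasure α) :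
    ∃ σ : α → ℝ, Measurable σ ∧ (∀ y, |σ y| = 1) ∧
      ∀ f : α → ℝ, ∫ᵛ y, f y ∂<•ν = ∫ y, f y * σ y ∂ν.variation := by
  classical
  obtain ⟨S, hS, hpos, hneg⟩ := ν.toJordanDecomposition.mutuallySingular
  -- `S` is null for the positive part and its complement is null for the negative part, so this is
  -- the Hahn sign.
  refine ⟨fun y => if y ∈ S then -1 else 1, Measurable.ite hS measurable_const measurable_const,
    fun y => by by_cases hy : y ∈ S <;> simp [hy], fun f => ?_⟩
  have hσm : Measurable (fun y => if y ∈ S then (-1 : ℝ) else 1) :=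
    Measurable.ite hS measurable_const measurable_const
  set J := ν.toJordanDecomposition with hJ
  have hvar : ν.variation = J.posPart + J.negPart := by
    rw [← ν.totalVariation_eq_variation]; rfl
  have hν : ν = J.posPart.toSignedMeasure - J.negPart.toSignedMeasure :=
    (SignedMeasure.toSignedMeasure_toJordanDecomposition ν).symm
  have hp : (fun y => f y * (if y ∈ S then (-1 : ℝ) else 1)) =ᵐ[J.posPart] f := by
    have : ∀ᵐ y ∂J.posPart, y ∉ S := by rw [ae_iff]; simpa using hpos
    filter_upwards [this] with y hy
    simp [hy]
  have hn : (fun y => f y * (if y ∈ S then (-1 : ℝ) else 1)) =ᵐ[J.negPart] fun y => -f y := by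
    have : ∀ᵐ y ∂J.negPart, y ∈ S := by rw [ae_iff]; exact hneg
    filter_upwards [this] with y hy
    simp [hy]
  by_cases hf : Integrable f ν.variation
  · have hf' := hf
    rw [hvar, integrable_add_measure] at hf'
    rw [hvar, integral_add_measure (hf'.1.congr hp.symm) (hf'.2.neg.congr hn.symm),
      integral_congr_ae hp, integral_congr_ae hn, integral_neg]
    conv_lhs => rw [hν]
    rw [VectorMeasure.integral_sub_vectorMeasure, VectorMeasure.integral_toSignedMeasure,
      VectorMeasure.integral_toSignedMeasure, sub_eq_add_neg]
    · simpa [VectorMeasure.Integrable] using hf'.1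
    · simpa [VectorMeasure.Integrable] using hf'.2
  -- Without integrability both integrals take the default value `0`; since `|σ| = 1`, the two
  -- notions of integrability agree.
  · rw [VectorMeasure.integral_undef hf, integral_undef]
    intro h
    apply hf
    have := h.mul_bdd (c := 1) (g := fun y => if y ∈ S then (-1 : ℝ) else 1)
      hσm.aestronglyMeasurable (Eventually.of_forall fun y => by split_ifs <;> simp)
    refine this.congr (Eventually.of_forall fun y => ?_)
    by_cases hy : y ∈ S <;> simp [hy]

/-- One-sided fundamental theorem of calculus: a continuous function whose upper right Dini
derivative is everywhere at most the integrable function `φ`. -/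
theorem sub_le_integral_of_dini_le_Ico {g φ : ℝ → ℝ} {a b : ℝ} (hab : a ≤ b)
    (hcont : ContinuousOn g (Icc a b))
    (hderiv : ∀ x ∈ Ico a b, ∀ c, φ x < c → ∀ᶠ u in 𝓝[>] x, g u - g x ≤ (u - x) * c)
    (φint : IntegrableOn φ (Icc a b)) :
    g b - g a ≤ ∫ y in a..b, φ y := by
  refine le_of_forall_pos_le_add fun ε εpos => ?_
  -- Vitali–Carathéodory: pass to a lower semicontinuous strict majorant of `φ` whose integral is
  -- larger by less than `ε`. Its strict inequality at `t` persists near `t`, which an integrable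
  -- `φ` alone would not give.
  rcases exists_lt_lowerSemicontinuous_integral_lt φ φint εpos with
    ⟨G', f_lt_G', G'cont, G'int, G'lt_top, hG'⟩
  set s := {t | g t - g a ≤ ∫ u in a..t, (G' u).toReal} ∩ Icc a b
  have s_closed : IsClosed s := by
    have : ContinuousOn (fun t => (g t - g a, ∫ u in a..t, (G' u).toReal)) (Icc a b) := by
      rw [← uIcc_of_le hab] at G'int hcont ⊢
      exact (hcont.sub continuousOn_const).prodMk
        (intervalIntegral.continuousOn_primitive_interval G'int)
    simp only [s, inter_comm]
    exact this.preimage_isClosed_of_isClosed isClosed_Icc OrderClosedTopology.isClosed_le'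
  -- Continuous induction: the set where the inequality holds is closed, contains `a`, and from each
  -- of its points extends a little to the right.
  have main : Icc a b ⊆ {t | g t - g a ≤ ∫ u in a..t, (G' u).toReal} := by
    refine s_closed.Icc_subset_of_forall_exists_gt
      (by simp) fun t ht v t_lt_v => ?_
    obtain ⟨y, g'_lt_y', y_lt_G'⟩ : ∃ y : ℝ, (φ t : EReal) < y ∧ (y : EReal) < G' t :=
      EReal.lt_iff_exists_real_btwn.1 (f_lt_G' t)
    have I1 : ∀ᶠ u in 𝓝[>] t, (u - t) * y ≤ ∫ w in t..u, (G' w).toReal := by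
      have B : ∀ᶠ u in 𝓝 t, (y : EReal) < G' u := G'cont.lowerSemicontinuousAt _ _ y_lt_G'
      rcases mem_nhds_iff_exists_Ioo_subset.1 B with ⟨m, M, ⟨hm, hM⟩, H⟩
      have : Ioo t (min M b) ∈ 𝓝[>] t := Ioo_mem_nhdsGT (lt_min hM ht.right.right)
      filter_upwards [this] with u hu
      have I : Icc t u ⊆ Icc a b := Icc_subset_Icc ht.2.1 (hu.2.le.trans (min_le_right _ _))
      calc
        (u - t) * y = ∫ _ in Icc t u, y := by
          simp only [MeasureTheory.integral_const, MeasurableSet.univ, measureReal_restrict_apply,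
            univ_inter, hu.left.le, Real.volume_real_Icc_of_le, smul_eq_mul]
        _ ≤ ∫ w in t..u, (G' w).toReal := by
          rw [intervalIntegral.integral_of_le hu.1.le, ← integral_Icc_eq_integral_Ioc]
          apply setIntegral_mono_ae_restrict
          · simp
          · exact IntegrableOn.mono_set G'int I
          · have C1 : ∀ᵐ x : ℝ ∂volume.restrict (Icc t u), G' x < ∞ :=
              ae_mono (Measure.restrict_mono I le_rfl) G'lt_top
            have C2 : ∀ᵐ x : ℝ ∂volume.restrict (Icc t u), x ∈ Icc t u :=
              ae_restrict_mem measurableSet_Icc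
            filter_upwards [C1, C2] with x G'x hx
            apply EReal.coe_le_coe_iff.1
            have : x ∈ Ioo m M := by
              simp only [hm.trans_le hx.left,
                (hx.right.trans_lt hu.right).trans_le (min_le_left M b), mem_Ioo, and_self_iff]
            refine (H this).out.le.trans_eq ?_
            exact (EReal.coe_toReal G'x.ne (f_lt_G' x).ne_bot).symm
    have I2 : ∀ᶠ u in 𝓝[>] t, g u - g t ≤ (u - t) * y :=
      hderiv t ⟨ht.2.1, ht.2.2⟩ y (EReal.coe_lt_coe_iff.1 g'_lt_y')
    have I3 : ∀ᶠ u in 𝓝[>] t, g u - g t ≤ ∫ w in t..u, (G' w).toReal := by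
      filter_upwards [I1, I2] with u hu1 hu2 using hu2.trans hu1
    have I4 : ∀ᶠ u in 𝓝[>] t, u ∈ Ioc t (min v b) := Ioc_mem_nhdsGT <| lt_min t_lt_v ht.2.2
    rcases (I3.and I4).exists with ⟨x, hx, h'x⟩
    refine ⟨x, ?_, Ioc_subset_Ioc le_rfl (min_le_left _ _) h'x⟩
    calc
      g x - g a = g t - g a + (g x - g t) := by abel
      _ ≤ (∫ w in a..t, (G' w).toReal) + ∫ w in t..x, (G' w).toReal := add_le_add ht.1 hx
      _ = ∫ w in a..x, (G' w).toReal := by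
        apply intervalIntegral.integral_add_adjacent_intervals
        · rw [intervalIntegrable_iff_integrableOn_Ioc_of_le ht.2.1]
          exact IntegrableOn.mono_set G'int
            (Ioc_subset_Icc_self.trans (Icc_subset_Icc le_rfl ht.2.2.le))
        · rw [intervalIntegrable_iff_integrableOn_Ioc_of_le h'x.1.le]
          apply IntegrableOn.mono_set G'int
          exact Ioc_subset_Icc_self.trans (Icc_subset_Icc ht.2.1 (h'x.2.trans (min_le_right _ _)))
  calc
    g b - g a ≤ ∫ y in a..b, (G' y).toReal := main (right_mem_Icc.2 hab)
    _ ≤ (∫ y in a..b, φ y) + ε := by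
      rw [intervalIntegral.integral_of_le hab, intervalIntegral.integral_of_le hab,
        ← integral_Icc_eq_integral_Ioc, ← integral_Icc_eq_integral_Ioc]
      exact hG'.le

/-- Fundamental theorem of calculus for a continuous function which has a right derivative off a
null set and bounded Dini difference quotients at every point. -/
theorem integral_eq_sub_of_right_slope {g f : ℝ → ℝ} {a b : ℝ} (hab : a ≤ b)
    (hcont : ContinuousOn g (Icc a b)) {N : Set ℝ} (hN : N.Countable)
    (hbdd : ∀ x ∈ Ico a b, ∃ B, ∀ᶠ h in 𝓝[>] (0 : ℝ), |(g (x + h) - g x) / h| ≤ B)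
    (hderiv : ∀ x ∈ Ico a b, x ∉ N →
      Tendsto (fun h => (g (x + h) - g x) / h) (𝓝[>] 0) (𝓝 (f x)))
    (fint : IntegrableOn f (Icc a b)) :
    ∫ y in a..b, f y = g b - g a := by
  classical
  choose! B hB using hbdd
  have hshift : ∀ x : ℝ, Tendsto (fun u => u - x) (𝓝[>] x) (𝓝[>] 0) := by
    intro x
    refine tendsto_nhdsWithin_iff.2 ⟨?_, ?_⟩
    · have : Tendsto (fun u => u - x) (𝓝 x) (𝓝 (x - x)) := by
        exact (continuous_id.sub continuous_const).tendsto x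
      rw [sub_self] at this
      exact this.mono_left nhdsWithin_le_nhds
    · filter_upwards [self_mem_nhdsWithin] with u hu
      exact sub_pos.2 (mem_Ioi.1 hu)
  have key : ∀ (g f : ℝ → ℝ), ContinuousOn g (Icc a b) →
      (∀ x ∈ Ico a b, ∀ᶠ h in 𝓝[>] (0 : ℝ), |(g (x + h) - g x) / h| ≤ B x) →
      (∀ x ∈ Ico a b, x ∉ N →
        Tendsto (fun h => (g (x + h) - g x) / h) (𝓝[>] 0) (𝓝 (f x))) →
      IntegrableOn f (Icc a b) → g b - g a ≤ ∫ y in a..b, f y := by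
    intro g f hcont hB hderiv fint
    have hN0 : volume N = 0 := hN.measure_zero _
    have hae : ∀ᵐ x : ℝ, f x = if x ∈ N then B x else f x := by
      have : ∀ᵐ x : ℝ, x ∉ N := by rw [ae_iff]; simpa using hN0
      filter_upwards [this] with x hx
      simp [hx]
    -- Redefining `f` as the Dini bound `B` on the countable set does not change the integral, and
    -- makes the derivative condition true at every point.
    have h1 : ∫ y in a..b, f y = ∫ y in a..b, if y ∈ N then B y else f y :=
      intervalIntegral.integral_congr_ae (hae.mono fun x hx _ => hx)
    rw [h1]
    refine sub_le_integral_of_dini_le_Ico hab hcont (fun x hx c hc => ?_)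
      (fint.congr (ae_restrict_of_ae hae))
    have hev : ∀ᶠ h in 𝓝[>] (0 : ℝ), (g (x + h) - g x) / h ≤ c := by
      by_cases hxN : x ∈ N
      · simp only [hxN, if_true] at hc
        filter_upwards [hB x hx] with h hh
        exact (le_abs_self _).trans (hh.trans hc.le)
      · simp only [hxN, if_false] at hc
        filter_upwards [(hderiv x hx hxN).eventually (gt_mem_nhds hc)] with h hh
        exact le_of_lt hh
    filter_upwards [(hshift x).eventually hev, self_mem_nhdsWithin] with u hu hux
    have hpos : 0 < u - x := sub_pos.2 hux
    rw [div_le_iff₀ hpos] at hu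
    simp only [add_sub_cancel] at hu
    linarith
  refine le_antisymm ?_ (key g f hcont hB hderiv fint)
  -- The reverse inequality is the same one applied to `-g`.
  have := key (fun x => -g x) (fun x => -f x) hcont.neg
    (fun x hx => by
      filter_upwards [hB x hx] with h hh
      rw [← abs_neg]; convert hh using 2; ring)
    (fun x hx hxN => by
      refine ((hderiv x hx hxN).neg).congr fun h => ?_
      ring) fint.neg
  rw [intervalIntegral.integral_neg] at this
  linarith

end Generic

/-! ### Test functions -/

variable {d : ℕ}

/-- A bounded cut-off sequence of test functions increasing to one. -/
theorem exists_test_cutoff (n : ℕ) : ∃ χ : Rd d → ℝ, IsTest χ ∧ (∀ x, χ x ∈ Icc (0 : ℝ) 1) ∧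
    ∀ x ∈ Metric.closedBall (0 : Rd d) n, χ x = 1 := by
  let b : ContDiffBump (0 : Rd d) := ⟨n + 1, n + 2, by positivity, by linarith⟩
  refine ⟨b, ⟨b.contDiff, b.hasCompactSupport⟩, fun x => ⟨b.nonneg, b.le_one⟩, fun x hx => ?_⟩
  apply b.one_of_mem_closedBall
  exact Metric.closedBall_subset_closedBall (by simp [b]) hx

theorem IsTest.mul {f g : Rd d → ℝ} (hf : ContDiff ℝ (⊤ : ℕ∞) f) (hg : IsTest g) :
    IsTest fun x => g x * f x :=
  ⟨hg.1.mul hf, hg.2.mul_right⟩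

theorem IsTest.isBddMeas {f : Rd d → ℝ} (hf : IsTest f) : IsBddMeas f := by
  refine ⟨hf.1.continuous.measurable, ?_⟩
  obtain ⟨M, hM⟩ := hf.2.exists_bound_of_continuous hf.1.continuous
  exact ⟨M, hM⟩

theorem IsTest.integrable {f : Rd d → ℝ} (hf : IsTest f) : Integrable f :=
  hf.1.continuous.integrable_of_hasCompactSupport hf.2

/-- A property of bounded measurable functions which holds for test functions and is stable under
linear combinations and bounded pointwise limits holds for all bounded measurable functions. -/
theorem IsBddMeas.induction {C : (Rd d → ℝ) → Prop} (test : ∀ f, IsTest f → C f)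
    (add : ∀ f g : Rd d → ℝ, IsBddMeas f → IsBddMeas g → C f → C g → C fun x => f x + g x)
    (smul : ∀ (c : ℝ) (f : Rd d → ℝ), IsBddMeas f → C f → C fun x => c * f x)
    (lim : ∀ (F : ℕ → Rd d → ℝ) (f : Rd d → ℝ) (M : ℝ), (∀ n, Measurable (F n)) →
      (∀ n x, |F n x| ≤ M) → (∀ x, Tendsto (fun n => F n x) atTop (𝓝 (f x))) →
      (∀ n, C (F n)) → C f)
    {f : Rd d → ℝ} (hf : IsBddMeas f) : C f := by
  have hopen : ∀ U : Set (Rd d), IsOpen U → C (U.indicator fun _ => 1) := by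
    intro U hU
    obtain ⟨u, hsupp, hu, hr⟩ := hU.exists_contDiff_support_eq (n := (⊤ : ℕ∞))
    choose χ hχ hχ01 hχ1 using fun n : ℕ => exists_test_cutoff (d := d) n
    have hr' : ∀ x, u x ∈ Icc (0 : ℝ) 1 := fun x => hr (mem_range_self x)
    have hpow : ∀ (n : ℕ) x, (1 - u x) ^ n ∈ Icc (0 : ℝ) 1 := fun n x =>
      ⟨pow_nonneg (by linarith [(hr' x).2]) n,
        pow_le_one₀ (by linarith [(hr' x).2]) (by linarith [(hr' x).1])⟩
    -- As `u` is positive exactly on `U`, `1 - (1 - u)^n` tends to the indicator of `U`; the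
    -- cut-offs add compact support and are eventually one at each point.
    have hF : ∀ n : ℕ, IsTest fun x => χ n x * (1 - (1 - u x) ^ n) := fun n =>
      IsTest.mul (contDiff_const.sub ((contDiff_const.sub hu).pow n)) (hχ n)
    refine lim (fun n x => χ n x * (1 - (1 - u x) ^ n)) _ 1
      (fun n => (hF n).isBddMeas.1) (fun n x => ?_) (fun x => ?_) (fun n => test _ (hF n))
    · rw [abs_mul, abs_of_nonneg (hχ01 n x).1, abs_of_nonneg (by linarith [(hpow n x).2])]
      exact mul_le_one₀ (hχ01 n x).2 (by linarith [(hpow n x).2]) (by linarith [(hpow n x).1])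
    · by_cases hx : x ∈ U
      · rw [indicator_of_mem hx]
        have hux : u x ≠ 0 := by rw [← Function.mem_support, hsupp]; exact hx
        have hux' : 0 < u x := lt_of_le_of_ne (hr' x).1 hux.symm
        have h1 : Tendsto (fun n : ℕ => 1 - (1 - u x) ^ n) atTop (𝓝 (1 - 0)) :=
          tendsto_const_nhds.sub
            (tendsto_pow_atTop_nhds_zero_of_lt_one (by linarith [(hr' x).2]) (by linarith))
        rw [sub_zero] at h1
        refine h1.congr' ?_
        obtain ⟨k, hk⟩ := exists_nat_ge ‖x‖
        filter_upwards [eventually_ge_atTop k] with n hn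
        rw [hχ1 n x, one_mul]
        rw [mem_closedBall_zero_iff]
        exact hk.trans (by exact_mod_cast hn)
      · rw [indicator_of_notMem hx]
        have hux : u x = 0 := by
          by_contra h
          rw [← Ne, ← Function.mem_support, hsupp] at h
          exact hx h
        simp [hux]
  refine boundedMeasurable_induction (S := {s : Set (Rd d) | IsOpen s})
    BorelSpace.measurable_eq isPiSystem_isOpen ?_ (fun A hA => hopen A hA)
    (fun f g hf hg hfb hgb => add f g ⟨hf, hfb⟩ ⟨hg, hgb⟩) (fun c f hf hfb => smul c f ⟨hf, hfb⟩)
    lim f hf.1 hf.2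
  simpa using hopen univ isOpen_univ

/-- A continuous compactly supported function is a uniform limit of test functions. -/
theorem exists_test_approx {f : Rd d → ℝ} (hf : Continuous f) (hc : HasCompactSupport f) {ε : ℝ}
    (hε : 0 < ε) : ∃ g, IsTest g ∧ ∀ x, |g x - f x| ≤ ε := by
  obtain ⟨g, hg, hgf, hs⟩ := hf.exists_contDiff_approx (⊤ : ℕ∞) (ε := fun _ => ε)
    continuous_const fun _ => hε
  refine ⟨g, ⟨hg, hc.mono hs⟩, fun x => (hgf x).le⟩

/-- A sign function is approximated in `L¹` by test functions bounded by one. -/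
theorem exists_test_approx_sign (m : Measure (Rd d)) [IsFiniteMeasure m] {σ : Rd d → ℝ}
    (hσ : Measurable σ) (hσ1 : ∀ y, |σ y| = 1) {ε : ℝ} (hε : 0 < ε) :
    ∃ χ, IsTest χ ∧ (∀ y, |χ y| ≤ 1) ∧ m.real univ - ε ≤ ∫ y, χ y * σ y ∂m := by
  have hσi : Integrable σ m :=
    Integrable.of_bound hσ.aestronglyMeasurable 1 (Eventually.of_forall fun y => (hσ1 y).le)
  obtain ⟨g, hgc, hg, hgcont, hgi⟩ :=
    hσi.exists_hasCompactSupport_integral_sub_le (half_pos hε)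
  -- Half of `ε` is spent on the `L¹` error of `g`, the other half on `2δ` times the total mass.
  set δ : ℝ := ε / (4 * (m.real univ + 1)) with hδ
  have hm0 : 0 ≤ m.real univ := measureReal_nonneg
  have hδ0 : 0 < δ := by positivity
  set k : Rd d → ℝ := fun y => max (-1) (min 1 (g y)) with hk
  have hkcont : Continuous k := continuous_const.max (continuous_const.min hgcont)
  have hkc : HasCompactSupport k := hgc.comp_left (g := fun s => max (-1) (min 1 s)) (by simp)
  obtain ⟨u, hu, huk⟩ := exists_test_approx hkcont hkc hδ0
  have hk1 : ∀ y, |k y| ≤ 1 := fun y => by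
    rw [abs_le]; exact ⟨le_max_left _ _, max_le (by norm_num) (min_le_left _ _)⟩
  have hu1 : ∀ y, |u y| ≤ 1 + δ := fun y => by
    have := abs_sub_abs_le_abs_sub (u y) (k y)
    linarith [hk1 y, huk y]
  -- Clipping to `[-1,1]` is 1-Lipschitz and fixes `σ`, so it does not increase the distance to `σ`.
  have hσk : ∀ y, |σ y - k y| ≤ |σ y - g y| := by
    intro y
    have h1 : σ y = max (-1) (min 1 (σ y)) := by
      rcases (abs_eq zero_le_one).1 (hσ1 y) with h | h <;> simp [h]
    rw [h1, hk]
    dsimp only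
    refine (abs_max_sub_max_le_max _ _ _ _).trans ?_
    simp only [sub_self, abs_zero]
    refine max_le (abs_nonneg _) ?_
    refine (abs_min_sub_min_le_max _ _ _ _).trans ?_
    simp only [sub_self, abs_zero]
    rw [← h1]
    exact max_le (abs_nonneg _) le_rfl
  -- Smoothing may exceed one by `δ`; the factor `(1 + δ)⁻¹` restores the bound at the cost of
  -- another `δ`.
  have hχt : IsTest fun y => (1 + δ)⁻¹ * u y := by
    refine ⟨contDiff_const.mul hu.1, hu.2.mul_left⟩
  have hpt : ∀ y, 1 - (|σ y - g y| + 2 * δ) ≤ (1 + δ)⁻¹ * u y * σ y := by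
    intro y
    have h0 : 0 < 1 + δ := by linarith
    have h2 : |u y - (1 + δ)⁻¹ * u y| ≤ δ := by
      have : u y - (1 + δ)⁻¹ * u y = ((1 + δ)⁻¹ * δ) * u y := by field_simp; ring
      rw [this, abs_mul, abs_of_nonneg (by positivity : 0 ≤ (1 + δ)⁻¹ * δ)]
      calc (1 + δ)⁻¹ * δ * |u y| ≤ (1 + δ)⁻¹ * δ * (1 + δ) := by gcongr; exact hu1 y
        _ = δ := by field_simp
    have h3 : |σ y - (1 + δ)⁻¹ * u y| ≤ |σ y - g y| + 2 * δ := by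
      have e : σ y - (1 + δ)⁻¹ * u y = (σ y - k y) + (-(u y - k y)) + (u y - (1 + δ)⁻¹ * u y) := by
        ring
      rw [e]
      refine (abs_add_three _ _ _).trans ?_
      rw [abs_neg]
      linarith [hσk y, huk y]
    have h4 : (1 + δ)⁻¹ * u y * σ y = 1 - (σ y - (1 + δ)⁻¹ * u y) * σ y := by
      have : σ y * σ y = 1 := by rw [← abs_mul_abs_self, hσ1]; norm_num
      linear_combination this
    rw [h4]
    have h5 : (σ y - (1 + δ)⁻¹ * u y) * σ y ≤ |σ y - (1 + δ)⁻¹ * u y| := by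
      refine (le_abs_self _).trans ?_
      rw [abs_mul, hσ1, mul_one]
    linarith
  refine ⟨_, hχt, fun y => ?_, ?_⟩
  · rw [abs_mul, abs_of_nonneg (by positivity : 0 ≤ (1 + δ)⁻¹), inv_mul_le_iff₀ (by linarith)]
    linarith [hu1 y]
  · have hi1 : Integrable (fun y => |σ y - g y|) m := (hσi.sub hgi).abs
    have hi2 : Integrable (fun y => 1 - (|σ y - g y| + 2 * δ)) m :=
      (integrable_const _).sub (hi1.add (integrable_const _))
    have hi3 : Integrable (fun y => (1 + δ)⁻¹ * u y * σ y) m := by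
      refine Integrable.of_bound (hχt.isBddMeas.1.mul hσ).aestronglyMeasurable ((1 + δ)⁻¹ * (1 + δ))
        (Eventually.of_forall fun y => ?_)
      rw [Real.norm_eq_abs, abs_mul, hσ1, mul_one, abs_mul,
        abs_of_nonneg (by positivity : 0 ≤ (1 + δ)⁻¹)]
      gcongr
      exact hu1 y
    have := integral_mono hi2 hi3 hpt
    have e1 : ∫ y, (1 - (|σ y - g y| + 2 * δ)) ∂m
        = ∫ y, 1 ∂m - (∫ y, |σ y - g y| ∂m + ∫ y, 2 * δ ∂m) := by
      rw [← integral_add hi1 (integrable_const _)]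
      exact integral_sub (integrable_const _) (hi1.add (integrable_const _))
    rw [e1] at this
    simp only [integral_const, smul_eq_mul, mul_one] at this
    have h6 : m.real univ * (2 * δ) ≤ ε / 2 := by
      rw [hδ]
      rw [show m.real univ * (2 * (ε / (4 * (m.real univ + 1))))
        = (ε / 2) * (m.real univ / (m.real univ + 1)) by field_simp; ring]
      have : m.real univ / (m.real univ + 1) ≤ 1 := by
        rw [div_le_one (by positivity)]; linarith
      nlinarith
    simp only [Real.norm_eq_abs] at hg
    linarith

end Parametrix

namespace Parametrix

variable {d : ℕ} {T : ℝ} {P : ℝ → Rd d → SignedMeasure (Rd d)}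

/-! ### Bounded measurable functions and the operators of a signed kernel -/

theorem IsBddMeas.integrable {f : Rd d → ℝ} (hf : IsBddMeas f) (m : Measure (Rd d))
    [IsFiniteMeasure m] : Integrable f m := by
  obtain ⟨M, hM⟩ := hf.2
  exact Integrable.of_bound hf.1.aestronglyMeasurable M (Eventually.of_forall hM)

theorem IsBddMeas.add {f g : Rd d → ℝ} (hf : IsBddMeas f) (hg : IsBddMeas g) :
    IsBddMeas fun x => f x + g x := by
  obtain ⟨M, hM⟩ := hf.2
  obtain ⟨N, hN⟩ := hg.2
  exact ⟨hf.1.add hg.1, M + N, fun x => (abs_add_le _ _).trans (add_le_add (hM x) (hN x))⟩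

theorem IsBddMeas.const_mul {f : Rd d → ℝ} (c : ℝ) (hf : IsBddMeas f) :
    IsBddMeas fun x => c * f x := by
  obtain ⟨M, hM⟩ := hf.2
  refine ⟨hf.1.const_mul c, |c| * M, fun x => ?_⟩
  rw [abs_mul]
  exact mul_le_mul_of_nonneg_left (hM x) (abs_nonneg _)

theorem IsBddMeas.sub {f g : Rd d → ℝ} (hf : IsBddMeas f) (hg : IsBddMeas g) :
    IsBddMeas fun x => f x - g x := by
  simpa [sub_eq_add_neg] using hf.add (hg.const_mul (-1))

theorem IsBddMeas.mul {f g : Rd d → ℝ} (hf : IsBddMeas f) (hg : IsBddMeas g) :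
    IsBddMeas fun x => f x * g x := by
  obtain ⟨M, hM⟩ := hf.2
  obtain ⟨N, hN⟩ := hg.2
  refine ⟨hf.1.mul hg.1, M * N, fun x => ?_⟩
  rw [abs_mul]
  exact mul_le_mul (hM x) (hN x) (abs_nonneg _) ((abs_nonneg _).trans (hM x))

theorem op_add_fun {s : ℝ} {x : Rd d} {f g : Rd d → ℝ} (hf : IsBddMeas f) (hg : IsBddMeas g) :
    op P s (fun y => f y + g y) x = op P s f x + op P s g x :=
  VectorMeasure.integral_fun_add (hf.integrable _) (hg.integrable _)

theorem op_sub_fun {s : ℝ} {x : Rd d} {f g : Rd d → ℝ} (hf : IsBddMeas f) (hg : IsBddMeas g) :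
    op P s (fun y => f y - g y) x = op P s f x - op P s g x :=
  VectorMeasure.integral_fun_sub (hf.integrable _) (hg.integrable _)

theorem op_const_mul {s : ℝ} {x : Rd d} {f : Rd d → ℝ} (c : ℝ) :
    op P s (fun y => c * f y) x = c * op P s f x :=
  VectorMeasure.integral_fun_smul _ _ c f

theorem tendsto_op {ι : Type*} {l : Filter ι} [l.IsCountablyGenerated] {s : ℝ} {x : Rd d}
    {F : ι → Rd d → ℝ} {f : Rd d → ℝ} {M : ℝ} (hF : ∀ᶠ i in l, Measurable (F i))
    (hM : ∀ᶠ i in l, ∀ y, |F i y| ≤ M)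
    (hlim : ∀ y, Tendsto (fun i => F i y) l (𝓝 (f y))) :
    Tendsto (fun i => op P s (F i) x) l (𝓝 (op P s f x)) :=
  VectorMeasure.tendsto_integral_filter_of_norm_le_const
    (hF.mono fun _ hi => hi.aestronglyMeasurable)
    ⟨M, hM.mono fun _ hi => Eventually.of_forall hi⟩ (Eventually.of_forall hlim)

theorem abs_op_le_mul {s : ℝ} {x : Rd d} {f : Rd d → ℝ} {M : ℝ} (hM : ∀ y, |f y| ≤ M) :
    |op P s f x| ≤ M * (P s x).variation.real univ := by
  obtain ⟨σ, hσ, hσ1, hop⟩ := exists_sign_integral_eq (P s x)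
  rw [op, hop, ← Real.norm_eq_abs]
  refine norm_integral_le_of_norm_le_const (Eventually.of_forall fun y => ?_)
  rw [Real.norm_eq_abs, abs_mul, hσ1, mul_one]
  exact hM y

/-- The total mass of the variation of `P_s(x, ·)`. -/
noncomputable def varMass (P : ℝ → Rd d → SignedMeasure (Rd d)) (x : Rd d) (s : ℝ) : ℝ :=
  (P s x).variation.real univ

/-! ### Contraction, measurability and total mass of the signed kernel. -/

namespace IsSemigroup

variable (hP : IsSemigroup T P)

include hP

/-- Duality: the mass of the variation is the integral of a sign function against the signed
measure, and test functions bounded by one approximate that sign in `L¹`. Contraction on test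
functions thus already controls the whole variation, hence all bounded measurable functions. -/
theorem varMass_le_one {s : ℝ} (hs : s ∈ Icc 0 T) (x : Rd d) : varMass P x s ≤ 1 := by
  refine le_of_forall_pos_le_add fun ε hε => ?_
  obtain ⟨σ, hσ, hσ1, hop⟩ := exists_sign_integral_eq (P s x)
  obtain ⟨χ, hχ, hχ1, hle⟩ := exists_test_approx_sign (P s x).variation hσ hσ1 hε
  have h1 := hP.contraction χ hχ 1 hχ1 s hs x
  rw [op, hop] at h1
  have := (le_abs_self _).trans h1
  rw [varMass]
  linarith

theorem abs_op_le {s : ℝ} (hs : s ∈ Icc 0 T) {f : Rd d → ℝ} {M : ℝ} (hM : ∀ y, |f y| ≤ M)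
    (x : Rd d) : |op P s f x| ≤ M := by
  refine (abs_op_le_mul hM).trans ?_
  exact mul_le_of_le_one_right ((abs_nonneg _).trans (hM 0)) (hP.varMass_le_one hs x)

theorem measurable_op {α : Type*} [MeasurableSpace α] {s : α → ℝ} (hs : Measurable s)
    (hsT : ∀ a, s a ∈ Icc 0 T) {ξ : α → Rd d} (hξ : Measurable ξ) {f : Rd d → ℝ}
    (hf : IsBddMeas f) : Measurable fun a => op P (s a) f (ξ a) := by
  refine IsBddMeas.induction (C := fun f => Measurable fun a => op P (s a) f (ξ a)) ?_ ?_ ?_ ?_ hf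
  · intro f hf
    have h1 : Measurable fun a => ((⟨s a, hsT a⟩ : Icc (0 : ℝ) T), ξ a) :=
      (hs.subtype_mk).prodMk hξ
    have h2 := (hP.measurable f hf).comp h1
    exact h2
  · intro f g hf hg ihf ihg
    simp_rw [op_add_fun hf hg]
    exact ihf.add ihg
  · intro c f hf ih
    simp_rw [op_const_mul]
    exact ih.const_mul c
  · intro F f M hF hM hlim ih
    exact measurable_of_tendsto_metrizable ih (tendsto_pi_nhds.2 fun a =>
      tendsto_op (Eventually.of_forall hF) (Eventually.of_forall hM) hlim)

/-- Variables separate on rectangles, and the monotone class theorem on the product does the rest.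
The bound on `F (a, ·)` may depend on `a`: truncation at level `n` is eventually exact for each `a`.
-/
theorem measurable_op_param {α : Type*} [MeasurableSpace α] {s : α → ℝ} (hs : Measurable s)
    (hsT : ∀ a, s a ∈ Icc 0 T) {ξ : α → Rd d} (hξ : Measurable ξ) {F : α × Rd d → ℝ}
    (hF : Measurable F) (hFb : ∀ a, ∃ M, ∀ y, |F (a, y)| ≤ M) :
    Measurable fun a => op P (s a) (fun y => F (a, y)) (ξ a) := by
  classical
  have main : ∀ F : α × Rd d → ℝ, Measurable F → (∃ M, ∀ q, |F q| ≤ M) →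
      Measurable fun a => op P (s a) (fun y => F (a, y)) (ξ a) := by
    refine boundedMeasurable_induction generateFrom_prod.symm isPiSystem_prod ?_ ?_ ?_ ?_ ?_
    · exact hP.measurable_op hs hsT hξ (f := fun _ => 1) ⟨measurable_const, 1, by simp⟩
    · rintro _ ⟨A, hA, B, hB, rfl⟩
      have e : ∀ a, (fun y => (A ×ˢ B).indicator (fun _ => (1 : ℝ)) (a, y))
          = fun y => A.indicator (fun _ => (1 : ℝ)) a * B.indicator (fun _ => (1 : ℝ)) y := by
        intro a
        ext y
        by_cases ha : a ∈ A <;> by_cases hy : y ∈ B <;> simp [ha, hy]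
      simp_rw [e, op_const_mul]
      refine (measurable_const.indicator hA).mul (hP.measurable_op hs hsT hξ
        ⟨measurable_const.indicator hB, 1, fun y => ?_⟩)
      by_cases hy : y ∈ B <;> simp [hy]
    · rintro f g hf hg ⟨M, hM⟩ ⟨N, hN⟩ ihf ihg
      have e : ∀ a, op P (s a) (fun y => f (a, y) + g (a, y)) (ξ a)
          = op P (s a) (fun y => f (a, y)) (ξ a) + op P (s a) (fun y => g (a, y)) (ξ a) :=
        fun a => op_add_fun ⟨hf.comp measurable_prodMk_left, M, fun y => hM _⟩
          ⟨hg.comp measurable_prodMk_left, N, fun y => hN _⟩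
      simp_rw [e]
      exact ihf.add ihg
    · intro c f hf hfb ih
      simp_rw [op_const_mul]
      exact ih.const_mul c
    · intro G f M hG hM hlim ih
      exact measurable_of_tendsto_metrizable ih (tendsto_pi_nhds.2 fun a =>
        tendsto_op (Eventually.of_forall fun n => (hG n).comp measurable_prodMk_left)
          (Eventually.of_forall fun n y => hM n _) fun y => hlim _)
  refine measurable_of_tendsto_metrizable
    (f := fun (n : ℕ) a => op P (s a) (fun y => max (-(n : ℝ)) (min n (F (a, y)))) (ξ a))
    (fun n => main (fun q => max (-(n : ℝ)) (min n (F q)))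
      (measurable_const.max (measurable_const.min hF)) ⟨n, fun q => ?_⟩)
    (tendsto_pi_nhds.2 fun a => ?_)
  · rw [abs_le]
    exact ⟨le_max_left _ _, max_le (by linarith [(Nat.cast_nonneg n : (0 : ℝ) ≤ n)])
      (min_le_left _ _)⟩
  · obtain ⟨M, hM⟩ := hFb a
    obtain ⟨k, hk⟩ := exists_nat_ge M
    refine tendsto_const_nhds.congr' ?_
    filter_upwards [eventually_ge_atTop k] with n hn
    congr 1
    ext y
    have h1 := (hM y).trans (hk.trans (Nat.cast_le.2 hn))
    rw [abs_le] at h1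
    rw [min_eq_right h1.2, max_eq_right h1.1]

theorem isBddMeas_op {s : ℝ} (hs : s ∈ Icc 0 T) {f : Rd d → ℝ} (hf : IsBddMeas f) :
    IsBddMeas (op P s f) := by
  obtain ⟨M, hM⟩ := hf.2
  exact ⟨hP.measurable_op measurable_const (fun _ => hs) measurable_id hf, M, hP.abs_op_le hs hM⟩

/-- With `σ` the sign of `P_t(x,·)`, the mass at time `t` is `P_t σ = P_s (P_{t-s} σ)` and `|P_{t-s}
σ| ≤ 1`. Monotonicity is what later confines the discontinuities in time to a countable set. -/
theorem varMass_antitoneOn (x : Rd d) : AntitoneOn (varMass P x) (Icc 0 T) := by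
  intro s hs t ht hst
  obtain ⟨σ, hσ, hσ1, hop⟩ := exists_sign_integral_eq (P t x)
  have hσb : IsBddMeas σ := ⟨hσ, 1, fun y => (hσ1 y).le⟩
  have h1 : varMass P x t = op P t σ x := by
    rw [op, hop, varMass]
    have : ∀ y, σ y * σ y = 1 := fun y => by rw [← abs_mul_abs_self, hσ1]; norm_num
    simp [this]
  have hts : t - s ∈ Icc 0 T := ⟨by linarith, by linarith [hs.1, ht.2]⟩
  have h2 : op P t σ x = op P s (op P (t - s) σ) x := by
    rw [← hP.add s (t - s) hs.1 hts.1 σ hσb x, add_sub_cancel]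
  rw [h1, h2]
  refine (le_abs_self _).trans ((abs_op_le_mul (M := 1) fun y =>
    hP.abs_op_le hts (fun z => (hσ1 z).le) y).trans ?_)
  rw [one_mul, varMass]

omit hP in
-- Tail estimate: `1 - η ≤ 1 - |χ| ≤ 1 - χ σ`, so what `f` sees outside the cut-off is at most `M`
-- times the part of the mass not captured by `χ`. The right side involves only quantities whose
-- continuity in `s` can be controlled.
theorem abs_op_mul_one_sub_le {s : ℝ} {x : Rd d} {f χ η : Rd d → ℝ} {M : ℝ}
    (hM : ∀ y, |f y| ≤ M) (hχ : IsBddMeas χ) (hχη : ∀ y, |χ y| ≤ η y)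
    (hη1 : ∀ y, η y ≤ 1) :
    |op P s (fun y => f y * (1 - η y)) x| ≤ M * (varMass P x s - op P s χ x) := by
  obtain ⟨σ, hσ, hσ1, hop⟩ := exists_sign_integral_eq (P s x)
  rw [op, op, hop, hop, varMass]
  have hM0 : 0 ≤ M := (abs_nonneg _).trans (hM 0)
  have hσb : IsBddMeas σ := ⟨hσ, 1, fun y => (hσ1 y).le⟩
  have e : M * ((P s x).variation.real univ - ∫ y, χ y * σ y ∂(P s x).variation)
      = ∫ y, M * (1 - χ y * σ y) ∂(P s x).variation := by
    rw [integral_const_mul, integral_sub (integrable_const _) ((hχ.mul hσb).integrable _)]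
    simp
  rw [e, ← Real.norm_eq_abs]
  refine norm_integral_le_of_norm_le
    (((integrable_const 1).sub ((hχ.mul hσb).integrable _)).const_mul M)
    (Eventually.of_forall fun y => ?_)
  rw [Real.norm_eq_abs, abs_mul, hσ1, mul_one, abs_mul,
    abs_of_nonneg (a := 1 - η y) (by linarith [hη1 y])]
  refine mul_le_mul (hM y) ?_ (by linarith [hη1 y]) hM0
  have : χ y * σ y ≤ |χ y| := by
    refine (le_abs_self _).trans ?_
    rw [abs_mul, hσ1, mul_one]
  linarith [hχη y]

end IsSemigroup

/-! ### Generators -/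

theorem InDom.tendstoUniformly_gen {S : ℝ → (Rd d → ℝ) → Rd d → ℝ} {f : Rd d → ℝ}
    (hf : InDom S f) :
    TendstoUniformly (fun (h : ℝ) (x : Rd d) => (S h f x - f x) / h) (gen S f) (𝓝[>] 0) := by
  obtain ⟨-, g, hg⟩ := hf
  have : gen S f = g := by
    ext x
    exact (hg.tendsto_at x).limUnder_eq
  rwa [this]

/-- A single `h` at which the difference quotient is uniformly within one of the generator suffices
for boundedness, since contraction bounds that quotient by `2M/h`. The uniform limit then gives a
Lipschitz estimate at time zero. -/
theorem InDom.exists_gen_bound {S : ℝ → (Rd d → ℝ) → Rd d → ℝ} {f : Rd d → ℝ} (hT : 0 < T)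
    (hf : InDom S f)
    (hS : ∀ h ∈ Ioc 0 T, ∀ M, (∀ x, |f x| ≤ M) → ∀ x, |S h f x| ≤ M) :
    ∃ B, 0 ≤ B ∧ (∀ x, |gen S f x| ≤ B) ∧
      ∀ᶠ h in 𝓝[>] (0 : ℝ), ∀ x, |S h f x - f x| ≤ (B + 1) * h := by
  have hu := Metric.tendstoUniformly_iff.1 hf.tendstoUniformly_gen 1 one_pos
  have hIoc : ∀ᶠ h in 𝓝[>] (0 : ℝ), h ∈ Ioc 0 T := Ioc_mem_nhdsGT hT
  obtain ⟨h, hh, hhT⟩ := (hu.and hIoc).exists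
  obtain ⟨M, hM⟩ := hf.1.2
  have hM0 : 0 ≤ M := (abs_nonneg _).trans (hM 0)
  have hB : ∀ x, |gen S f x| ≤ 1 + (M + M) / h := by
    intro x
    have h1 := (hh x).le
    rw [Real.dist_eq] at h1
    have h2 : |(S h f x - f x) / h| ≤ (M + M) / h := by
      rw [abs_div, abs_of_pos hhT.1]
      refine div_le_div_of_nonneg_right ?_ hhT.1.le
      exact (abs_sub _ _).trans (add_le_add (hS h hhT M hM x) (hM x))
    have h3 := abs_sub_abs_le_abs_sub (gen S f x) ((S h f x - f x) / h)
    linarith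
  refine ⟨1 + (M + M) / h, by have := hhT.1; positivity, hB, ?_⟩
  filter_upwards [hu, hIoc] with k hk hkT x
  have h1 := (hk x).le
  rw [Real.dist_eq, abs_sub_comm] at h1
  have h3 := abs_sub_abs_le_abs_sub ((S k f x - f x) / k) (gen S f x)
  have h4 : |(S k f x - f x) / k| ≤ 1 + (M + M) / h + 1 := by linarith [hB x]
  rwa [abs_div, abs_of_pos hkT.1, div_le_iff₀ hkT.1] at h4

/-! ### Continuity in time of the semigroup. -/

namespace IsSemigroup

variable (hT : 0 < T) (hP : IsSemigroup T P)

include hT hP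

/-- `P_t f - P_s f = P_s (P_{t-s} f - f)`, and `P_s` is a contraction: the modulus at any time
reduces to the Lipschitz estimate at time zero. -/
theorem uniform_modulus {f : Rd d → ℝ} (hf : InDom (op P) f) {ε : ℝ} (hε : 0 < ε) :
    ∃ δ > 0, ∀ s ∈ Icc 0 T, ∀ t ∈ Icc 0 T, |t - s| < δ → ∀ x,
      |op P t f x - op P s f x| ≤ ε := by
  obtain ⟨B, hB0, -, hB⟩ := hf.exists_gen_bound hT
    fun h hh M hM x => hP.abs_op_le ⟨hh.1.le, hh.2⟩ hM x
  have hsm : ∀ᶠ h in 𝓝[>] (0 : ℝ), (B + 1) * h < ε := by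
    have : Tendsto (fun h : ℝ => (B + 1) * h) (𝓝[>] 0) (𝓝 0) := by
      have h1 : Tendsto (fun h : ℝ => (B + 1) * h) (𝓝 0) (𝓝 ((B + 1) * 0)) :=
        (continuous_const.mul continuous_id).tendsto 0
      rw [mul_zero] at h1
      exact h1.mono_left nhdsWithin_le_nhds
    exact this.eventually (gt_mem_nhds hε)
  obtain ⟨δ, hδ, hIoo⟩ := mem_nhdsGT_iff_exists_Ioo_subset.1 (hB.and hsm)
  have key : ∀ s ∈ Icc 0 T, ∀ t ∈ Icc 0 T, s < t → t - s < δ → ∀ x,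
      |op P t f x - op P s f x| ≤ ε := by
    intro s hs t ht hst hd x
    have hts : t - s ∈ Icc 0 T := ⟨by linarith, by linarith [hs.1, ht.2]⟩
    obtain ⟨h1, h2⟩ := hIoo (⟨by linarith, hd⟩ : t - s ∈ Ioo 0 δ)
    have e : op P t f x - op P s f x = op P s (fun y => op P (t - s) f y - f y) x := by
      rw [op_sub_fun (hP.isBddMeas_op hts hf.1) hf.1]
      have := hP.add s (t - s) hs.1 hts.1 f hf.1 x
      rw [add_sub_cancel] at this
      rw [this]
    rw [e]
    exact hP.abs_op_le hs (fun y => (h1 y).trans h2.le) x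
  refine ⟨δ, hδ, fun s hs t ht hd x => ?_⟩
  rcases lt_trichotomy s t with h | h | h
  · exact key s hs t ht h (by rwa [abs_of_pos (sub_pos.2 h)] at hd) x
  · simp [h, hε.le]
  · rw [abs_sub_comm]
    refine key t ht s hs h ?_ x
    rw [abs_sub_comm, abs_of_pos (sub_pos.2 h)] at hd
    exact hd

theorem continuousOn_op {f : Rd d → ℝ} (hf : InDom (op P) f) (x : Rd d) :
    ContinuousOn (fun s => op P s f x) (Icc 0 T) := by
  rw [Metric.continuousOn_iff]
  intro s hs ε hε
  obtain ⟨δ, hδ, h⟩ := hP.uniform_modulus hT hf (half_pos hε)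
  refine ⟨δ, hδ, fun t ht hd => ?_⟩
  rw [Real.dist_eq] at hd ⊢
  exact (h s hs t ht hd x).trans_lt (half_lt_self hε)

/-- At the continuity points of the total mass, `s ↦ P_s f(x)` is continuous for every bounded
continuous function `f`. -/
theorem tendsto_op_of_continuous {x : Rd d} {s₀ : ℝ} (hs₀ : s₀ ∈ Icc 0 T)
    (hm : ContinuousWithinAt (varMass P x) (Icc 0 T) s₀) {f : Rd d → ℝ} (hf : Continuous f)
    {M : ℝ} (hM : ∀ y, |f y| ≤ M) :
    Tendsto (fun s => op P s f x) (𝓝[Icc 0 T] s₀) (𝓝 (op P s₀ f x)) := by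
  have hM0 : 0 ≤ M := (abs_nonneg _).trans (hM 0)
  have hfb : IsBddMeas f := ⟨hf.measurable, M, hM⟩
  rw [Metric.tendsto_nhds]
  intro ε hε
  -- The estimates below cost `3Me + e` at time `s`, `Me + e` at time `s₀` and `e` for the test
  -- function `g`, in total `(4M + 3)e`.
  set e : ℝ := ε / (4 * M + 4) with he
  have he0 : 0 < e := by positivity
  have heε : (4 * M + 3) * e < ε := by
    rw [he, mul_div_assoc', div_lt_iff₀ (by positivity)]
    nlinarith
  obtain ⟨σ, hσ, hσ1, hop⟩ := exists_sign_integral_eq (P s₀ x)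
  obtain ⟨χ, hχ, hχ1, hle⟩ := exists_test_approx_sign (P s₀ x).variation hσ hσ1 he0
  rw [← hop] at hle
  change varMass P x s₀ - e ≤ op P s₀ χ x at hle
  obtain ⟨R, hR⟩ := hχ.2.isCompact.isBounded.subset_closedBall (0 : Rd d)
  obtain ⟨n, hn⟩ := exists_nat_ge R
  obtain ⟨η, hη, hη01, hη1⟩ := exists_test_cutoff (d := d) n
  have hχη : ∀ y, |χ y| ≤ η y := by
    intro y
    by_cases hy : y ∈ tsupport χ
    · rw [hη1 y (Metric.closedBall_subset_closedBall hn (hR hy))]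
      exact hχ1 y
    · rw [image_eq_zero_of_notMem_tsupport hy, abs_zero]
      exact (hη01 y).1
  obtain ⟨g, hg, hgf⟩ := exists_test_approx (f := fun y => f y * η y)
    (hf.mul hη.1.continuous) hη.2.mul_left he0
  have hfη : IsBddMeas fun y => f y * η y := hfb.mul hη.isBddMeas
  -- The part `f (1 - η)` is charged to the mass defect, and `f η` is uniformly close to the test
  -- function `g`.
  have hdec : ∀ s ∈ Icc 0 T, |op P s f x - op P s g x| ≤ M * (varMass P x s - op P s χ x) + e := by
    intro s hs
    have h1 : op P s f x - op P s g x
        = op P s (fun y => f y * (1 - η y)) x + op P s (fun y => f y * η y - g y) x := by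
      have hone : IsBddMeas fun y => f y * (1 - η y) := by
        have := hfb.sub hfη
        convert this using 2 with y
        ring
      rw [← op_sub_fun hfb hg.isBddMeas, ← op_add_fun hone (hfη.sub hg.isBddMeas)]
      congr 1
      ext y
      ring
    rw [h1]
    refine (abs_add_le _ _).trans (add_le_add ?_ ?_)
    · exact abs_op_mul_one_sub_le hM hχ.isBddMeas hχη fun y => (hη01 y).2
    · exact hP.abs_op_le hs (fun y => by rw [abs_sub_comm]; exact hgf y) x
  have c1 := hm.tendsto.eventually (gt_mem_nhds (lt_add_of_pos_right _ he0))
  have c2 := (hP.continuousOn_op hT (hP.test_dom χ hχ) x s₀ hs₀).tendsto.eventually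
    (lt_mem_nhds (sub_lt_self _ he0))
  have c3 := (hP.continuousOn_op hT (hP.test_dom g hg) x s₀ hs₀).tendsto.eventually
    (Metric.ball_mem_nhds _ he0)
  filter_upwards [c1, c2, c3, self_mem_nhdsWithin] with s h1 h2 h3 hs
  rw [Real.dist_eq] at h3
  rw [Real.dist_eq]
  have d1 := hdec s hs
  have d2 := hdec s₀ hs₀
  have d3 : M * (varMass P x s - op P s χ x) ≤ M * (3 * e) :=
    mul_le_mul_of_nonneg_left (by linarith) hM0
  have d4 : M * (varMass P x s₀ - op P s₀ χ x) ≤ M * e :=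
    mul_le_mul_of_nonneg_left (by linarith) hM0
  have e1 : op P s f x - op P s₀ f x = (op P s f x - op P s g x) + (op P s g x - op P s₀ g x)
      + (-(op P s₀ f x - op P s₀ g x)) := by ring
  rw [e1]
  refine lt_of_le_of_lt (abs_add_three _ _ _) ?_
  rw [abs_neg]
  nlinarith

/-- Off a countable set of times, `s ↦ P_s f(x)` is continuous for all bounded continuous `f`. -/
theorem exists_countable_tendsto_op (x : Rd d) :
    ∃ N : Set ℝ, N.Countable ∧ ∀ s₀ ∈ Icc 0 T, s₀ ∉ N → ∀ f : Rd d → ℝ, Continuous f →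
      (∃ M, ∀ y, |f y| ≤ M) →
      Tendsto (fun s => op P s f x) (𝓝[Icc 0 T] s₀) (𝓝 (op P s₀ f x)) := by
  refine ⟨{s ∈ Icc 0 T | ¬ContinuousWithinAt (varMass P x) (Icc 0 T) s},
    (hP.varMass_antitoneOn x).countable_not_continuousWithinAt, ?_⟩
  rintro s₀ hs₀ hN f hf ⟨M, hM⟩
  refine hP.tendsto_op_of_continuous hT hs₀ ?_ hf hM
  by_contra h
  exact hN ⟨hs₀, h⟩

end IsSemigroup

end Parametrix

namespace Parametrix

variable {d : ℕ} {T : ℝ} {P : ℝ → Rd d → SignedMeasure (Rd d)}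
  {p : ℝ → Rd d → Rd d → Rd d → ℝ} {θ : ℝ → Rd d → Rd d → ℝ}

/-! ### The frozen densities and the correction kernel -/

open Classical in
/-- The frozen density on the diagonal `p_t^y(x, y)`, extended by zero outside `(0, T]`. -/
noncomputable def diagDensity (T : ℝ) (p : ℝ → Rd d → Rd d → Rd d → ℝ) (t : ℝ) (x y : Rd d) : ℝ :=
  if t ∈ Ioc 0 T then p t y x y else 0

open Classical in
/-- The kernel `θ̂_t(w, y) φ_t^y(w)`, extended by zero outside `(0, T]`. -/
noncomputable def corrKernel (T : ℝ) (p : ℝ → Rd d → Rd d → Rd d → ℝ)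
    (θ : ℝ → Rd d → Rd d → ℝ) (t : ℝ) (w y : Rd d) : ℝ :=
  if t ∈ Ioc 0 T then θ t w y * phi p t y w else 0

/-- The operator `f ↦ ∫ f(y) p_t^y(x, y) dy`. -/
noncomputable def diagOp (T : ℝ) (p : ℝ → Rd d → Rd d → Rd d → ℝ) (t : ℝ) (f : Rd d → ℝ)
    (x : Rd d) : ℝ :=
  ∫ y, f y * diagDensity T p t x y

/-- The operator `f ↦ ∫ f(y) θ̂_t(w, y) φ_t^y(w) dy`. -/
noncomputable def corrOp (T : ℝ) (p : ℝ → Rd d → Rd d → Rd d → ℝ) (θ : ℝ → Rd d → Rd d → ℝ)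
    (t : ℝ) (f : Rd d → ℝ) (w : Rd d) : ℝ :=
  ∫ y, f y * corrKernel T p θ t w y

theorem diagDensity_of_mem {t : ℝ} (ht : t ∈ Ioc 0 T) (x y : Rd d) :
    diagDensity T p t x y = phi p t y x := if_pos ht

theorem diagDensity_of_notMem {t : ℝ} (ht : t ∉ Ioc 0 T) (x y : Rd d) :
    diagDensity T p t x y = 0 := if_neg ht

theorem corrKernel_of_mem {t : ℝ} (ht : t ∈ Ioc 0 T) (w y : Rd d) :
    corrKernel T p θ t w y = θ t w y * phi p t y w := if_pos ht

theorem corrKernel_of_notMem {t : ℝ} (ht : t ∉ Ioc 0 T) (w y : Rd d) :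
    corrKernel T p θ t w y = 0 := if_neg ht

namespace IsFrozenFamily

variable (hp : IsFrozenFamily T p)

include hp

theorem measurable_diagDensity :
    Measurable fun q : ℝ × Rd d × Rd d => diagDensity T p q.1 q.2.1 q.2.2 := by
  have hs : MeasurableSet {q : ℝ × Rd d × Rd d | q.1 ∈ Ioc 0 T} :=
    measurable_fst measurableSet_Ioc
  refine measurable_of_restrict_of_restrict_compl hs ?_ ?_
  · have h1 : Measurable fun q : {q : ℝ × Rd d × Rd d | q.1 ∈ Ioc 0 T} =>
        ((⟨q.1.1, q.2⟩ : Ioc (0 : ℝ) T), q.1.2.2, q.1.2.1, q.1.2.2) :=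
      ((measurable_fst.comp measurable_subtype_coe).subtype_mk).prodMk
        ((measurable_snd.comp (measurable_snd.comp measurable_subtype_coe)).prodMk
          (measurable_snd.comp measurable_subtype_coe))
    have h2 := hp.measurable.comp h1
    convert h2 using 1
    ext q
    exact diagDensity_of_mem q.2 _ _
  · convert (measurable_const : Measurable fun _ : ↥{q : ℝ × Rd d × Rd d | q.1 ∈ Ioc 0 T}ᶜ =>
      (0 : ℝ)) using 1
    ext q
    exact diagDensity_of_notMem q.2 _ _

theorem diagDensity_nonneg (t : ℝ) (x y : Rd d) : 0 ≤ diagDensity T p t x y := by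
  by_cases ht : t ∈ Ioc 0 T
  · rw [diagDensity_of_mem ht]
    exact hp.nonneg t ht _ _ _
  · rw [diagDensity_of_notMem ht]

theorem measurable_corrKernel (hθ : IsBackwardWeight T P p θ) :
    Measurable fun q : ℝ × Rd d × Rd d => corrKernel T p θ q.1 q.2.1 q.2.2 := by
  have hs : MeasurableSet {q : ℝ × Rd d × Rd d | q.1 ∈ Ioc 0 T} :=
    measurable_fst measurableSet_Ioc
  refine measurable_of_restrict_of_restrict_compl hs ?_ ?_
  · have hset : {q : ℝ × Rd d × Rd d | q.1 ∈ Ioc 0 T} = Ioc 0 T ×ˢ univ := by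
      ext q; simp
    have h1 : Measurable fun q : {q : ℝ × Rd d × Rd d | q.1 ∈ Ioc 0 T} =>
        θ q.1.1 q.1.2.1 q.1.2.2 := by
      have := hθ.continuous
      rw [← hset] at this
      exact (continuousOn_iff_continuous_domRestrict.1 this).measurable
    have h2 : Measurable fun q : {q : ℝ × Rd d × Rd d | q.1 ∈ Ioc 0 T} =>
        diagDensity T p q.1.1 q.1.2.1 q.1.2.2 :=
      hp.measurable_diagDensity.comp measurable_subtype_coe
    convert h1.mul h2 using 1
    ext q
    simp only [Set.domRestrict_apply, Pi.mul_apply]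
    rw [corrKernel_of_mem q.2, diagDensity_of_mem q.2]
  · convert (measurable_const : Measurable fun _ : ↥{q : ℝ × Rd d × Rd d | q.1 ∈ Ioc 0 T}ᶜ =>
      (0 : ℝ)) using 1
    ext q
    exact corrKernel_of_notMem q.2 _ _

theorem integrable_density {t : ℝ} (ht : t ∈ Ioc 0 T) (z x : Rd d) : Integrable (p t z x) :=
  Integrable.of_integral_ne_zero (by rw [hp.prob t ht z x]; exact one_ne_zero)

theorem abs_frozenOp_le {t : ℝ} (ht : t ∈ Ioc 0 T) (z : Rd d) {f : Rd d → ℝ} {M : ℝ}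
    (hM : ∀ y, |f y| ≤ M) (x : Rd d) : |frozenOp p z t f x| ≤ M := by
  have h1 : ∫ y, M * p t z x y = M := by
    rw [integral_const_mul, hp.prob t ht z x, mul_one]
  rw [← h1, frozenOp, ← Real.norm_eq_abs]
  refine norm_integral_le_of_norm_le ((hp.integrable_density ht z x).const_mul M)
    (Eventually.of_forall fun y => ?_)
  rw [Real.norm_eq_abs, abs_mul, abs_of_nonneg (hp.nonneg t ht z x y)]
  exact mul_le_mul_of_nonneg_right (hM y) (hp.nonneg t ht z x y)

theorem frozenOp_phi {h r : ℝ} (hh : 0 < h) (hr : 0 < r) (hhr : h + r ≤ T) (y x : Rd d) :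
    frozenOp p y h (phi p r y) x = phi p (h + r) y x := by
  rw [frozenOp, phi, (hp.chapman_kolmogorov h r hh hr hhr y x y).2]
  simp only [phi, mul_comm]

theorem continuous_phi {t : ℝ} (ht : t ∈ Ioc 0 T) (y : Rd d) : Continuous (phi p t y) := by
  have h1 : Continuous fun x : Rd d => ((t, x, y) : ℝ × Rd d × Rd d) := by fun_prop
  exact (hp.continuous y).comp_continuous h1 fun x => ⟨ht, mem_univ _⟩

theorem continuous_corrKernel (hθ : IsBackwardWeight T P p θ) (t : ℝ) (y : Rd d) :
    Continuous fun w => corrKernel T p θ t w y := by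
  by_cases ht : t ∈ Ioc 0 T
  · simp_rw [corrKernel_of_mem ht]
    have h1 : Continuous fun x : Rd d => ((t, x, y) : ℝ × Rd d × Rd d) := by fun_prop
    exact (hθ.continuous.comp_continuous h1 fun x => ⟨ht, mem_univ _⟩).mul
      (hp.continuous_phi ht y)
  · simp_rw [corrKernel_of_notMem ht]
    exact continuous_const

/-- Chapman–Kolmogorov factors the contraction `P^y_{r-ε}` out of both terms, so an increment at a
time `r ≥ ε` is controlled by the increment of the same length at time `ε`. -/
theorem abs_phi_sub_le (hreg : BackwardRegular T P p) {ε r r' : ℝ} (hε : 0 < ε) (hr : ε ≤ r)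
    (hrr' : r ≤ r') (hr' : r' ≤ T) (y : Rd d) {D : ℝ}
    (hD : ∀ x, |phi p (ε + (r' - r)) y x - phi p ε y x| ≤ D) (x : Rd d) :
    |phi p r' y x - phi p r y x| ≤ D := by
  rcases hrr'.eq_or_lt with rfl | hlt
  · simp only [sub_self, abs_zero, add_zero] at hD ⊢
    exact hD x
  -- The case `r = ε` is separate because `P^y_0` is not given by a density.
  rcases hr.eq_or_lt with rfl | hlt'
  · simpa using hD x
  have hmem : r - ε ∈ Ioc 0 T := ⟨by linarith, by linarith⟩
  have hb1 := (hreg.phi_dom (ε + (r' - r)) ⟨by linarith, by linarith⟩ y).1.1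
  have hb2 := (hreg.phi_dom ε ⟨hε, by linarith⟩ y).1.1
  have e1 := hp.frozenOp_phi (h := r - ε) (r := ε + (r' - r)) hmem.1 (by linarith)
    (by linarith) y x
  have e2 := hp.frozenOp_phi (h := r - ε) (r := ε) hmem.1 hε (by linarith) y x
  rw [show r - ε + (ε + (r' - r)) = r' by ring] at e1
  rw [sub_add_cancel] at e2
  have hint : ∀ f : Rd d → ℝ, IsBddMeas f → Integrable fun w => f w * p (r - ε) y x w := by
    rintro f ⟨hf, M, hM⟩
    exact (hp.integrable_density hmem y x).bdd_mul (c := M) hf.aestronglyMeasurable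
      (Eventually.of_forall hM)
  have e3 : phi p r' y x - phi p r y x
      = frozenOp p y (r - ε) (fun w => phi p (ε + (r' - r)) y w - phi p ε y w) x := by
    rw [← e1, ← e2, frozenOp, frozenOp, frozenOp, ← integral_sub (hint _ hb1) (hint _ hb2)]
    simp only [sub_mul]
  rw [e3]
  exact hp.abs_frozenOp_le hmem y hD x

/-- `φ_ε^y` lies in the domain of `L^y`, so its increments at time `ε` are Lipschitz in their
length; `abs_phi_sub_le` carries this to all later times. The modulus depends on `ε`, so the
singular time zero is approached only after integration in `y`. -/
theorem phi_uniform_modulus (hT : 0 < T) (hreg : BackwardRegular T P p) {ε : ℝ}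
    (hε : ε ∈ Ioc 0 T) (y : Rd d) {η : ℝ} (hη : 0 < η) :
    ∃ δ > 0, ∀ r ∈ Icc ε T, ∀ r' ∈ Icc ε T, |r' - r| < δ → ∀ x,
      |phi p r' y x - phi p r y x| ≤ η := by
  obtain ⟨B, hB0, -, hB⟩ := ((hreg.phi_dom ε hε y).2 y).exists_gen_bound hT
    fun h hh M hM x => hp.abs_frozenOp_le hh y hM x
  have hsm : ∀ᶠ h in 𝓝[>] (0 : ℝ), (B + 1) * h < η := by
    have : Tendsto (fun h : ℝ => (B + 1) * h) (𝓝[>] 0) (𝓝 0) := by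
      have h1 : Tendsto (fun h : ℝ => (B + 1) * h) (𝓝 0) (𝓝 ((B + 1) * 0)) :=
        (continuous_const.mul continuous_id).tendsto 0
      rw [mul_zero] at h1
      exact h1.mono_left nhdsWithin_le_nhds
    exact this.eventually (gt_mem_nhds hη)
  obtain ⟨δ, hδ, hIoo⟩ := mem_nhdsGT_iff_exists_Ioo_subset.1 (hB.and hsm)
  have key : ∀ r ∈ Icc ε T, ∀ r' ∈ Icc ε T, r < r' → r' - r < δ → ∀ x,
      |phi p r' y x - phi p r y x| ≤ η := by
    intro r hr r' hr' hlt hd x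
    refine hp.abs_phi_sub_le hreg hε.1 hr.1 hlt.le hr'.2 y (fun w => ?_) x
    obtain ⟨h1, h2⟩ := hIoo (⟨by linarith, hd⟩ : r' - r ∈ Ioo 0 δ)
    have := h1 w
    rw [hp.frozenOp_phi (by linarith) hε.1 (by linarith [hr.1, hr'.2]), add_comm] at this
    exact this.trans h2.le
  refine ⟨δ, hδ, fun r hr r' hr' hd x => ?_⟩
  rcases lt_trichotomy r r' with h | h | h
  · exact key r hr r' hr' h (by rwa [abs_of_pos (sub_pos.2 h)] at hd) x
  · simp [h, hη.le]
  · rw [abs_sub_comm]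
    refine key r' hr' r hr h ?_ x
    rw [abs_sub_comm, abs_of_pos (sub_pos.2 h)] at hd
    exact hd

end IsFrozenFamily

/-! ### The fundamental theorem of calculus along `r ↦ P_{u-r} φ_r^y` -/

section FixedPoint

variable (hT : 0 < T) (hP : IsSemigroup T P) (hp : IsFrozenFamily T p)
  (hL : GeneratorsAgree T P p) (hreg : BackwardRegular T P p) (hθ : IsBackwardWeight T P p θ)

include hL hθ in
-- This is where freezing at the arrival point pays: at `w` the generator `L` may be replaced by
-- `L^w`, and `θ̂` measures the difference between `L^w` and `L^y`.
theorem gen_sub_gen_phi {r : ℝ} (hr : r ∈ Ioc 0 T) (y w : Rd d) :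
    gen (op P) (phi p r y) w - gen (frozenOp p y) (phi p r y) w = corrKernel T p θ r w y := by
  rw [hL.phi r hr y w, hθ.weight r hr w y, corrKernel_of_mem hr]

include hT hP hp hL hreg hθ

/-- No pointwise bound on `θ̂` is needed: the kernel is a difference of two generators applied to
`φ_r^y`, and each is bounded on its domain. -/
theorem exists_corrKernel_bound (r : ℝ) (y : Rd d) :
    ∃ B, ∀ w, |corrKernel T p θ r w y| ≤ B := by
  by_cases hr : r ∈ Ioc 0 T
  · obtain ⟨h1, h2⟩ := hreg.phi_dom r hr y
    obtain ⟨B, -, hB, -⟩ := h1.exists_gen_bound hT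
      fun h hh M hM x => hP.abs_op_le ⟨hh.1.le, hh.2⟩ hM x
    obtain ⟨B', -, hB', -⟩ := (h2 y).exists_gen_bound hT
      fun h hh M hM x => hp.abs_frozenOp_le hh y hM x
    refine ⟨B + B', fun w => ?_⟩
    rw [← gen_sub_gen_phi hL hθ hr]
    exact (abs_sub _ _).trans (add_le_add (hB w) (hB' w))
  · exact ⟨0, fun w => by simp [corrKernel_of_notMem hr]⟩

theorem isBddMeas_corrKernel (r : ℝ) (y : Rd d) : IsBddMeas fun w => corrKernel T p θ r w y :=
  ⟨(hp.continuous_corrKernel hθ r y).measurable, exists_corrKernel_bound hT hP hp hL hreg hθ r y⟩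

omit hL hθ in
-- Move one factor at a time: `φ_r^y` varies uniformly on `[ε, T]` under a contraction, and the
-- semigroup varies uniformly on the fixed function `φ_r^y` of its domain.
theorem continuousOn_op_phi {ε u : ℝ} (hε : 0 < ε) (hu : u ≤ T) (x y : Rd d) :
    ContinuousOn (fun r => op P (u - r) (phi p r y) x) (Icc ε u) := by
  rw [Metric.continuousOn_iff]
  intro r hr η hη
  have hεT : ε ∈ Ioc 0 T := ⟨hε, by linarith [hr.1, hr.2]⟩
  obtain ⟨δ₁, hδ₁, h1⟩ := hp.phi_uniform_modulus hT hreg hεT y (by positivity : 0 < η / 3)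
  have hrT : r ∈ Ioc 0 T := ⟨by linarith [hr.1], by linarith [hr.2]⟩
  obtain ⟨δ₂, hδ₂, h2⟩ := hP.uniform_modulus hT (hreg.phi_dom r hrT y).1
    (by positivity : 0 < η / 3)
  refine ⟨min δ₁ δ₂, lt_min hδ₁ hδ₂, fun r' hr' hd => ?_⟩
  rw [Real.dist_eq] at hd ⊢
  have hr'T : r' ∈ Ioc 0 T := ⟨by linarith [hr'.1], by linarith [hr'.2]⟩
  have hs : u - r ∈ Icc 0 T := ⟨by linarith [hr.2], by linarith [hr.1]⟩
  have hs' : u - r' ∈ Icc 0 T := ⟨by linarith [hr'.2], by linarith [hr'.1]⟩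
  have e : op P (u - r') (phi p r' y) x - op P (u - r) (phi p r y) x
      = op P (u - r') (fun w => phi p r' y w - phi p r y w) x
        + (op P (u - r') (phi p r y) x - op P (u - r) (phi p r y) x) := by
    rw [op_sub_fun (hreg.phi_dom r' hr'T y).1.1 (hreg.phi_dom r hrT y).1.1]
    ring
  rw [e]
  have a1 := hP.abs_op_le hs' (h1 r ⟨hr.1, hrT.2⟩ r' ⟨hr'.1, hr'T.2⟩
    (hd.trans_le (min_le_left _ _))) x
  have a2 := h2 (u - r) hs (u - r') hs' (by
    rw [show u - r' - (u - r) = -(r' - r) by ring, abs_neg]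
    exact hd.trans_le (min_le_right _ _)) x
  have := abs_add_le (op P (u - r') (fun w => phi p r' y w - phi p r y w) x)
    (op P (u - r') (phi p r y) x - op P (u - r) (phi p r y) x)
  linarith

/-- Since `P_{u-r} = P_{u-r-h} P_h`, the left side is `P_{u-r-h}` of the difference between the
errors of two generator quotients, and both errors tend to zero uniformly. The correction is kept
under `P_{u-r-h}` rather than `P_{u-r}`, so continuity of `P` in time is not needed yet. -/
theorem eventually_slope_close {r u : ℝ} (hr : 0 < r) (hru : r < u) (hu : u ≤ T) (x y : Rd d)
    {η : ℝ} (hη : 0 < η) :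
    ∀ᶠ h in 𝓝[>] (0 : ℝ), |(op P (u - (r + h)) (phi p (r + h) y) x - op P (u - r) (phi p r y) x) / h
      + op P (u - (r + h)) (fun w => corrKernel T p θ r w y) x| ≤ η := by
  have hrT : r ∈ Ioc 0 T := ⟨hr, by linarith⟩
  obtain ⟨hd1, hd2⟩ := hreg.phi_dom r hrT y
  have u1 := Metric.tendstoUniformly_iff.1 hd1.tendstoUniformly_gen (η / 2) (by positivity)
  have u2 := Metric.tendstoUniformly_iff.1 (hd2 y).tendstoUniformly_gen (η / 2) (by positivity)
  have hIoc : ∀ᶠ h in 𝓝[>] (0 : ℝ), h ∈ Ioc 0 (u - r) := Ioc_mem_nhdsGT (by linarith)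
  filter_upwards [u1, u2, hIoc] with h h1 h2 hh
  have hhT : h ∈ Icc 0 T := ⟨hh.1.le, by linarith [hh.2]⟩
  have hs : u - (r + h) ∈ Icc 0 T := ⟨by linarith [hh.2], by linarith [hh.1]⟩
  have hrh : r + h ∈ Ioc 0 T := ⟨by linarith [hh.1], by linarith [hh.2]⟩
  have hbφ := hd1.1
  have hbφ' := (hreg.phi_dom (r + h) hrh y).1.1
  have hbP := hP.isBddMeas_op hhT hbφ
  have hba := isBddMeas_corrKernel hT hP hp hL hreg hθ r y
  have e1 : op P (u - r) (phi p r y) x = op P (u - (r + h)) (op P h (phi p r y)) x := by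
    rw [← hP.add _ _ hs.1 hhT.1 _ hbφ x]
    congr 1
    ring
  have e2 : (op P (u - (r + h)) (phi p (r + h) y) x - op P (u - r) (phi p r y) x) / h
      + op P (u - (r + h)) (fun w => corrKernel T p θ r w y) x
      = op P (u - (r + h)) (fun w => h⁻¹ * (phi p (r + h) y w - op P h (phi p r y) w)
        + corrKernel T p θ r w y) x := by
    rw [op_add_fun ((hbφ'.sub hbP).const_mul _) hba, op_const_mul, op_sub_fun hbφ' hbP, e1]
    ring
  rw [e2]
  refine hP.abs_op_le hs (fun w => ?_) x
  rw [← gen_sub_gen_phi hL hθ hrT, add_comm r h, ← hp.frozenOp_phi hh.1 hr (by linarith [hh.2])]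
  have b1 := h1 w
  have b2 := h2 w
  rw [Real.dist_eq] at b1 b2
  have e3 : h⁻¹ * (frozenOp p y h (phi p r y) w - op P h (phi p r y) w)
      + (gen (op P) (phi p r y) w - gen (frozenOp p y) (phi p r y) w)
      = (gen (op P) (phi p r y) w - (op P h (phi p r y) w - phi p r y w) / h)
        - (gen (frozenOp p y) (phi p r y) w
          - (frozenOp p y h (phi p r y) w - phi p r y w) / h) := by
    ring
  rw [e3]
  refine (abs_sub _ _).trans ?_
  linarith

/-- Duhamel's formula for one frozen density `φ^y`, when the correction term is integrable. -/
theorem op_phi_sub_phi_eq {ε u : ℝ} (hε : 0 < ε) (hεu : ε ≤ u) (hu : u ≤ T) (x y : Rd d)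
    (hint : IntegrableOn (fun r => op P (u - r) (fun w => corrKernel T p θ r w y) x) (Icc ε u)) :
    op P (u - ε) (phi p ε y) x - phi p u y x
      = ∫ r in ε..u, op P (u - r) (fun w => corrKernel T p θ r w y) x := by
  obtain ⟨N, hN, hcont⟩ := hP.exists_countable_tendsto_op hT x
  -- The exceptional times concern `u - r`, hence the reflected set.
  have hFTC := integral_eq_sub_of_right_slope hεu (continuousOn_op_phi hT hP hp hreg hε hu x y)
    (N := (fun s => u - s) '' N) (hN.image _)
    (f := fun r => -op P (u - r) (fun w => corrKernel T p θ r w y) x) ?_ ?_ hint.neg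
  · rw [intervalIntegral.integral_neg, sub_self,
      hP.zero _ (hreg.phi_dom u ⟨by linarith, hu⟩ y).1.1] at hFTC
    linarith
  · intro r hr
    have hr0 : 0 < r := by linarith [hr.1]
    obtain ⟨B, hB⟩ := exists_corrKernel_bound hT hP hp hL hreg hθ r y
    -- Even at an exceptional time the slope is within one of a quantity bounded by `B`.
    refine ⟨B + 1, ?_⟩
    have hIoc : ∀ᶠ h in 𝓝[>] (0 : ℝ), h ∈ Ioc 0 (u - r) := Ioc_mem_nhdsGT (by linarith [hr.2])
    filter_upwards [eventually_slope_close hT hP hp hL hreg hθ hr0 hr.2 hu x y one_pos, hIoc]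
      with h h1 hh
    have hs : u - (r + h) ∈ Icc 0 T := ⟨by linarith [hh.2], by linarith [hh.1]⟩
    have h2 := hP.abs_op_le hs hB x
    have h3 := abs_sub_abs_le_abs_add
      ((op P (u - (r + h)) (phi p (r + h) y) x - op P (u - r) (phi p r y) x) / h)
      (op P (u - (r + h)) (fun w => corrKernel T p θ r w y) x)
    linarith
  · intro r hr hrN
    have hr0 : 0 < r := by linarith [hr.1]
    have hur : u - r ∈ Icc 0 T := ⟨by linarith [hr.2], by linarith [hr.1]⟩
    have hurN : u - r ∉ N := fun h => hrN ⟨u - r, h, by simp⟩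
    have hIoc : ∀ᶠ h in 𝓝[>] (0 : ℝ), h ∈ Ioc 0 (u - r) := Ioc_mem_nhdsGT (by linarith [hr.2])
    have hlim := hcont (u - r) hur hurN _ (hp.continuous_corrKernel hθ r y)
      (exists_corrKernel_bound hT hP hp hL hreg hθ r y)
    have hmap : Tendsto (fun h => u - (r + h)) (𝓝[>] (0 : ℝ)) (𝓝[Icc 0 T] (u - r)) := by
      refine tendsto_nhdsWithin_iff.2 ⟨?_, ?_⟩
      · have : Tendsto (fun h : ℝ => u - (r + h)) (𝓝 0) (𝓝 (u - (r + 0))) :=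
          (by fun_prop : Continuous fun h : ℝ => u - (r + h)).tendsto 0
        rw [add_zero] at this
        exact this.mono_left nhdsWithin_le_nhds
      · filter_upwards [hIoc] with h hh
        exact ⟨by linarith [hh.2], by linarith [hh.1]⟩
    have hsum : Tendsto (fun h =>
        (op P (u - (r + h)) (phi p (r + h) y) x - op P (u - r) (phi p r y) x) / h
          + op P (u - (r + h)) (fun w => corrKernel T p θ r w y) x) (𝓝[>] 0) (𝓝 0) := by
      rw [Metric.tendsto_nhds]
      intro η hη
      filter_upwards [eventually_slope_close hT hP hp hL hreg hθ hr0 hr.2 hu x y (half_pos hη)]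
        with h hh
      rw [Real.dist_eq, sub_zero]
      exact hh.trans_lt (half_lt_self hη)
    have := hsum.sub (hlim.comp hmap)
    simpa using this

end FixedPoint

end Parametrix

namespace Parametrix

variable {d : ℕ} {T : ℝ} {P : ℝ → Rd d → SignedMeasure (Rd d)}
  {p : ℝ → Rd d → Rd d → Rd d → ℝ} {θ : ℝ → Rd d → Rd d → ℝ} {ρ c : ℝ}

/-! ### Bounds for the correction kernel -/

open Classical in
/-- The singular rate `c r^{-ρ}` on `(0, T]`, extended by zero. -/
noncomputable def rate (T ρ c r : ℝ) : ℝ := if r ∈ Ioc 0 T then c * r ^ (-ρ) else 0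

/-- The consequences of the kernel bound which are used: the correction kernel has marginal
integrals of order `r^{-ρ}` and maps test functions to continuous functions. -/
structure CorrBound (T : ℝ) (p : ℝ → Rd d → Rd d → Rd d → ℝ) (θ : ℝ → Rd d → Rd d → ℝ)
    (ρ c : ℝ) : Prop where
  rho_lt_one : ρ < 1
  nonneg : 0 ≤ c
  row : ∀ r w, ∫⁻ y, ‖corrKernel T p θ r w y‖ₑ ≤ ENNReal.ofReal (rate T ρ c r)
  col : ∀ r y, ∫⁻ w, ‖corrKernel T p θ r w y‖ₑ ≤ ENNReal.ofReal (rate T ρ c r)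
  continuous_corrOp : ∀ f : Rd d → ℝ, IsTest f → ∀ r, Continuous (corrOp T p θ r f)

theorem CorrBound.rate_nonneg (hb : CorrBound T p θ ρ c) (r : ℝ) : 0 ≤ rate T ρ c r := by
  unfold rate
  split_ifs with h
  · exact mul_nonneg hb.nonneg (Real.rpow_nonneg h.1.le _)
  · exact le_rfl

theorem CorrBound.integrable_rate (hT : 0 < T) (hb : CorrBound T p θ ρ c) :
    Integrable (rate T ρ c) := by
  have h1 : IntegrableOn (fun r : ℝ => c * r ^ (-ρ)) (Ioc 0 T) := by
    have := (intervalIntegral.intervalIntegrable_rpow' (a := 0) (b := T) (r := -ρ)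
      (by linarith [hb.rho_lt_one]))
    rw [intervalIntegrable_iff_integrableOn_Ioc_of_le hT.le] at this
    exact this.const_mul c
  rw [← integrable_indicator_iff measurableSet_Ioc] at h1
  refine h1.congr (Eventually.of_forall fun r => ?_)
  by_cases hr : r ∈ Ioc 0 T
  · rw [indicator_of_mem hr, rate, if_pos hr]
  · rw [indicator_of_notMem hr, rate, if_neg hr]

/-- Beyond level `N`, write `|a| = |a|^{1-ζ} |a|^ζ` and use that `1 - ζ` is negative. This is the
uniform integrability estimate behind the moment condition. -/
theorem abs_sub_clip_le {a N ζ : ℝ} (hN : 0 < N) (hζ : 1 < ζ) :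
    |a - max (-N) (min N a)| ≤ N ^ (1 - ζ) * |a| ^ ζ := by
  by_cases ha : |a| ≤ N
  · rw [abs_le] at ha
    rw [min_eq_right ha.2, max_eq_right ha.1, sub_self, abs_zero]
    positivity
  · push Not at ha
    have ha0 : 0 < |a| := hN.trans ha
    have h1 : |a - max (-N) (min N a)| ≤ |a| := by
      rcases le_total 0 a with h | h
      · rw [abs_of_nonneg h] at ha ⊢
        rw [min_eq_left ha.le, max_eq_right (by linarith), abs_of_nonneg (by linarith)]
        linarith
      · rw [abs_of_nonpos h] at ha ⊢
        rw [min_eq_right (by linarith), max_eq_left (by linarith), abs_of_nonpos (by linarith)]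
        linarith
    refine h1.trans ?_
    have h2 : |a| = |a| ^ (1 - ζ) * |a| ^ ζ := by
      rw [← Real.rpow_add ha0]; simp
    calc |a| = |a| ^ (1 - ζ) * |a| ^ ζ := h2
      _ ≤ N ^ (1 - ζ) * |a| ^ ζ := mul_le_mul_of_nonneg_right
          (Real.rpow_le_rpow_of_nonpos hN ha.le (by linarith)) (by positivity)

/-- The marginal bounds are immediate; continuity of `corrOp` on test functions is the point. A
kernel truncated at height `n + 1` gives continuous functions by dominated convergence, and the
local `ζ`-moments, used on the support of `f`, make the truncation error uniform in `w`. -/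
theorem exists_corrBound (hp : IsFrozenFamily T p) (hθ : IsBackwardWeight T P p θ)
    (hker : HasBackwardKernelBound T p θ) : ∃ ρ c, CorrBound T p θ ρ c := by
  obtain ⟨ρ, C, ζ, γ, hρ0, hρ1, hC, hζ, -, hγm, hγ0, hle, ⟨K₁, hK₁⟩, ⟨K₂, hK₂⟩, hloc⟩ := hker
  set K : ℝ≥0 := max K₁ K₂
  -- The arguments are transposed: `γ_t(y,w)` bounds the kernel at `(w,y)`, so rows use `K₂` and
  -- columns use `K₁`.
  have hen : ∀ {t : ℝ}, t ∈ Ioc 0 T → ∀ w y, ‖corrKernel T p θ t w y‖ₑ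
      ≤ ENNReal.ofReal (C / t ^ ρ) * ENNReal.ofReal (γ t y w) := by
    intro t ht w y
    have h0 : 0 ≤ C / t ^ ρ := div_nonneg hC.le (Real.rpow_nonneg ht.1.le _)
    rw [corrKernel_of_mem ht, ← ofReal_norm, ← ENNReal.ofReal_mul h0, Real.norm_eq_abs]
    exact ENNReal.ofReal_le_ofReal (hle t ht y w)
  have hrate : ∀ {t : ℝ}, t ∈ Ioc 0 T → ENNReal.ofReal (C / t ^ ρ) * K
      = ENNReal.ofReal (rate T ρ (C * K) t) := by
    intro t ht
    have h0 : 0 ≤ C / t ^ ρ := div_nonneg hC.le (Real.rpow_nonneg ht.1.le _)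
    rw [rate, if_pos ht, ← ENNReal.ofReal_coe_nnreal (p := K), ← ENNReal.ofReal_mul h0,
      Real.rpow_neg ht.1.le]
    congr 1
    ring
  refine ⟨ρ, C * K, hρ1, by positivity, fun r w => ?_, fun r y => ?_, fun f hf r => ?_⟩
  · by_cases hr : r ∈ Ioc 0 T
    · calc ∫⁻ y, ‖corrKernel T p θ r w y‖ₑ
          ≤ ∫⁻ y, ENNReal.ofReal (C / r ^ ρ) * ENNReal.ofReal (γ r y w) :=
            lintegral_mono fun y => hen hr w y
        _ = ENNReal.ofReal (C / r ^ ρ) * ∫⁻ y, ENNReal.ofReal (γ r y w) :=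
            lintegral_const_mul' _ _ ENNReal.ofReal_ne_top
        _ ≤ ENNReal.ofReal (C / r ^ ρ) * K := by
            gcongr
            exact (hK₂ r hr w).trans (by exact_mod_cast le_max_right K₁ K₂)
        _ = _ := hrate hr
    · simp [corrKernel_of_notMem hr]
  · by_cases hr : r ∈ Ioc 0 T
    · calc ∫⁻ w, ‖corrKernel T p θ r w y‖ₑ
          ≤ ∫⁻ w, ENNReal.ofReal (C / r ^ ρ) * ENNReal.ofReal (γ r y w) :=
            lintegral_mono fun w => hen hr w y
        _ = ENNReal.ofReal (C / r ^ ρ) * ∫⁻ w, ENNReal.ofReal (γ r y w) :=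
            lintegral_const_mul' _ _ ENNReal.ofReal_ne_top
        _ ≤ ENNReal.ofReal (C / r ^ ρ) * K := by
            gcongr
            exact (hK₁ r hr y).trans (by exact_mod_cast le_max_left K₁ K₂)
        _ = _ := hrate hr
    · simp [corrKernel_of_notMem hr]
  · by_cases hr : r ∈ Ioc 0 T
    swap
    · have : corrOp T p θ r f = fun _ => 0 := by
        ext w
        simp [corrOp, corrKernel_of_notMem hr]
      rw [this]
      exact continuous_const
    have hmeas : ∀ w, Measurable fun y => corrKernel T p θ r w y := fun w =>
      (hp.measurable_corrKernel hθ).comp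
        (measurable_const.prodMk (measurable_const.prodMk measurable_id))
    obtain ⟨M, hM⟩ := hf.isBddMeas.2
    have hM0 : 0 ≤ M := (abs_nonneg _).trans (hM 0)
    obtain ⟨R₀, hR₀⟩ := hf.2.isCompact.isBounded.subset_closedBall (0 : Rd d)
    set R := max R₀ 1
    have hR : tsupport f ⊆ Metric.closedBall 0 R :=
      hR₀.trans (Metric.closedBall_subset_closedBall (le_max_left _ _))
    obtain ⟨K₃, hK₃⟩ := hloc R (lt_max_of_lt_right one_pos)
    set clip : ℕ → ℝ → ℝ := fun n a => max (-((n : ℝ) + 1)) (min ((n : ℝ) + 1) a)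
    have hclipc : ∀ n, Continuous (clip n) := fun n =>
      continuous_const.max (continuous_const.min continuous_id)
    have hclip : ∀ n a, |clip n a| ≤ (n : ℝ) + 1 := fun n a => by
      have hn : (0 : ℝ) ≤ n := Nat.cast_nonneg n
      rw [abs_le]
      exact ⟨le_max_left _ _, max_le (by linarith) (min_le_left _ _)⟩
    have hcont : ∀ n, Continuous fun w => ∫ y, f y * clip n (corrKernel T p θ r w y) := by
      intro n
      refine continuous_of_dominated (bound := fun y => ‖f y‖ * ((n : ℝ) + 1)) (fun w => ?_)
        (fun w => Eventually.of_forall fun y => ?_) (hf.integrable.norm.mul_const _)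
        (Eventually.of_forall fun y => ?_)
      · exact (hf.isBddMeas.1.mul ((hclipc n).measurable.comp (hmeas w))).aestronglyMeasurable
      · rw [norm_mul]
        exact mul_le_mul_of_nonneg_left (hclip n _) (norm_nonneg _)
      · exact continuous_const.mul ((hclipc n).comp (hp.continuous_corrKernel hθ r y))
    set D : ℝ := M * (C / r ^ ρ) ^ ζ with hD
    have hC0 : 0 ≤ C / r ^ ρ := div_nonneg hC.le (Real.rpow_nonneg hr.1.le _)
    have hD0 : 0 ≤ D := mul_nonneg hM0 (Real.rpow_nonneg hC0 _)
    have hrow : ∀ w, Integrable fun y => corrKernel T p θ r w y := by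
      intro w
      refine ⟨(hmeas w).aestronglyMeasurable, ?_⟩
      refine lt_of_le_of_lt (lintegral_mono fun y => hen hr w y) ?_
      rw [lintegral_const_mul' _ _ ENNReal.ofReal_ne_top]
      exact ENNReal.mul_lt_top ENNReal.ofReal_lt_top
        ((hK₂ r hr w).trans_lt ENNReal.coe_lt_top)
    have hdiff : ∀ (n : ℕ) w, |corrOp T p θ r f w - ∫ y, f y * clip n (corrKernel T p θ r w y)|
        ≤ ((n : ℝ) + 1) ^ (1 - ζ) * (D * K₃) := by
      intro n w
      have hn : (0 : ℝ) < (n : ℝ) + 1 := by positivity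
      have hint1 : Integrable fun y => f y * corrKernel T p θ r w y :=
        (hrow w).bdd_mul (c := M) hf.isBddMeas.1.aestronglyMeasurable (Eventually.of_forall hM)
      have hint2 : Integrable fun y => f y * clip n (corrKernel T p θ r w y) := by
        refine hf.integrable.mul_bdd (c := (n : ℝ) + 1)
          ((hclipc n).measurable.comp (hmeas w)).aestronglyMeasurable
          (Eventually.of_forall fun y => hclip n _)
      rw [corrOp, ← integral_sub hint1 hint2]
      set E : ℝ := ((n : ℝ) + 1) ^ (1 - ζ) * D with hE
      have hE0 : 0 ≤ E := mul_nonneg (Real.rpow_nonneg hn.le _) hD0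
      have hpt : ∀ y, ‖f y * corrKernel T p θ r w y - f y * clip n (corrKernel T p θ r w y)‖ₑ
          ≤ (Metric.closedBall 0 R).indicator (fun y => ENNReal.ofReal E *
            ENNReal.ofReal (γ r y w ^ ζ)) y := by
        intro y
        by_cases hy : y ∈ Metric.closedBall 0 R
        · rw [indicator_of_mem hy, ← ofReal_norm, ← ENNReal.ofReal_mul hE0]
          refine ENNReal.ofReal_le_ofReal ?_
          rw [← mul_sub, norm_mul, Real.norm_eq_abs, Real.norm_eq_abs]
          have h1 := abs_sub_clip_le (a := corrKernel T p θ r w y) hn hζ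
          have h2 : |corrKernel T p θ r w y| ^ ζ ≤ (C / r ^ ρ) ^ ζ * γ r y w ^ ζ := by
            rw [← Real.mul_rpow hC0 (hγ0 r hr y w)]
            refine Real.rpow_le_rpow (abs_nonneg _) ?_ (by linarith)
            rw [corrKernel_of_mem hr]
            exact hle r hr y w
          calc |f y| * |corrKernel T p θ r w y - clip n (corrKernel T p θ r w y)|
              ≤ M * (((n : ℝ) + 1) ^ (1 - ζ) * ((C / r ^ ρ) ^ ζ * γ r y w ^ ζ)) := by
                refine mul_le_mul (hM y) (h1.trans ?_) (abs_nonneg _) hM0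
                exact mul_le_mul_of_nonneg_left h2 (Real.rpow_nonneg hn.le _)
            _ = E * γ r y w ^ ζ := by rw [hE, hD]; ring
        · have hfy : f y = 0 := image_eq_zero_of_notMem_tsupport fun h => hy (hR h)
          simp [hfy]
      have hl : ‖∫ y, (f y * corrKernel T p θ r w y - f y * clip n (corrKernel T p θ r w y))‖ₑ
          ≤ ENNReal.ofReal E * K₃ := by
        refine (enorm_integral_le_lintegral_enorm _).trans ((lintegral_mono hpt).trans ?_)
        rw [lintegral_indicator Metric.isClosed_closedBall.measurableSet,
          lintegral_const_mul' _ _ ENNReal.ofReal_ne_top]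
        gcongr
        exact hK₃ r hr w
      rw [← ENNReal.ofReal_coe_nnreal, ← ENNReal.ofReal_mul hE0, ← ofReal_norm,
        ENNReal.ofReal_le_ofReal_iff (by positivity), Real.norm_eq_abs] at hl
      refine hl.trans (le_of_eq ?_)
      rw [hE]; ring
    have hunif : TendstoUniformly
        (fun (n : ℕ) w => ∫ y, f y * clip n (corrKernel T p θ r w y)) (corrOp T p θ r f) atTop := by
      rw [Metric.tendstoUniformly_iff]
      intro η hη
      have hlim : Tendsto (fun n : ℕ => ((n : ℝ) + 1) ^ (1 - ζ) * (D * K₃)) atTop (𝓝 0) := by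
        have h1 := (tendsto_rpow_neg_atTop (y := ζ - 1) (by linarith)).comp
          (tendsto_atTop_add_const_right atTop (1 : ℝ) tendsto_natCast_atTop_atTop)
        have h2 := h1.mul_const (D * K₃)
        rw [zero_mul] at h2
        refine h2.congr fun n => ?_
        simp [Function.comp]
      filter_upwards [hlim.eventually (gt_mem_nhds hη)] with n hn w
      rw [Real.dist_eq]
      exact (hdiff n w).trans_lt hn
    exact hunif.continuous (Eventually.of_forall hcont).frequently

end Parametrix

namespace Parametrix

variable {d : ℕ} {T : ℝ} {P : ℝ → Rd d → SignedMeasure (Rd d)}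
  {p : ℝ → Rd d → Rd d → Rd d → ℝ} {θ : ℝ → Rd d → Rd d → ℝ} {ρ c : ℝ}

/-! ### Fubini for the operators of a signed kernel -/

theorem lintegral_enorm_op_le {s : ℝ} {x : Rd d} {F : Rd d × Rd d → ℝ} (hF : Measurable F)
    {C : ℝ≥0∞} (hC : ∀ w, ∫⁻ y, ‖F (w, y)‖ₑ ≤ C) :
    ∫⁻ y, ‖op P s (fun w => F (w, y)) x‖ₑ ≤ C * (P s x).variation univ := by
  obtain ⟨σ, hσ, hσ1, hop⟩ := exists_sign_integral_eq (P s x)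
  have hσe : ∀ w, ‖σ w‖ₑ = 1 := fun w => by rw [← ofReal_norm, Real.norm_eq_abs, hσ1]; simp
  calc ∫⁻ y, ‖op P s (fun w => F (w, y)) x‖ₑ
      ≤ ∫⁻ y, ∫⁻ w, ‖F (w, y)‖ₑ ∂(P s x).variation := by
        refine lintegral_mono fun y => ?_
        rw [op, hop]
        refine (enorm_integral_le_lintegral_enorm _).trans (lintegral_mono fun w => ?_)
        simp only [enorm_mul, hσe, mul_one, le_refl]
    _ = ∫⁻ w, (∫⁻ y, ‖F (w, y)‖ₑ) ∂(P s x).variation := by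
        exact (lintegral_lintegral_swap (f := fun w y => ‖F (w, y)‖ₑ)
          hF.enorm.aemeasurable).symm
    _ ≤ ∫⁻ _, C ∂(P s x).variation := lintegral_mono hC
    _ = C * (P s x).variation univ := lintegral_const _

/-- Polar decomposition reduces to Fubini for the finite variation measure; the uniform row bound
gives integrability on the product. -/
theorem op_integral_eq {s : ℝ} {x : Rd d} {F : Rd d × Rd d → ℝ} (hF : Measurable F)
    {C : ℝ≥0∞} (hCt : C ≠ ∞) (hC : ∀ w, ∫⁻ y, ‖F (w, y)‖ₑ ≤ C) :
    op P s (fun w => ∫ y, F (w, y)) x = ∫ y, op P s (fun w => F (w, y)) x := by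
  obtain ⟨σ, hσ, hσ1, hop⟩ := exists_sign_integral_eq (P s x)
  have hσe : ∀ w, ‖σ w‖ₑ = 1 := fun w => by rw [← ofReal_norm, Real.norm_eq_abs, hσ1]; simp
  simp only [op, hop]
  have hm : Measurable fun q : Rd d × Rd d => F q * σ q.1 := hF.mul (hσ.comp measurable_fst)
  have hint : Integrable (Function.uncurry fun w y => F (w, y) * σ w)
      ((P s x).variation.prod volume) := by
    refine ⟨hm.aestronglyMeasurable, ?_⟩
    have hm' : Measurable (Function.uncurry fun w y => F (w, y) * σ w) := hm
    rw [HasFiniteIntegral, lintegral_prod _ hm'.enorm.aemeasurable]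
    simp only [Function.uncurry, enorm_mul, hσe, mul_one]
    refine (lintegral_mono hC).trans_lt ?_
    rw [lintegral_const]
    exact ENNReal.mul_lt_top hCt.lt_top (measure_lt_top _ _)
  rw [← integral_integral_swap hint]
  refine integral_congr_ae (Eventually.of_forall fun w => ?_)
  exact (integral_mul_const _ _).symm

/-! ### The operators `diagOp` and `corrOp` -/

theorem CorrBound.integrable_row (hb : CorrBound T p θ ρ c) (hp : IsFrozenFamily T p)
    (hθ : IsBackwardWeight T P p θ) (r : ℝ) (w : Rd d) :
    Integrable fun y => corrKernel T p θ r w y :=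
  ⟨((hp.measurable_corrKernel hθ).comp
      (measurable_const.prodMk (measurable_const.prodMk measurable_id))).aestronglyMeasurable,
    (hb.row r w).trans_lt ENNReal.ofReal_lt_top⟩

theorem lintegral_enorm_mul_le {α : Type*} [MeasurableSpace α] {m : Measure α} {f k : α → ℝ}
    {M : ℝ} (hM : ∀ y, |f y| ≤ M) : ∫⁻ y, ‖f y * k y‖ₑ ∂m ≤ ENNReal.ofReal M * ∫⁻ y, ‖k y‖ₑ ∂m := by
  rw [← lintegral_const_mul' _ _ ENNReal.ofReal_ne_top]
  refine lintegral_mono fun y => ?_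
  rw [enorm_mul, ← ofReal_norm (f y)]
  gcongr
  exact hM y

theorem CorrBound.abs_corrOp_le (hb : CorrBound T p θ ρ c) {f : Rd d → ℝ} {M : ℝ}
    (hM : ∀ y, |f y| ≤ M) (r : ℝ) (w : Rd d) : |corrOp T p θ r f w| ≤ M * rate T ρ c r := by
  have hM0 : 0 ≤ M := (abs_nonneg _).trans (hM 0)
  have h := (enorm_integral_le_lintegral_enorm (μ := volume) fun y => f y * corrKernel T p θ r w y).trans
    ((lintegral_enorm_mul_le hM).trans (mul_le_mul_right (hb.row r w) _))
  rwa [← ENNReal.ofReal_mul hM0, ← ofReal_norm, ENNReal.ofReal_le_ofReal_iff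
    (mul_nonneg hM0 (hb.rate_nonneg r)), Real.norm_eq_abs] at h

theorem IsFrozenFamily.measurable_corrOp (hp : IsFrozenFamily T p)
    (hθ : IsBackwardWeight T P p θ) {f : Rd d → ℝ} (hf : Measurable f) :
    Measurable fun q : ℝ × Rd d => corrOp T p θ q.1 f q.2 := by
  have h1 : Measurable fun q : (ℝ × Rd d) × Rd d => f q.2 * corrKernel T p θ q.1.1 q.1.2 q.2 :=
    (hf.comp measurable_snd).mul ((hp.measurable_corrKernel hθ).comp
      (((measurable_fst.comp measurable_fst)).prodMk
        ((measurable_snd.comp measurable_fst).prodMk measurable_snd)))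
  exact h1.stronglyMeasurable.integral_prod_right'.measurable

theorem CorrBound.isBddMeas_corrOp (hb : CorrBound T p θ ρ c) (hp : IsFrozenFamily T p)
    (hθ : IsBackwardWeight T P p θ) {f : Rd d → ℝ} (hf : IsBddMeas f) (r : ℝ) :
    IsBddMeas (corrOp T p θ r f) := by
  obtain ⟨M, hM⟩ := hf.2
  exact ⟨(hp.measurable_corrOp hθ hf.1).comp (measurable_const.prodMk measurable_id), _,
    hb.abs_corrOp_le hM r⟩

/-- The marginal integrals of the diagonal density are bounded by `K`. -/
structure DiagBound (T : ℝ) (p : ℝ → Rd d → Rd d → Rd d → ℝ) (K : ℝ) : Prop where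
  nonneg : 0 ≤ K
  row : ∀ t x, ∫⁻ y, ‖diagDensity T p t x y‖ₑ ≤ ENNReal.ofReal K
  col : ∀ t y, ∫⁻ x, ‖diagDensity T p t x y‖ₑ ≤ ENNReal.ofReal K

theorem exists_diagBound (hp : IsFrozenFamily T p) (hreg : BackwardRegular T P p) :
    ∃ K, DiagBound T p K := by
  obtain ⟨M, hM⟩ := hreg.integrable_bound
  have aux : ∀ {t : ℝ} (ht : t ∈ Ioc 0 T) (g : Rd d → ℝ), (∀ x, 0 ≤ g x) → Integrable g →
      ∫ x, g x ≤ M → ∫⁻ x, ‖g x‖ₑ ≤ ENNReal.ofReal (max M 0) := by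
    intro t ht g hg hi hgM
    have : ∀ x, ‖g x‖ₑ = ENNReal.ofReal (g x) := fun x => Real.enorm_of_nonneg (hg x)
    simp_rw [this]
    rw [← ofReal_integral_eq_lintegral_ofReal hi (Eventually.of_forall hg)]
    exact ENNReal.ofReal_le_ofReal (hgM.trans (le_max_left _ _))
  refine ⟨max M 0, le_max_right _ _, fun t x => ?_, fun t y => ?_⟩
  · by_cases ht : t ∈ Ioc 0 T
    · simp_rw [diagDensity_of_mem ht]
      exact aux ht _ (fun y => hp.nonneg t ht _ _ _) ((hM t ht).1 x).1 ((hM t ht).1 x).2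
    · simp [diagDensity_of_notMem ht]
  · by_cases ht : t ∈ Ioc 0 T
    · simp_rw [diagDensity_of_mem ht]
      exact aux ht _ (fun y => hp.nonneg t ht _ _ _) ((hM t ht).2 y).1 ((hM t ht).2 y).2
    · simp [diagDensity_of_notMem ht]

theorem IsFrozenFamily.measurable_diagOp (hp : IsFrozenFamily T p) {f : Rd d → ℝ}
    (hf : Measurable f) : Measurable fun q : ℝ × Rd d => diagOp T p q.1 f q.2 := by
  have h1 : Measurable fun q : (ℝ × Rd d) × Rd d => f q.2 * diagDensity T p q.1.1 q.1.2 q.2 :=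
    (hf.comp measurable_snd).mul (hp.measurable_diagDensity.comp
      (((measurable_fst.comp measurable_fst)).prodMk
        ((measurable_snd.comp measurable_fst).prodMk measurable_snd)))
  exact h1.stronglyMeasurable.integral_prod_right'.measurable

theorem DiagBound.integrable_row {K : ℝ} (hK : DiagBound T p K) (hp : IsFrozenFamily T p)
    (t : ℝ) (x : Rd d) : Integrable fun y => diagDensity T p t x y :=
  ⟨(hp.measurable_diagDensity.comp
      (measurable_const.prodMk (measurable_const.prodMk measurable_id))).aestronglyMeasurable,
    (hK.row t x).trans_lt ENNReal.ofReal_lt_top⟩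

theorem DiagBound.integrable_col {K : ℝ} (hK : DiagBound T p K) (hp : IsFrozenFamily T p)
    (t : ℝ) (y : Rd d) : Integrable fun x => diagDensity T p t x y :=
  ⟨(hp.measurable_diagDensity.comp
      (measurable_const.prodMk (measurable_id.prodMk measurable_const))).aestronglyMeasurable,
    (hK.col t y).trans_lt ENNReal.ofReal_lt_top⟩

theorem DiagBound.abs_diagOp_le {K : ℝ} (hK : DiagBound T p K) {f : Rd d → ℝ} {M : ℝ}
    (hM : ∀ y, |f y| ≤ M) (t : ℝ) (x : Rd d) : |diagOp T p t f x| ≤ M * K := by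
  have hM0 : 0 ≤ M := (abs_nonneg _).trans (hM 0)
  have h := (enorm_integral_le_lintegral_enorm (μ := volume) fun y => f y * diagDensity T p t x y).trans
    ((lintegral_enorm_mul_le hM).trans (mul_le_mul_right (hK.row t x) _))
  rwa [← ENNReal.ofReal_mul hM0, ← ofReal_norm, ENNReal.ofReal_le_ofReal_iff
    (mul_nonneg hM0 hK.nonneg), Real.norm_eq_abs] at h

/-! ### The integrated Duhamel formula at positive distance from the singularity -/

/-- The projection of the real line to `[0, T]`. -/
noncomputable def clampTime (T s : ℝ) : ℝ := max 0 (min T s)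

theorem clampTime_of_mem {s : ℝ} (hs : s ∈ Icc 0 T) : clampTime T s = s := by
  rw [clampTime, min_eq_right hs.2, max_eq_right hs.1]

theorem clampTime_mem (hT : 0 < T) (s : ℝ) : clampTime T s ∈ Icc 0 T :=
  ⟨le_max_left _ _, max_le hT.le (min_le_left _ _)⟩

theorem measurable_clampTime : Measurable (clampTime T) :=
  measurable_const.max (measurable_const.min measurable_id)

/-- Duhamel's formula for `φ^y` is integrated against `f(y) dy`. It requires integrability of the
correction in `r`, which the row bound and Fubini provide for almost every `y`, and no more is
needed. -/
theorem op_diagOp_sub_diagOp_eq (hT : 0 < T) (hP : IsSemigroup T P) (hp : IsFrozenFamily T p)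
    (hL : GeneratorsAgree T P p) (hreg : BackwardRegular T P p) (hθ : IsBackwardWeight T P p θ)
    (hb : CorrBound T p θ ρ c) {ε u : ℝ} (hε : 0 < ε) (hεu : ε ≤ u) (hu : u ≤ T)
    {f : Rd d → ℝ} (hf : IsBddMeas f) (x : Rd d) :
    op P (u - ε) (diagOp T p ε f) x - diagOp T p u f x
      = ∫ r in Ioc ε u, op P (u - r) (corrOp T p θ r f) x := by
  obtain ⟨K, hK⟩ := exists_diagBound hp hreg
  have hεT : ε ∈ Ioc 0 T := ⟨hε, hεu.trans hu⟩
  have huT : u ∈ Ioc 0 T := ⟨hε.trans_le hεu, hu⟩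
  have hs : ∀ r ∈ Icc ε u, u - r ∈ Icc 0 T := fun r hr =>
    ⟨by linarith [hr.2], by linarith [hr.1]⟩
  -- Clamping makes the time lie in `[0, T]` for every `q`, where joint measurability of `P` is
  -- available; on the range of integration it changes nothing.
  set G : ℝ × Rd d → ℝ := fun q =>
    op P (clampTime T (u - q.1)) (fun w => corrKernel T p θ q.1 w q.2) x with hG
  have hGm : Measurable G := by
    have m1 : Measurable fun q : ℝ × Rd d => clampTime T (u - q.1) :=
      measurable_clampTime.comp (measurable_const.sub measurable_fst)
    have m2 : Measurable fun q : (ℝ × Rd d) × Rd d => corrKernel T p θ q.1.1 q.2 q.1.2 := by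
      have m3 : Measurable fun q : (ℝ × Rd d) × Rd d => (q.1.1, q.2, q.1.2) :=
        (measurable_fst.comp measurable_fst).prodMk
          (measurable_snd.prodMk (measurable_snd.comp measurable_fst))
      exact (hp.measurable_corrKernel hθ).comp m3
    exact hP.measurable_op_param (s := fun q : ℝ × Rd d => clampTime T (u - q.1))
      (ξ := fun _ => x) (F := fun q : (ℝ × Rd d) × Rd d => corrKernel T p θ q.1.1 q.2 q.1.2)
      m1 (fun a => clampTime_mem hT _) measurable_const m2
      (fun a => exists_corrKernel_bound hT hP hp hL hreg hθ a.1 a.2)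
  have hGle : ∀ r, ∫⁻ y, ‖G (r, y)‖ₑ ≤ ENNReal.ofReal (rate T ρ c r) := by
    intro r
    have m4 : Measurable fun q : Rd d × Rd d => corrKernel T p θ r q.1 q.2 :=
      (hp.measurable_corrKernel hθ).comp (measurable_const.prodMk measurable_id)
    refine (lintegral_enorm_op_le (s := clampTime T (u - r)) (x := x) m4
      (C := ENNReal.ofReal (rate T ρ c r)) (fun w => hb.row r w)).trans ?_
    have h1 := hP.varMass_le_one (clampTime_mem hT (u - r)) x
    rw [varMass, measureReal_def] at h1
    have h2 : (P (clampTime T (u - r)) x).variation univ ≤ 1 := by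
      rw [← ENNReal.ofReal_toReal (measure_ne_top (P (clampTime T (u - r)) x).variation univ)]
      exact ENNReal.ofReal_le_one.2 h1
    exact mul_le_of_le_one_right' h2
  have hratefin : ∫⁻ r, ENNReal.ofReal (rate T ρ c r) < ∞ := by
    have := (hb.integrable_rate hT).2
    rw [HasFiniteIntegral] at this
    refine lt_of_le_of_lt (lintegral_mono fun r => ?_) this
    rw [Real.enorm_of_nonneg (hb.rate_nonneg r)]
  have hGint : Integrable G ((volume.restrict (Ioc ε u)).prod volume) := by
    refine ⟨hGm.aestronglyMeasurable, ?_⟩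
    rw [HasFiniteIntegral, lintegral_prod _ hGm.enorm.aemeasurable]
    exact ((lintegral_mono hGle).trans (setLIntegral_le_lintegral _ _)).trans_lt hratefin
  obtain ⟨M, hM⟩ := hf.2
  have hfG : Integrable (Function.uncurry fun r y => f y * G (r, y))
      ((volume.restrict (Ioc ε u)).prod volume) :=
    hGint.bdd_mul (c := M) (hf.1.comp measurable_snd).aestronglyMeasurable
      (Eventually.of_forall fun q => hM q.2)
  have hae : ∀ᵐ y : Rd d, op P (u - ε) (phi p ε y) x - phi p u y x = ∫ r in Ioc ε u, G (r, y) := by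
    filter_upwards [hGint.prod_left_ae] with y hy
    have hcongr : ∀ r ∈ Ioc ε u, G (r, y) = op P (u - r) (fun w => corrKernel T p θ r w y) x := by
      intro r hr
      simp only [hG]
      rw [clampTime_of_mem (hs r ⟨hr.1.le, hr.2⟩)]
    rw [op_phi_sub_phi_eq hT hP hp hL hreg hθ hε hεu hu x y,
      intervalIntegral.integral_of_le hεu]
    · exact (setIntegral_congr_fun measurableSet_Ioc hcongr).symm
    · rw [integrableOn_Icc_iff_integrableOn_Ioc]
      have hy' : IntegrableOn (fun r => G (r, y)) (Ioc ε u) := hy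
      exact hy'.congr_fun hcongr measurableSet_Ioc
  have e1 : op P (u - ε) (diagOp T p ε f) x = ∫ y, f y * op P (u - ε) (phi p ε y) x := by
    have hm : Measurable fun q : Rd d × Rd d => f q.2 * diagDensity T p ε q.1 q.2 :=
      (hf.1.comp measurable_snd).mul
        (hp.measurable_diagDensity.comp (measurable_const.prodMk measurable_id))
    have := op_integral_eq (P := P) (s := u - ε) (x := x) hm
      (C := ENNReal.ofReal M * ENNReal.ofReal K)
      (ENNReal.mul_ne_top ENNReal.ofReal_ne_top ENNReal.ofReal_ne_top)
      (fun w => (lintegral_enorm_mul_le hM).trans (mul_le_mul_right (hK.row ε w) _))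
    refine this.trans (integral_congr_ae (Eventually.of_forall fun y => ?_))
    simp only [op_const_mul, diagDensity_of_mem hεT]
  have hint1 : Integrable fun y => f y * diagDensity T p u x y :=
    (hK.integrable_row hp u x).bdd_mul (c := M) hf.1.aestronglyMeasurable (Eventually.of_forall hM)
  -- Integrability of this term is read off the identity, as the other two terms are integrable.
  have hint2 : Integrable fun y => f y * op P (u - ε) (phi p ε y) x := by
    have h1 : Integrable fun y => ∫ r in Ioc ε u, f y * G (r, y) := hfG.integral_prod_right
    refine (h1.add hint1).congr ?_
    filter_upwards [hae] with y hy
    simp only [Pi.add_apply]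
    rw [integral_const_mul, ← hy, diagDensity_of_mem huT]
    ring
  rw [e1, diagOp, ← integral_sub hint2 hint1]
  have e2 : ∫ y, (f y * op P (u - ε) (phi p ε y) x - f y * diagDensity T p u x y)
      = ∫ y, ∫ r in Ioc ε u, f y * G (r, y) := by
    refine integral_congr_ae ?_
    filter_upwards [hae] with y hy
    rw [integral_const_mul, ← hy, diagDensity_of_mem huT]
    ring
  rw [e2, ← integral_integral_swap hfG]
  refine setIntegral_congr_fun measurableSet_Ioc fun r hr => ?_
  have hm : Measurable fun q : Rd d × Rd d => f q.2 * corrKernel T p θ r q.1 q.2 :=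
    (hf.1.comp measurable_snd).mul
      ((hp.measurable_corrKernel hθ).comp (measurable_const.prodMk measurable_id))
  have := op_integral_eq (P := P) (s := u - r) (x := x) hm
    (C := ENNReal.ofReal M * ENNReal.ofReal (rate T ρ c r))
    (ENNReal.mul_ne_top ENNReal.ofReal_ne_top ENNReal.ofReal_ne_top)
    (fun w => (lintegral_enorm_mul_le hM).trans (mul_le_mul_right (hb.row r w) _))
  refine Eq.trans ?_ this.symm
  refine integral_congr_ae (Eventually.of_forall fun y => ?_)
  simp only [op_const_mul, hG]
  rw [clampTime_of_mem (hs r ⟨hr.1.le, hr.2⟩)]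

end Parametrix

namespace Parametrix

variable {d : ℕ} {T : ℝ} {P : ℝ → Rd d → SignedMeasure (Rd d)}
  {p : ℝ → Rd d → Rd d → Rd d → ℝ} {θ : ℝ → Rd d → Rd d → ℝ} {ρ c : ℝ}

/-! ### Duhamel's formula -/

theorem IsSemigroup.measurable_op_corrOp (hT : 0 < T) (hP : IsSemigroup T P)
    (hp : IsFrozenFamily T p) (hθ : IsBackwardWeight T P p θ) (hb : CorrBound T p θ ρ c)
    {f : Rd d → ℝ} (hf : IsBddMeas f) :
    Measurable fun q : ℝ × ℝ × Rd d =>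
      op P (clampTime T (q.1 - q.2.1)) (corrOp T p θ q.2.1 f) q.2.2 := by
  have m1 : Measurable fun q : ℝ × ℝ × Rd d => clampTime T (q.1 - q.2.1) :=
    measurable_clampTime.comp (measurable_fst.sub (measurable_fst.comp measurable_snd))
  have m2 : Measurable fun q : (ℝ × ℝ × Rd d) × Rd d => corrOp T p θ q.1.2.1 f q.2 := by
    have m3 : Measurable fun q : (ℝ × ℝ × Rd d) × Rd d => (q.1.2.1, q.2) :=
      (measurable_fst.comp (measurable_snd.comp measurable_fst)).prodMk measurable_snd
    exact (hp.measurable_corrOp hθ hf.1).comp m3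
  have m4 : Measurable fun q : ℝ × ℝ × Rd d => q.2.2 := measurable_snd.comp measurable_snd
  exact hP.measurable_op_param (s := fun q : ℝ × ℝ × Rd d => clampTime T (q.1 - q.2.1))
    (ξ := fun q => q.2.2) (F := fun q : (ℝ × ℝ × Rd d) × Rd d => corrOp T p θ q.1.2.1 f q.2)
    m1 (fun a => clampTime_mem hT _) m4 m2
    (fun a => (hb.isBddMeas_corrOp hp hθ hf a.2.1).2)

theorem measurable_op_corrOp_time (hT : 0 < T) (hP : IsSemigroup T P)
    (hp : IsFrozenFamily T p) (hθ : IsBackwardWeight T P p θ) (hb : CorrBound T p θ ρ c)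
    {f : Rd d → ℝ} (hf : IsBddMeas f) (t : ℝ) (x : Rd d) :
    Measurable fun r => op P (clampTime T (t - r)) (corrOp T p θ r f) x := by
  have m : Measurable fun r : ℝ => ((t, r, x) : ℝ × ℝ × Rd d) :=
    measurable_const.prodMk (measurable_id.prodMk measurable_const)
  have h := (hP.measurable_op_corrOp hT hp hθ hb hf).comp m
  exact h

theorem abs_op_corrOp_le (hP : IsSemigroup T P) (hb : CorrBound T p θ ρ c) {f : Rd d → ℝ} {M : ℝ}
    (hM : ∀ y, |f y| ≤ M) {s : ℝ} (hs : s ∈ Icc 0 T) (r : ℝ) (x : Rd d) :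
    |op P s (corrOp T p θ r f) x| ≤ M * rate T ρ c r :=
  hP.abs_op_le hs (hb.abs_corrOp_le hM r) x

theorem setIntegral_clampTime {ε u : ℝ} (hε : 0 ≤ ε) (hu : u ≤ T) (f : Rd d → ℝ) (x : Rd d) :
    ∫ r in Ioc ε u, op P (u - r) (corrOp T p θ r f) x
      = ∫ r, (Ioc ε u).indicator
        (fun r => op P (clampTime T (u - r)) (corrOp T p θ r f) x) r := by
  rw [integral_indicator measurableSet_Ioc]
  refine setIntegral_congr_fun measurableSet_Ioc fun r hr => ?_
  rw [clampTime_of_mem ⟨by linarith [hr.2], by linarith [hr.1]⟩]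

theorem integrableOn_op_corrOp (hT : 0 < T) (hP : IsSemigroup T P)
    (hp : IsFrozenFamily T p) (hθ : IsBackwardWeight T P p θ) (hb : CorrBound T p θ ρ c)
    {f : Rd d → ℝ} (hf : IsBddMeas f) {t : ℝ} (ht : t ≤ T) (x : Rd d) :
    IntegrableOn (fun r => op P (t - r) (corrOp T p θ r f) x) (Ioc 0 t) := by
  obtain ⟨M, hM⟩ := hf.2
  have h1 : IntegrableOn (fun r => op P (clampTime T (t - r)) (corrOp T p θ r f) x) (Ioc 0 t) :=
    (((hb.integrable_rate hT).const_mul M).integrableOn).mono'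
      (measurable_op_corrOp_time hT hP hp hθ hb hf t x).aestronglyMeasurable
      (Eventually.of_forall fun r => abs_op_corrOp_le hP hb hM (clampTime_mem hT _) r x)
  refine h1.congr_fun (fun r hr => ?_) measurableSet_Ioc
  simp only
  rw [clampTime_of_mem ⟨by linarith [hr.2], by linarith [hr.1]⟩]

/-- Dominated convergence with majorant `M * rate`. The integrand converges for all but countably
many `r`, because `corrOp` sends a test function to a bounded continuous one, on which `P` is
continuous in time off a countable set. -/
theorem tendsto_duhamel (hT : 0 < T) (hP : IsSemigroup T P) (hp : IsFrozenFamily T p)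
    (hθ : IsBackwardWeight T P p θ) (hb : CorrBound T p θ ρ c) {f : Rd d → ℝ} (hf : IsTest f)
    {ε u : ℕ → ℝ} {t : ℝ} (htT : t ≤ T) (hε : Tendsto ε atTop (𝓝 0))
    (hε0 : ∀ n, 0 ≤ ε n) (hu : Tendsto u atTop (𝓝 t)) (huT : ∀ n, u n ≤ T) (x : Rd d) :
    Tendsto (fun n => ∫ r in Ioc (ε n) (u n), op P (u n - r) (corrOp T p θ r f) x) atTop
      (𝓝 (∫ r in Ioc 0 t, op P (t - r) (corrOp T p θ r f) x)) := by
  obtain ⟨M, hM⟩ := hf.isBddMeas.2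
  have hM0 : 0 ≤ M := (abs_nonneg _).trans (hM 0)
  rw [setIntegral_clampTime le_rfl htT]
  simp_rw [fun n => setIntegral_clampTime (P := P) (p := p) (θ := θ) (hε0 n) (huT n) f x]
  obtain ⟨N, hN, hcont⟩ := hP.exists_countable_tendsto_op hT x
  refine tendsto_integral_of_dominated_convergence (fun r => M * rate T ρ c r)
    (fun n => ((measurable_op_corrOp_time hT hP hp hθ hb hf.isBddMeas (u n) x).indicator
      measurableSet_Ioc).aestronglyMeasurable) ((hb.integrable_rate hT).const_mul M)
    (fun n => Eventually.of_forall fun r => ?_) ?_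
  · refine (norm_indicator_le_norm_self _ _).trans ?_
    exact abs_op_corrOp_le hP hb hM (clampTime_mem hT _) r x
  · have hbad : (({0, t} : Set ℝ) ∪ (fun s => t - s) '' N).Countable :=
      ((Set.toFinite {0, t}).countable).union (hN.image _)
    have h0 : ∀ᵐ r : ℝ, r ∉ ({0, t} : Set ℝ) ∪ (fun s => t - s) '' N :=
      hbad.ae_notMem volume
    filter_upwards [h0] with r hr
    simp only [mem_union, mem_insert_iff, mem_singleton_iff, not_or] at hr
    obtain ⟨⟨hr0, hrt⟩, hrN⟩ := hr
    rcases lt_or_gt_of_ne hr0 with h | h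
    · rw [indicator_of_notMem (fun hm => by linarith [hm.1])]
      refine tendsto_const_nhds.congr fun n => ?_
      rw [indicator_of_notMem fun hm => by linarith [hm.1, hε0 n]]
    rcases lt_or_gt_of_ne hrt with h' | h'
    · have hm : t - r ∈ Icc 0 T := ⟨by linarith, by linarith⟩
      have hr1 : r ∈ Ioc 0 t := ⟨h, h'.le⟩
      rw [indicator_of_mem hr1, clampTime_of_mem hm]
      have hlim := hcont (t - r) hm (fun hn => hrN ⟨t - r, hn, by simp⟩) _
        (hb.continuous_corrOp f hf r) (hb.isBddMeas_corrOp hp hθ hf.isBddMeas r).2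
      have e1 : ∀ᶠ n in atTop, ε n < r := hε.eventually (gt_mem_nhds h)
      have e2 : ∀ᶠ n in atTop, r < u n := hu.eventually (lt_mem_nhds h')
      have hmap : Tendsto (fun n => u n - r) atTop (𝓝[Icc 0 T] (t - r)) := by
        refine tendsto_nhdsWithin_iff.2 ⟨hu.sub_const r, ?_⟩
        filter_upwards [e2] with n hn
        exact ⟨by linarith, by linarith [huT n]⟩
      refine (hlim.comp hmap).congr' ?_
      filter_upwards [e1, e2] with n h1 h2
      have hr2 : r ∈ Ioc (ε n) (u n) := ⟨h1, h2.le⟩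
      rw [indicator_of_mem hr2,
        clampTime_of_mem ⟨by linarith, by linarith [huT n]⟩]
      rfl
    · rw [indicator_of_notMem (fun hm => by linarith [hm.2])]
      refine tendsto_const_nhds.congr' ?_
      filter_upwards [hu.eventually (gt_mem_nhds h')] with n hn
      rw [indicator_of_notMem fun hm => by linarith [hm.2]]

theorem integral_mul_diagOp_eq (hp : IsFrozenFamily T p) {K : ℝ} (hK : DiagBound T p K)
    {f g : Rd d → ℝ} (hf : IsTest f) (hg : IsTest g) (t : ℝ) :
    ∫ x, g x * diagOp T p t f x = ∫ y, f y * ∫ x, g x * diagDensity T p t x y := by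
  obtain ⟨M, hM⟩ := hf.isBddMeas.2
  have hm : Measurable fun q : Rd d × Rd d => diagDensity T p t q.1 q.2 :=
    hp.measurable_diagDensity.comp (measurable_const.prodMk measurable_id)
  have hm1 : Measurable fun q : Rd d × Rd d => f q.2 * diagDensity T p t q.1 q.2 :=
    (hf.isBddMeas.1.comp measurable_snd).mul hm
  have hm2 : Measurable (Function.uncurry fun x y => g x * (f y * diagDensity T p t x y)) :=
    (hg.isBddMeas.1.comp measurable_fst).mul hm1
  have hint : Integrable (Function.uncurry fun x y => g x * (f y * diagDensity T p t x y))
      (volume.prod volume) := by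
    refine ⟨hm2.aestronglyMeasurable, ?_⟩
    rw [HasFiniteIntegral, lintegral_prod _ hm2.enorm.aemeasurable]
    calc ∫⁻ x, ∫⁻ y, ‖g x * (f y * diagDensity T p t x y)‖ₑ
        ≤ ∫⁻ x, ‖g x‖ₑ * (ENNReal.ofReal M * ENNReal.ofReal K) := by
          refine lintegral_mono fun x => ?_
          simp only [enorm_mul (g x)]
          rw [lintegral_const_mul' _ _ enorm_ne_top]
          gcongr
          exact (lintegral_enorm_mul_le hM).trans (mul_le_mul_right (hK.row t x) _)
      _ = (∫⁻ x, ‖g x‖ₑ) * (ENNReal.ofReal M * ENNReal.ofReal K) :=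
          lintegral_mul_const' _ _ (ENNReal.mul_ne_top ENNReal.ofReal_ne_top ENNReal.ofReal_ne_top)
      _ < ∞ := ENNReal.mul_lt_top hg.integrable.2
          (ENNReal.mul_lt_top ENNReal.ofReal_lt_top ENNReal.ofReal_lt_top)
  calc ∫ x, g x * diagOp T p t f x
      = ∫ x, ∫ y, g x * (f y * diagDensity T p t x y) := by
        simp only [diagOp, integral_const_mul]
    _ = ∫ y, ∫ x, g x * (f y * diagDensity T p t x y) := integral_integral_swap hint
    _ = ∫ y, f y * ∫ x, g x * diagDensity T p t x y := by
        refine integral_congr_ae (Eventually.of_forall fun y => ?_)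
        simp only
        rw [← integral_const_mul]
        congr 1
        ext x
        ring

/-- Weak continuity in time is available where pointwise continuity is not. After Fubini the inner
integral runs over the compact support of `g`, on which joint continuity of `p^y` applies, and the
column bound dominates the outer integral. -/
theorem tendsto_integral_mul_diagOp (hp : IsFrozenFamily T p) {K : ℝ} (hK : DiagBound T p K)
    {f g : Rd d → ℝ} (hf : IsTest f) (hg : IsTest g) {u : ℕ → ℝ} {t : ℝ} (ht : t ∈ Ioc 0 T)
    (hu : Tendsto u atTop (𝓝 t)) (huT : ∀ n, u n ∈ Ioc 0 T) :
    Tendsto (fun n => ∫ x, g x * diagOp T p (u n) f x) atTop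
      (𝓝 (∫ x, g x * diagOp T p t f x)) := by
  obtain ⟨N, hN⟩ := hg.isBddMeas.2
  have hN0 : 0 ≤ N := (abs_nonneg _).trans (hN 0)
  simp_rw [integral_mul_diagOp_eq hp hK hf hg]
  have hcol : ∀ s y, |∫ x, g x * diagDensity T p s x y| ≤ N * K := by
    intro s y
    have h := (enorm_integral_le_lintegral_enorm (μ := volume)
      fun x => g x * diagDensity T p s x y).trans
      ((lintegral_enorm_mul_le hN).trans (mul_le_mul_right (hK.col s y) _))
    rwa [← ENNReal.ofReal_mul hN0, ← ofReal_norm, ENNReal.ofReal_le_ofReal_iff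
      (mul_nonneg hN0 hK.nonneg), Real.norm_eq_abs] at h
  have hmeas : ∀ s, Measurable fun y => ∫ x, g x * diagDensity T p s x y := by
    intro s
    have h1 : Measurable fun q : Rd d × Rd d => g q.2 * diagDensity T p s q.2 q.1 :=
      (hg.isBddMeas.1.comp measurable_snd).mul (hp.measurable_diagDensity.comp
        (measurable_const.prodMk (measurable_snd.prodMk measurable_fst)))
    exact h1.stronglyMeasurable.integral_prod_right'.measurable
  refine tendsto_integral_of_dominated_convergence (fun y => ‖f y‖ * (N * K))
    (fun n => (hf.isBddMeas.1.mul (hmeas _)).aestronglyMeasurable)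
    (hf.integrable.norm.mul_const _) (fun n => Eventually.of_forall fun y => ?_)
    (Eventually.of_forall fun y => Tendsto.const_mul _ ?_)
  · rw [norm_mul]
    exact mul_le_mul_of_nonneg_left (hcol _ y) (norm_nonneg _)
  · have hco : ContinuousOn (fun s => ∫ x, g x * p s y x y) (Ioc 0 T) := by
      refine continuousOn_integral_of_compact_support (k := tsupport g) hg.2.isCompact ?_ ?_
      · have h1 : Continuous fun q : ℝ × Rd d => ((q.1, q.2, y) : ℝ × Rd d × Rd d) := by fun_prop
        have h2 := (hp.continuous y).comp (s := Ioc 0 T ×ˢ univ) h1.continuousOn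
          (fun q hq => ⟨hq.1, mem_univ _⟩)
        exact ((hg.1.continuous.comp continuous_snd).continuousOn).mul h2
      · intro s x _ hx
        rw [image_eq_zero_of_notMem_tsupport hx, zero_mul]
    have h3 : Tendsto u atTop (𝓝[Ioc 0 T] t) :=
      tendsto_nhdsWithin_iff.2 ⟨hu, Eventually.of_forall huT⟩
    have h4 := (hco t ht).tendsto.comp h3
    have e : ∀ s ∈ Ioc 0 T, (∫ x, g x * diagDensity T p s x y) = ∫ x, g x * p s y x y :=
      fun s hs => by simp only [diagDensity_of_mem hs, phi]
    rw [e t ht]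
    exact h4.congr fun n => (e _ (huT n)).symm

/-- A bounded pointwise limit must agree almost everywhere with the limit obtained against test
functions. -/
theorem ae_eq_diagOp_of_tendsto (hp : IsFrozenFamily T p) {K : ℝ} (hK : DiagBound T p K)
    {f : Rd d → ℝ} (hf : IsTest f) {u : ℕ → ℝ} {t : ℝ} (ht : t ∈ Ioc 0 T)
    (hu : Tendsto u atTop (𝓝 t)) (huT : ∀ n, u n ∈ Ioc 0 T) {L : Rd d → ℝ}
    (hL : ∀ᵐ x, Tendsto (fun n => diagOp T p (u n) f x) atTop (𝓝 (L x))) :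
    ∀ᵐ x, L x = diagOp T p t f x := by
  obtain ⟨M, hM⟩ := hf.isBddMeas.2
  have hmeas : ∀ s, Measurable (diagOp T p s f) := fun s =>
    (hp.measurable_diagOp hf.isBddMeas.1).comp (measurable_const.prodMk measurable_id)
  have hLm : AEStronglyMeasurable L volume :=
    aestronglyMeasurable_of_tendsto_ae atTop (fun n => (hmeas (u n)).aestronglyMeasurable) hL
  have hLb : ∀ᵐ x, ‖L x‖ ≤ M * K := by
    filter_upwards [hL] with x hx
    exact le_of_tendsto hx.norm (Eventually.of_forall fun n => hK.abs_diagOp_le hM _ x)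
  have hloc : ∀ F : Rd d → ℝ, AEStronglyMeasurable F volume → (∀ᵐ x, ‖F x‖ ≤ M * K) →
      LocallyIntegrable F volume := by
    intro F hF hFb
    exact (locallyIntegrable_const (M * K)).mono hF (hFb.mono fun x hx => by
      rw [Real.norm_eq_abs (M * K)]
      exact hx.trans (le_abs_self _))
  refine ae_eq_of_integral_contDiff_smul_eq (hloc L hLm hLb)
    (hloc _ (hmeas t).aestronglyMeasurable
      (Eventually.of_forall fun x => hK.abs_diagOp_le hM t x)) fun g hg hgc => ?_
  have hgt : IsTest g := ⟨hg, hgc⟩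
  simp only [smul_eq_mul]
  refine tendsto_nhds_unique ?_ (tendsto_integral_mul_diagOp hp hK hf hgt ht hu huT)
  refine tendsto_integral_of_dominated_convergence (fun x => ‖g x‖ * (M * K))
    (fun n => (hgt.isBddMeas.1.mul (hmeas _)).aestronglyMeasurable)
    (hgt.integrable.norm.mul_const _) (fun n => Eventually.of_forall fun x => ?_) ?_
  · rw [norm_mul]
    exact mul_le_mul_of_nonneg_left (hK.abs_diagOp_le hM _ x) (norm_nonneg _)
  · filter_upwards [hL] with x hx
    exact hx.const_mul _

section Duhamel

variable (hT : 0 < T) (hP : IsSemigroup T P) (hp : IsFrozenFamily T p)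
  (hL : GeneratorsAgree T P p) (hreg : BackwardRegular T P p) (hθ : IsBackwardWeight T P p θ)
  (hb : CorrBound T p θ ρ c)

include hT hP hp hL hreg hθ hb

/-- With `u = t + ε` the semigroup factor `P_{u-ε} = P_t` stays fixed, and the approximate identity
passes under it by bounded convergence. This needs room above `t`. -/
theorem duhamel_test_of_lt {f : Rd d → ℝ} (hf : IsTest f) {t : ℝ} (ht0 : 0 < t) (htT : t < T) :
    ∀ᵐ x, op P t f x - ∫ r in Ioc 0 t, op P (t - r) (corrOp T p θ r f) x = diagOp T p t f x := by
  obtain ⟨K, hK⟩ := exists_diagBound hp hreg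
  obtain ⟨M, hM⟩ := hf.isBddMeas.2
  set ε : ℕ → ℝ := fun n => (T - t) / ((n : ℝ) + 1) with hε
  have hε0 : ∀ n, 0 < ε n := fun n => div_pos (by linarith) (by positivity)
  have hεle : ∀ n, ε n ≤ T - t := fun n =>
    div_le_self (by linarith) (by linarith [(Nat.cast_nonneg n : (0 : ℝ) ≤ n)])
  have hεlim : Tendsto ε atTop (𝓝 0) := tendsto_const_div_atTop_nhds_zero_nat (T - t) |>.comp
    (tendsto_add_atTop_nat 1) |>.congr fun n => by simp [hε]
  have hulim : Tendsto (fun n => t + ε n) atTop (𝓝 t) := by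
    simpa using hεlim.const_add t
  refine ae_eq_diagOp_of_tendsto hp hK hf ⟨ht0, htT.le⟩ hulim
    (fun n => ⟨by linarith [hε0 n], by linarith [hεle n]⟩) (Eventually.of_forall fun x => ?_)
  have key : ∀ n, diagOp T p (t + ε n) f x = op P t (diagOp T p (ε n) f) x
      - ∫ r in Ioc (ε n) (t + ε n), op P (t + ε n - r) (corrOp T p θ r f) x := by
    intro n
    rw [← op_diagOp_sub_diagOp_eq hT hP hp hL hreg hθ hb (hε0 n) (by linarith)
      (by linarith [hεle n]) hf.isBddMeas x, add_sub_cancel_right]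
    ring
  simp_rw [key]
  refine Tendsto.sub ?_ (tendsto_duhamel hT hP hp hθ hb hf htT.le hεlim (fun n => (hε0 n).le)
    hulim (fun n => by linarith [hεle n]) x)
  refine tendsto_op (M := M * K) (Eventually.of_forall fun n =>
    (hp.measurable_diagOp hf.isBddMeas.1).comp (measurable_const.prodMk measurable_id))
    (Eventually.of_forall fun n y => hK.abs_diagOp_le hM _ y) fun y => ?_
  have h1 := (hreg.approx_identity f hf y).comp
    (tendsto_nhdsWithin_iff.2 ⟨hεlim, Eventually.of_forall fun n => hε0 n⟩)
  refine h1.congr fun n => ?_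
  simp only [Function.comp, diagOp,
    diagDensity_of_mem (⟨hε0 n, by linarith [hεle n]⟩ : ε n ∈ Ioc 0 T)]

/-- At the terminal time there is no room above, so the formula is taken at times increasing to it.
There `P_{u_n} f(x)` converges because `f` is in the domain of the generator. -/
theorem duhamel_test {f : Rd d → ℝ} (hf : IsTest f) {t : ℝ} (ht : t ∈ Ioc 0 T) :
    ∀ᵐ x, op P t f x - ∫ r in Ioc 0 t, op P (t - r) (corrOp T p θ r f) x = diagOp T p t f x := by
  rcases ht.2.lt_or_eq with h | rfl
  · exact duhamel_test_of_lt hT hP hp hL hreg hθ hb hf ht.1 h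
  obtain ⟨K, hK⟩ := exists_diagBound hp hreg
  set u : ℕ → ℝ := fun n => t - (t / 2) / ((n : ℝ) + 1) with hu
  have hu1 : ∀ n, u n < t := fun n => sub_lt_self _ (div_pos (by linarith) (by positivity))
  have hu0 : ∀ n, 0 < u n := fun n => by
    have : (t / 2) / ((n : ℝ) + 1) ≤ t / 2 :=
      div_le_self (by linarith) (by linarith [(Nat.cast_nonneg n : (0 : ℝ) ≤ n)])
    simp only [hu]
    linarith
  have hulim : Tendsto u atTop (𝓝 t) := by
    have h0 : Tendsto (fun n : ℕ => (t / 2) / ((n : ℝ) + 1)) atTop (𝓝 0) :=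
      tendsto_const_div_atTop_nhds_zero_nat (t / 2) |>.comp
        (tendsto_add_atTop_nat 1) |>.congr fun n => by simp
    simpa using h0.const_sub t
  refine ae_eq_diagOp_of_tendsto hp hK hf ht hulim (fun n => ⟨hu0 n, (hu1 n).le⟩) ?_
  have hall : ∀ᵐ x, ∀ n, op P (u n) f x
      - ∫ r in Ioc 0 (u n), op P (u n - r) (corrOp t p θ r f) x = diagOp t p (u n) f x :=
    ae_all_iff.2 fun n => duhamel_test_of_lt hT hP hp hL hreg hθ hb hf (hu0 n) (hu1 n)
  filter_upwards [hall] with x hx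
  simp_rw [← hx]
  refine Tendsto.sub ?_ (tendsto_duhamel hT hP hp hθ hb hf le_rfl tendsto_const_nhds
    (fun _ => le_rfl) hulim (fun n => (hu1 n).le) x)
  refine (hP.continuousOn_op hT (hP.test_dom f hf) x t ⟨hT.le, le_rfl⟩).tendsto.comp
    (tendsto_nhdsWithin_iff.2 ⟨hulim, Eventually.of_forall fun n => ⟨(hu0 n).le, (hu1 n).le⟩⟩)

/-- **Duhamel's formula**: for bounded measurable `f` and almost every `x`,
`P_t f = ∫ f(y) p_t^y(·, y) dy + ∫_0^t P_{t-r} (∫ f(y) θ̂_r(·, y) φ_r^y dy) dr`. -/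
theorem duhamel {f : Rd d → ℝ} (hf : IsBddMeas f) {t : ℝ} (ht : t ∈ Ioc 0 T) :
    ∀ᵐ x, op P t f x
      = diagOp T p t f x + ∫ r in Ioc 0 t, op P (t - r) (corrOp T p θ r f) x := by
  obtain ⟨K, hK⟩ := exists_diagBound hp hreg
  have hintD : ∀ {f : Rd d → ℝ}, IsBddMeas f → ∀ x, Integrable fun y =>
      f y * diagDensity T p t x y := by
    rintro f ⟨hf, M, hM⟩ x
    exact (hK.integrable_row hp t x).bdd_mul (c := M) hf.aestronglyMeasurable
      (Eventually.of_forall hM)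
  have hintC : ∀ {f : Rd d → ℝ}, IsBddMeas f → ∀ r x, Integrable fun y =>
      f y * corrKernel T p θ r x y := by
    rintro f ⟨hf, M, hM⟩ r x
    exact (hb.integrable_row hp hθ r x).bdd_mul (c := M) hf.aestronglyMeasurable
      (Eventually.of_forall hM)
  -- The null set depends on `f`, but each stability step combines only countably many functions.
  refine IsBddMeas.induction (C := fun f => ∀ᵐ x, op P t f x
      = diagOp T p t f x + ∫ r in Ioc 0 t, op P (t - r) (corrOp T p θ r f) x) ?_ ?_ ?_ ?_ hf
  · intro f hf
    filter_upwards [duhamel_test hT hP hp hL hreg hθ hb hf ht] with x hx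
    linarith
  · intro f g hf hg ihf ihg
    filter_upwards [ihf, ihg] with x hxf hxg
    rw [op_add_fun hf hg, hxf, hxg]
    have e1 : diagOp T p t (fun y => f y + g y) x = diagOp T p t f x + diagOp T p t g x := by
      simp only [diagOp, add_mul]
      exact integral_add (hintD hf x) (hintD hg x)
    have e2 : ∀ r, corrOp T p θ r (fun y => f y + g y)
        = fun w => corrOp T p θ r f w + corrOp T p θ r g w := by
      intro r
      ext w
      simp only [corrOp, add_mul]
      exact integral_add (hintC hf r w) (hintC hg r w)
    have e3 : ∀ r, op P (t - r) (corrOp T p θ r (fun y => f y + g y)) x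
        = op P (t - r) (corrOp T p θ r f) x + op P (t - r) (corrOp T p θ r g) x := by
      intro r
      rw [e2, op_add_fun (hb.isBddMeas_corrOp hp hθ hf r) (hb.isBddMeas_corrOp hp hθ hg r)]
    simp_rw [e3]
    rw [e1, integral_add (integrableOn_op_corrOp hT hP hp hθ hb hf ht.2 x)
      (integrableOn_op_corrOp hT hP hp hθ hb hg ht.2 x)]
    ring
  · intro k f hf ih
    filter_upwards [ih] with x hx
    have e1 : diagOp T p t (fun y => k * f y) x = k * diagOp T p t f x := by
      simp only [diagOp, mul_assoc, integral_const_mul]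
    have e2 : ∀ r, corrOp T p θ r (fun y => k * f y) = fun w => k * corrOp T p θ r f w := by
      intro r
      ext w
      simp only [corrOp, mul_assoc, integral_const_mul]
    simp_rw [e2, op_const_mul, integral_const_mul]
    rw [hx, e1]
    ring
  · intro F f M hF hM hlim ih
    have hfM : ∀ y, |f y| ≤ M := fun y =>
      le_of_tendsto (hlim y).abs (Eventually.of_forall fun n => hM n y)
    have hM0 : 0 ≤ M := (abs_nonneg _).trans (hfM 0)
    have hFb : ∀ n, IsBddMeas (F n) := fun n => ⟨hF n, M, hM n⟩
    filter_upwards [ae_all_iff.2 ih] with x hx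
    have l1 : Tendsto (fun n => op P t (F n) x) atTop (𝓝 (op P t f x)) :=
      tendsto_op (Eventually.of_forall hF) (Eventually.of_forall hM) hlim
    have l2 : Tendsto (fun n => diagOp T p t (F n) x) atTop (𝓝 (diagOp T p t f x)) := by
      refine tendsto_integral_of_dominated_convergence
        (fun y => M * ‖diagDensity T p t x y‖) (fun n => (hintD (hFb n) x).aestronglyMeasurable)
        ((hK.integrable_row hp t x).norm.const_mul M)
        (fun n => Eventually.of_forall fun y => ?_)
        (Eventually.of_forall fun y => (hlim y).mul_const _)
      rw [norm_mul]
      exact mul_le_mul_of_nonneg_right (hM n y) (norm_nonneg _)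
    have l3 : ∀ r w, Tendsto (fun n => corrOp T p θ r (F n) w) atTop
        (𝓝 (corrOp T p θ r f w)) := by
      intro r w
      refine tendsto_integral_of_dominated_convergence
        (fun y => M * ‖corrKernel T p θ r w y‖) (fun n => (hintC (hFb n) r w).aestronglyMeasurable)
        ((hb.integrable_row hp hθ r w).norm.const_mul M)
        (fun n => Eventually.of_forall fun y => ?_)
        (Eventually.of_forall fun y => (hlim y).mul_const _)
      rw [norm_mul]
      exact mul_le_mul_of_nonneg_right (hM n y) (norm_nonneg _)
    have l4 : Tendsto (fun n => ∫ r in Ioc 0 t, op P (t - r) (corrOp T p θ r (F n)) x) atTop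
        (𝓝 (∫ r in Ioc 0 t, op P (t - r) (corrOp T p θ r f) x)) := by
      refine tendsto_integral_of_dominated_convergence (fun r => M * rate T ρ c r)
        (fun n => (integrableOn_op_corrOp hT hP hp hθ hb (hFb n) ht.2 x).aestronglyMeasurable)
        ((hb.integrable_rate hT).const_mul M).integrableOn (fun n => ?_)
        (Eventually.of_forall fun r => ?_)
      · filter_upwards [ae_restrict_mem measurableSet_Ioc] with r hr
        exact abs_op_corrOp_le hP hb (hM n) ⟨by linarith [hr.2], by linarith [hr.1, ht.2]⟩ r x
      · exact tendsto_op (M := M * rate T ρ c r)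
          (Eventually.of_forall fun n => (hb.isBddMeas_corrOp hp hθ (hFb n) r).1)
          (Eventually.of_forall fun n => hb.abs_corrOp_le (hM n) r) (l3 r)
    refine tendsto_nhds_unique l1 ?_
    simp_rw [hx]
    exact l2.add l4

end Duhamel

end Parametrix

namespace Parametrix

variable {d : ℕ}

/-! ### The parametrix series of a pair of kernels -/

/-- Terms of the parametrix series: `W₀ = D` and
`W_{n+1}(t, x, y) = ∫∫ W_n(t - r, x, w) A_r(w, y) dw dr`. -/
noncomputable def seriesTerm (D A : ℝ → Rd d → Rd d → ℝ) : ℕ → ℝ → Rd d → Rd d → ℝ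
  | 0, t, x, y => D t x y
  | n + 1, t, x, y => ∫ q : ℝ × Rd d, seriesTerm D A n (t - q.1) x q.2 * A q.1 q.2 y

/-- The parametrix series of the absolute values of the kernels. -/
noncomputable def seriesAbs (D A : ℝ → Rd d → Rd d → ℝ) : ℕ → ℝ → Rd d → Rd d → ℝ≥0∞
  | 0, t, x, y => ‖D t x y‖ₑ
  | n + 1, t, x, y => ∫⁻ q : ℝ × Rd d, seriesAbs D A n (t - q.1) x q.2 * ‖A q.1 q.2 y‖ₑ

/-- Jointly measurable kernels, vanishing at nonpositive times, whose marginal integrals are bounded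
by a constant, respectively by an integrable function of time. -/
structure KernelBounds (D A : ℝ → Rd d → Rd d → ℝ) (K : ℝ≥0∞) (R : ℝ → ℝ≥0∞) : Prop where
  measurable_left : Measurable fun q : ℝ × Rd d × Rd d => D q.1 q.2.1 q.2.2
  measurable_right : Measurable fun q : ℝ × Rd d × Rd d => A q.1 q.2.1 q.2.2
  left_zero : ∀ t ≤ 0, ∀ x y, D t x y = 0
  right_zero : ∀ t ≤ 0, ∀ x y, A t x y = 0
  const_ne_top : K ≠ ∞
  measurable_rate : Measurable R
  rate_ne_top : ∀ r, R r ≠ ∞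
  rate_zero : ∀ r ≤ 0, R r = 0
  lintegral_rate : ∫⁻ r, R r ≠ ∞
  left_row : ∀ t x, ∫⁻ y, ‖D t x y‖ₑ ≤ K
  left_col : ∀ t y, ∫⁻ x, ‖D t x y‖ₑ ≤ K
  right_row : ∀ t x, ∫⁻ y, ‖A t x y‖ₑ ≤ R t
  right_col : ∀ t y, ∫⁻ x, ‖A t x y‖ₑ ≤ R t

namespace KernelBounds

variable {D A : ℝ → Rd d → Rd d → ℝ} {K : ℝ≥0∞} {R : ℝ → ℝ≥0∞}

/-- `e^{-nr} R(r)` decreases to zero on `r > 0` and `R` is integrable. The value `1/2` becomes the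
ratio of the geometric series that dominates the parametrix series. -/
theorem exists_laplace_le (h : KernelBounds D A K R) :
    ∃ l : ℝ, 0 ≤ l ∧ ∫⁻ r, ENNReal.ofReal (Real.exp (-(l * r))) * R r ≤ 2⁻¹ := by
  have hlim : Tendsto (fun n : ℕ => ∫⁻ r, ENNReal.ofReal (Real.exp (-((n : ℝ) * r))) * R r) atTop
      (𝓝 (∫⁻ _ : ℝ, 0)) := by
    refine tendsto_lintegral_of_dominated_convergence R (fun n => ?_) (fun n => ?_)
      h.lintegral_rate ?_
    · have : Measurable fun r : ℝ => ENNReal.ofReal (Real.exp (-((n : ℝ) * r))) := by fun_prop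
      exact this.mul h.measurable_rate
    · refine Eventually.of_forall fun r => ?_
      rcases le_or_gt r 0 with hr | hr
      · simp [h.rate_zero r hr]
      · refine mul_le_of_le_one_left' (ENNReal.ofReal_le_one.2 (Real.exp_le_one_iff.2 ?_))
        have : (0 : ℝ) ≤ n * r := by positivity
        linarith
    · refine Eventually.of_forall fun r => ?_
      rcases le_or_gt r 0 with hr | hr
      · simp [h.rate_zero r hr]
      · have h1 : Tendsto (fun n : ℕ => (n : ℝ) * r) atTop atTop :=
          tendsto_natCast_atTop_atTop.atTop_mul_const hr
        have h2 := Real.tendsto_exp_neg_atTop_nhds_zero.comp h1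
        have h3 := (ENNReal.tendsto_ofReal h2)
        rw [ENNReal.ofReal_zero] at h3
        have h4 := ENNReal.Tendsto.mul_const (b := R r) h3 (Or.inr (h.rate_ne_top r))
        rw [zero_mul] at h4
        exact h4
  rw [lintegral_zero] at hlim
  have h2 : (0 : ℝ≥0∞) < 2⁻¹ := by simp
  obtain ⟨n, hn⟩ := (hlim.eventually (gt_mem_nhds h2)).exists
  exact ⟨n, Nat.cast_nonneg n, hn.le⟩

theorem measurable_seriesAbs (h : KernelBounds D A K R) (n : ℕ) :
    Measurable fun q : ℝ × Rd d × Rd d => seriesAbs D A n q.1 q.2.1 q.2.2 := by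
  induction n with
  | zero => exact h.measurable_left.enorm
  | succ n ih =>
    have m1 : Measurable fun u : (ℝ × Rd d × Rd d) × (ℝ × Rd d) =>
        ((u.1.1 - u.2.1, u.1.2.1, u.2.2) : ℝ × Rd d × Rd d) := by fun_prop
    have m2 : Measurable fun u : (ℝ × Rd d × Rd d) × (ℝ × Rd d) =>
        ((u.2.1, u.2.2, u.1.2.2) : ℝ × Rd d × Rd d) := by fun_prop
    have m3 := (ih.comp m1).mul (h.measurable_right.enorm.comp m2)
    exact m3.lintegral_prod_right'

theorem measurable_seriesTerm (h : KernelBounds D A K R) (n : ℕ) :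
    Measurable fun q : ℝ × Rd d × Rd d => seriesTerm D A n q.1 q.2.1 q.2.2 := by
  induction n with
  | zero => exact h.measurable_left
  | succ n ih =>
    have m1 : Measurable fun u : (ℝ × Rd d × Rd d) × (ℝ × Rd d) =>
        ((u.1.1 - u.2.1, u.1.2.1, u.2.2) : ℝ × Rd d × Rd d) := by fun_prop
    have m2 : Measurable fun u : (ℝ × Rd d × Rd d) × (ℝ × Rd d) =>
        ((u.2.1, u.2.2, u.1.2.2) : ℝ × Rd d × Rd d) := by fun_prop
    have m3 := (ih.comp m1).mul (h.measurable_right.comp m2)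
    exact m3.stronglyMeasurable.integral_prod_right'.measurable

theorem enorm_seriesTerm_le (n : ℕ) (t : ℝ) (x y : Rd d) :
    ‖seriesTerm D A n t x y‖ₑ ≤ seriesAbs D A n t x y := by
  induction n generalizing t y with
  | zero => exact le_rfl
  | succ n ih =>
    refine (enorm_integral_le_lintegral_enorm _).trans (lintegral_mono fun q => ?_)
    rw [enorm_mul]
    gcongr
    exact ih _ _

/-- For `t ≤ 0` either `r ≤ 0` and `A_r` vanishes, or `t - r < 0` and the previous term does. This
is why the time convolutions may be written over the whole line. -/
theorem seriesAbs_of_nonpos (h : KernelBounds D A K R) (n : ℕ) {t : ℝ} (ht : t ≤ 0) (x y : Rd d) :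
    seriesAbs D A n t x y = 0 := by
  induction n generalizing t y with
  | zero => simp [seriesAbs, h.left_zero t ht]
  | succ n ih =>
    have : ∀ q : ℝ × Rd d, seriesAbs D A n (t - q.1) x q.2 * ‖A q.1 q.2 y‖ₑ = 0 := by
      intro q
      rcases le_or_gt q.1 0 with hq | hq
      · simp [h.right_zero _ hq]
      · rw [ih (by linarith), zero_mul]
    simp [seriesAbs, this]

theorem seriesTerm_of_nonpos (h : KernelBounds D A K R) (n : ℕ) {t : ℝ} (ht : t ≤ 0) (x y : Rd d) :
    seriesTerm D A n t x y = 0 := by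
  have := enorm_seriesTerm_le (D := D) (A := A) n t x y
  rw [h.seriesAbs_of_nonpos n ht] at this
  simpa using this

/-- The integrated bound on the time convolution. -/
theorem lintegral_laplace_le {l : ℝ} (hm : Measurable R)
    (hl : ∫⁻ r, ENNReal.ofReal (Real.exp (-(l * r))) * R r ≤ 2⁻¹) (C : ℝ≥0∞) (t : ℝ) (n : ℕ) :
    ∫⁻ r, C * ENNReal.ofReal (Real.exp (l * (t - r))) * 2⁻¹ ^ n * R r
      ≤ C * ENNReal.ofReal (Real.exp (l * t)) * 2⁻¹ ^ (n + 1) := by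
  have e : ∀ r, C * ENNReal.ofReal (Real.exp (l * (t - r))) * 2⁻¹ ^ n * R r
      = C * ENNReal.ofReal (Real.exp (l * t)) * 2⁻¹ ^ n *
        (ENNReal.ofReal (Real.exp (-(l * r))) * R r) := by
    intro r
    have : l * (t - r) = l * t + -(l * r) := by ring
    rw [this, Real.exp_add, ENNReal.ofReal_mul (Real.exp_pos _).le]
    ring
  simp_rw [e]
  have m1 : Measurable fun r : ℝ => ENNReal.ofReal (Real.exp (-(l * r))) := by fun_prop
  have m2 : Measurable fun r : ℝ => ENNReal.ofReal (Real.exp (-(l * r))) * R r := m1.mul hm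
  rw [lintegral_const_mul _ m2, pow_succ, ← mul_assoc]
  gcongr

/-- Integrating the last variable first uses the row bound of `A`, leaving a time convolution with
`R`, which costs a factor `1/2` under the exponential weight. -/
theorem lintegral_seriesAbs_row_le (h : KernelBounds D A K R) {l : ℝ} (hl0 : 0 ≤ l)
    (hl : ∫⁻ r, ENNReal.ofReal (Real.exp (-(l * r))) * R r ≤ 2⁻¹) (n : ℕ) (t : ℝ) (x : Rd d) :
    ∫⁻ y, seriesAbs D A n t x y ≤ K * ENNReal.ofReal (Real.exp (l * t)) * 2⁻¹ ^ n := by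
  induction n generalizing t with
  | zero =>
    rcases le_or_gt t 0 with ht | ht
    · simp [h.seriesAbs_of_nonpos 0 ht]
    · rw [pow_zero, mul_one]
      refine (h.left_row t x).trans (le_mul_of_one_le_right' ?_)
      rw [ENNReal.one_le_ofReal]
      exact Real.one_le_exp (by positivity)
  | succ n ih =>
    have m1 : Measurable fun u : Rd d × (ℝ × Rd d) =>
        ((t - u.2.1, x, u.2.2) : ℝ × Rd d × Rd d) := by fun_prop
    have m2 : Measurable fun u : Rd d × (ℝ × Rd d) =>
        ((u.2.1, u.2.2, u.1) : ℝ × Rd d × Rd d) := by fun_prop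
    have m3 := ((h.measurable_seriesAbs n).comp m1).mul (h.measurable_right.enorm.comp m2)
    have m4 : Measurable fun u : ℝ × Rd d => ((t - u.1, x, u.2) : ℝ × Rd d × Rd d) := by fun_prop
    have m5 := (h.measurable_seriesAbs n).comp m4
    calc ∫⁻ y, seriesAbs D A (n + 1) t x y
        = ∫⁻ q : ℝ × Rd d, ∫⁻ y, seriesAbs D A n (t - q.1) x q.2 * ‖A q.1 q.2 y‖ₑ :=
          lintegral_lintegral_swap m3.aemeasurable
      _ ≤ ∫⁻ q : ℝ × Rd d, seriesAbs D A n (t - q.1) x q.2 * R q.1 := by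
          refine lintegral_mono fun q => ?_
          have m6 : Measurable fun y => A q.1 q.2 y := by
            have m7 : Measurable fun y : Rd d => ((q.1, q.2, y) : ℝ × Rd d × Rd d) := by fun_prop
            exact h.measurable_right.comp m7
          rw [lintegral_const_mul _ m6.enorm]
          gcongr
          exact h.right_row _ _
      _ = ∫⁻ r, ∫⁻ w, seriesAbs D A n (t - r) x w * R r := by
          rw [Measure.volume_eq_prod, lintegral_prod]
          exact (m5.mul (h.measurable_rate.comp measurable_fst)).aemeasurable
      _ ≤ ∫⁻ r, K * ENNReal.ofReal (Real.exp (l * (t - r))) * 2⁻¹ ^ n * R r := by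
          refine lintegral_mono fun r => ?_
          rw [lintegral_mul_const' _ _ (h.rate_ne_top r)]
          gcongr
          exact ih _
      _ ≤ _ := lintegral_laplace_le h.measurable_rate hl K t n

/-- Mirror image of the row estimate: here the first variable is integrated first, by the induction
hypothesis, and the column bound of `A` comes last. -/
theorem lintegral_seriesAbs_col_le (h : KernelBounds D A K R) {l : ℝ} (hl0 : 0 ≤ l)
    (hl : ∫⁻ r, ENNReal.ofReal (Real.exp (-(l * r))) * R r ≤ 2⁻¹) (n : ℕ) (t : ℝ) (y : Rd d) :
    ∫⁻ x, seriesAbs D A n t x y ≤ K * ENNReal.ofReal (Real.exp (l * t)) * 2⁻¹ ^ n := by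
  induction n generalizing t y with
  | zero =>
    rcases le_or_gt t 0 with ht | ht
    · simp [h.seriesAbs_of_nonpos 0 ht]
    · rw [pow_zero, mul_one]
      refine (h.left_col t y).trans (le_mul_of_one_le_right' ?_)
      rw [ENNReal.one_le_ofReal]
      exact Real.one_le_exp (by positivity)
  | succ n ih =>
    have m1 : Measurable fun u : Rd d × (ℝ × Rd d) =>
        ((t - u.2.1, u.1, u.2.2) : ℝ × Rd d × Rd d) := by fun_prop
    have m2 : Measurable fun u : Rd d × (ℝ × Rd d) =>
        ((u.2.1, u.2.2, y) : ℝ × Rd d × Rd d) := by fun_prop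
    have m3 := ((h.measurable_seriesAbs n).comp m1).mul (h.measurable_right.enorm.comp m2)
    have m4 : Measurable fun u : ℝ × Rd d => ((u.1, u.2, y) : ℝ × Rd d × Rd d) := by fun_prop
    have m5 := h.measurable_right.enorm.comp m4
    have m6 : Measurable fun r : ℝ => K * ENNReal.ofReal (Real.exp (l * (t - r))) * 2⁻¹ ^ n := by
      fun_prop
    calc ∫⁻ x, seriesAbs D A (n + 1) t x y
        = ∫⁻ q : ℝ × Rd d, ∫⁻ x, seriesAbs D A n (t - q.1) x q.2 * ‖A q.1 q.2 y‖ₑ :=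
          lintegral_lintegral_swap m3.aemeasurable
      _ ≤ ∫⁻ q : ℝ × Rd d, K * ENNReal.ofReal (Real.exp (l * (t - q.1))) * 2⁻¹ ^ n *
            ‖A q.1 q.2 y‖ₑ := by
          refine lintegral_mono fun q => ?_
          rw [lintegral_mul_const' _ _ enorm_ne_top]
          gcongr
          exact ih _ _
      _ = ∫⁻ r, ∫⁻ w, K * ENNReal.ofReal (Real.exp (l * (t - r))) * 2⁻¹ ^ n * ‖A r w y‖ₑ := by
          rw [Measure.volume_eq_prod, lintegral_prod]
          exact ((m6.comp measurable_fst).mul m5).aemeasurable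
      _ ≤ ∫⁻ r, K * ENNReal.ofReal (Real.exp (l * (t - r))) * 2⁻¹ ^ n * R r := by
          refine lintegral_mono fun r => ?_
          have m7 : Measurable fun w => A r w y := by
            have m8 : Measurable fun w : Rd d => ((r, w, y) : ℝ × Rd d × Rd d) := by fun_prop
            exact h.measurable_right.comp m8
          rw [lintegral_const_mul _ m7.enorm]
          gcongr
          exact h.right_col _ _
      _ ≤ _ := lintegral_laplace_le h.measurable_rate hl K t n

theorem exists_tsum_bound (h : KernelBounds D A K R) (t : ℝ) :
    ∃ C : ℝ≥0∞, C ≠ ∞ ∧ (∀ x, ∫⁻ y, ∑' n, seriesAbs D A n t x y ≤ C) ∧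
      ∀ y, ∫⁻ x, ∑' n, seriesAbs D A n t x y ≤ C := by
  obtain ⟨l, hl0, hl⟩ := h.exists_laplace_le
  -- The final `2` is the sum of the geometric series of ratio `1/2`.
  refine ⟨K * ENNReal.ofReal (Real.exp (l * t)) * 2, ?_, fun x => ?_, fun y => ?_⟩
  · exact ENNReal.mul_ne_top (ENNReal.mul_ne_top h.const_ne_top ENNReal.ofReal_ne_top) (by simp)
  · have m : ∀ n, Measurable fun y => seriesAbs D A n t x y := fun n => by
      have m1 : Measurable fun y : Rd d => ((t, x, y) : ℝ × Rd d × Rd d) := by fun_prop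
      exact (h.measurable_seriesAbs n).comp m1
    rw [lintegral_tsum fun n => (m n).aemeasurable]
    refine (ENNReal.tsum_le_tsum fun n => h.lintegral_seriesAbs_row_le hl0 hl n t x).trans ?_
    rw [ENNReal.tsum_mul_left, ENNReal.tsum_geometric]
    simp [ENNReal.one_sub_inv_two]
  · have m : ∀ n, Measurable fun x => seriesAbs D A n t x y := fun n => by
      have m1 : Measurable fun x : Rd d => ((t, x, y) : ℝ × Rd d × Rd d) := by fun_prop
      exact (h.measurable_seriesAbs n).comp m1
    rw [lintegral_tsum fun n => (m n).aemeasurable]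
    refine (ENNReal.tsum_le_tsum fun n => h.lintegral_seriesAbs_col_le hl0 hl n t y).trans ?_
    rw [ENNReal.tsum_mul_left, ENNReal.tsum_geometric]
    simp [ENNReal.one_sub_inv_two]

/-- Fubini's theorem for a term of the series. -/
theorem integral_mul_seriesTerm_succ (h : KernelBounds D A K R) (n : ℕ) (t : ℝ) (x : Rd d)
    {f : Rd d → ℝ} (hf : IsBddMeas f) :
    ∫ y, f y * seriesTerm D A (n + 1) t x y
      = ∫ r, ∫ w, (∫ y, f y * A r w y) * seriesTerm D A n (t - r) x w := by
  obtain ⟨l, hl0, hl⟩ := h.exists_laplace_le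
  obtain ⟨M, hM⟩ := hf.2
  have m1 : Measurable fun u : Rd d × (ℝ × Rd d) =>
      ((t - u.2.1, x, u.2.2) : ℝ × Rd d × Rd d) := by fun_prop
  have m2 : Measurable fun u : Rd d × (ℝ × Rd d) =>
      ((u.2.1, u.2.2, u.1) : ℝ × Rd d × Rd d) := by fun_prop
  have m3 := ((h.measurable_seriesTerm n).comp m1).mul (h.measurable_right.comp m2)
  have m4 : Measurable fun u : Rd d × (ℝ × Rd d) =>
      f u.1 * (seriesTerm D A n (t - u.2.1) x u.2.2 * A u.2.1 u.2.2 u.1) :=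
    (hf.1.comp measurable_fst).mul m3
  have hfin : ∫⁻ y, ∫⁻ q : ℝ × Rd d, seriesAbs D A n (t - q.1) x q.2 * ‖A q.1 q.2 y‖ₑ < ∞ := by
    refine (h.lintegral_seriesAbs_row_le hl0 hl (n + 1) t x).trans_lt ?_
    exact ENNReal.mul_lt_top (ENNReal.mul_lt_top h.const_ne_top.lt_top ENNReal.ofReal_lt_top)
      (by finiteness)
  have hint0 : Integrable (fun u : Rd d × (ℝ × Rd d) =>
      seriesTerm D A n (t - u.2.1) x u.2.2 * A u.2.1 u.2.2 u.1)
      ((volume : Measure (Rd d)).prod (volume : Measure (ℝ × Rd d))) := by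
    refine ⟨m3.aestronglyMeasurable, ?_⟩
    have m3' : Measurable fun u : Rd d × (ℝ × Rd d) =>
        ‖seriesTerm D A n (t - u.2.1) x u.2.2 * A u.2.1 u.2.2 u.1‖ₑ := m3.enorm
    rw [HasFiniteIntegral, lintegral_prod _ m3'.aemeasurable]
    refine lt_of_le_of_lt (lintegral_mono fun y => lintegral_mono fun q => ?_) hfin
    rw [enorm_mul]
    gcongr
    exact enorm_seriesTerm_le n _ _ _
  have hint : Integrable (fun u : Rd d × (ℝ × Rd d) =>
      f u.1 * (seriesTerm D A n (t - u.2.1) x u.2.2 * A u.2.1 u.2.2 u.1))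
      ((volume : Measure (Rd d)).prod (volume : Measure (ℝ × Rd d))) :=
    hint0.bdd_mul (c := M) (hf.1.comp measurable_fst).aestronglyMeasurable
      (Eventually.of_forall fun u => hM u.1)
  have e1 : ∀ y, f y * seriesTerm D A (n + 1) t x y
      = ∫ q : ℝ × Rd d, f y * (seriesTerm D A n (t - q.1) x q.2 * A q.1 q.2 y) := by
    intro y
    rw [integral_const_mul]
    rfl
  simp_rw [e1]
  rw [integral_integral_swap hint]
  have hint2 : Integrable (fun q : ℝ × Rd d => ∫ y, f y *
      (seriesTerm D A n (t - q.1) x q.2 * A q.1 q.2 y))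
      ((volume : Measure ℝ).prod (volume : Measure (Rd d))) := hint.integral_prod_right
  rw [Measure.volume_eq_prod, integral_prod _ hint2]
  refine integral_congr_ae (Eventually.of_forall fun r => integral_congr_ae
    (Eventually.of_forall fun w => ?_))
  simp only
  rw [← integral_mul_const]
  refine integral_congr_ae (Eventually.of_forall fun y => ?_)
  simp only
  ring

theorem lintegral_enorm_seriesTerm_row_le (h : KernelBounds D A K R) {l : ℝ} (hl0 : 0 ≤ l)
    (hl : ∫⁻ r, ENNReal.ofReal (Real.exp (-(l * r))) * R r ≤ 2⁻¹) (n : ℕ) (t : ℝ) (x : Rd d) :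
    ∫⁻ y, ‖seriesTerm D A n t x y‖ₑ ≤ K * ENNReal.ofReal (Real.exp (l * t)) * 2⁻¹ ^ n :=
  (lintegral_mono fun y => enorm_seriesTerm_le n t x y).trans
    (h.lintegral_seriesAbs_row_le hl0 hl n t x)

end KernelBounds

end Parametrix

namespace Parametrix

variable {d : ℕ} {T : ℝ} {P : ℝ → Rd d → SignedMeasure (Rd d)}
  {p : ℝ → Rd d → Rd d → Rd d → ℝ} {θ : ℝ → Rd d → Rd d → ℝ} {ρ c K : ℝ}

/-! ### The parametrix series is the density of the semigroup -/

theorem measurable_rate : Measurable (rate T ρ c) := by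
  unfold rate
  exact Measurable.ite measurableSet_Ioc
    (measurable_const.mul (measurable_id.pow_const _)) measurable_const

theorem CorrBound.kernelBounds (hT : 0 < T) (hp : IsFrozenFamily T p)
    (hθ : IsBackwardWeight T P p θ) (hb : CorrBound T p θ ρ c) (hK : DiagBound T p K) :
    KernelBounds (diagDensity T p) (corrKernel T p θ) (ENNReal.ofReal K)
      fun r => ENNReal.ofReal (rate T ρ c r) where
  measurable_left := hp.measurable_diagDensity
  measurable_right := hp.measurable_corrKernel hθ
  left_zero t ht x y := diagDensity_of_notMem (fun h => absurd h.1 (not_lt.2 ht)) x y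
  right_zero t ht x y := corrKernel_of_notMem (fun h => absurd h.1 (not_lt.2 ht)) x y
  const_ne_top := ENNReal.ofReal_ne_top
  measurable_rate := measurable_rate.ennreal_ofReal
  rate_ne_top r := ENNReal.ofReal_ne_top
  rate_zero r hr := by
    rw [rate, if_neg fun h => absurd h.1 (not_lt.2 hr), ENNReal.ofReal_zero]
  lintegral_rate := by
    have h := (hb.integrable_rate hT).2
    rw [HasFiniteIntegral] at h
    refine (lt_of_le_of_lt (lintegral_mono fun r => ?_) h).ne
    rw [Real.enorm_of_nonneg (hb.rate_nonneg r)]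
  left_row := hK.row
  left_col := hK.col
  right_row := hb.row
  right_col := hb.col

section Density

variable (hT : 0 < T) (hP : IsSemigroup T P) (hp : IsFrozenFamily T p)
  (hL : GeneratorsAgree T P p) (hreg : BackwardRegular T P p) (hθ : IsBackwardWeight T P p θ)
  (hb : CorrBound T p θ ρ c) (hK : DiagBound T p K)

include hT hP hp hL hreg hθ hb hK

/-- By Duhamel's formula the remainder of order `n + 1` for `f` is `∫_0^t` of the remainder of order
`n` at time `t - r` for `corrOp f`, whose supremum is at most `M` times the rate at `r`. The Laplace
weight gains `1/2` at each step; the induction ranges over `t`, `f` and `M`, since all three change.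
-/
theorem enorm_op_sub_sum_le {l : ℝ} (hl0 : 0 ≤ l)
    (hl : ∫⁻ r, ENNReal.ofReal (Real.exp (-(l * r))) * ENNReal.ofReal (rate T ρ c r) ≤ 2⁻¹)
    (n : ℕ) {t : ℝ} (ht : t ∈ Ioc 0 T) {f : Rd d → ℝ} (hf : IsBddMeas f) {M : ℝ}
    (hM : ∀ y, |f y| ≤ M) :
    ∀ᵐ x, ‖op P t f x - ∑ k ∈ Finset.range n,
        ∫ y, f y * seriesTerm (diagDensity T p) (corrKernel T p θ) k t x y‖ₑ
      ≤ ENNReal.ofReal M * ENNReal.ofReal (Real.exp (l * t)) * 2⁻¹ ^ n := by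
  have hker := hb.kernelBounds hT hp hθ hK
  induction n generalizing t f M with
  | zero =>
    refine Eventually.of_forall fun x => ?_
    have hM0 : 0 ≤ M := (abs_nonneg _).trans (hM 0)
    rw [Finset.sum_range_zero, sub_zero, pow_zero, mul_one, ← ofReal_norm, Real.norm_eq_abs]
    refine (ENNReal.ofReal_le_ofReal (hP.abs_op_le (Ioc_subset_Icc_self ht) hM x)).trans
      (le_mul_of_one_le_right' ?_)
    rw [ENNReal.one_le_ofReal]
    exact Real.one_le_exp (mul_nonneg hl0 ht.1.le)
  | succ n ih =>
    have hM0 : 0 ≤ M := (abs_nonneg _).trans (hM 0)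
    set W := seriesTerm (diagDensity T p) (corrKernel T p θ) with hW
    set S : ℕ → ℝ → Rd d → ℝ := fun k r x => ∫ w, corrOp T p θ r f w * W k (t - r) x w with hS
    set H : ℝ → Rd d → ℝ := fun r x => op P (clampTime T (t - r)) (corrOp T p θ r f) x
      - ∑ k ∈ Finset.range n, S k r x with hH
    have hSm : ∀ k, Measurable fun q : ℝ × Rd d => S k q.1 q.2 := by
      intro k
      have m1 : Measurable fun u : (ℝ × Rd d) × Rd d => (u.1.1, u.2) := by fun_prop
      have m2 : Measurable fun u : (ℝ × Rd d) × Rd d =>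
          ((t - u.1.1, u.1.2, u.2) : ℝ × Rd d × Rd d) := by fun_prop
      have m3 := ((hp.measurable_corrOp hθ hf.1).comp m1).mul
        ((hker.measurable_seriesTerm k).comp m2)
      exact m3.stronglyMeasurable.integral_prod_right'.measurable
    have hHm : Measurable fun q : ℝ × Rd d => H q.1 q.2 := by
      have m1 : Measurable fun q : ℝ × Rd d => ((t, q.1, q.2) : ℝ × ℝ × Rd d) := by fun_prop
      have m2 := (hP.measurable_op_corrOp hT hp hθ hb hf).comp m1
      exact m2.sub (Finset.measurable_sum _ fun k _ => hSm k)
    set B : ℝ → ℝ≥0∞ := fun r => ENNReal.ofReal M * ENNReal.ofReal (Real.exp (l * (t - r))) *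
      2⁻¹ ^ n * ENNReal.ofReal (rate T ρ c r) with hB
    have hBm : Measurable B := by
      have : Measurable fun r : ℝ => ENNReal.ofReal (Real.exp (l * (t - r))) := by fun_prop
      exact ((measurable_const.mul this).mul_const _).mul measurable_rate.ennreal_ofReal
    -- The induction hypothesis holds for each `r` at almost every `x`; joint measurability
    -- exchanges the two quantifiers.
    have hswap : ∀ᵐ x, ∀ᵐ r ∂(volume.restrict (Ioc 0 t)), ‖H r x‖ₑ ≤ B r := by
      have hms : MeasurableSet {q : ℝ × Rd d | ‖H q.1 q.2‖ₑ ≤ B q.1} :=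
        measurableSet_le hHm.enorm (hBm.comp measurable_fst)
      refine (Measure.ae_ae_comm (μ := volume.restrict (Ioc 0 t)) (ν := volume)
        (p := fun r x => ‖H r x‖ₑ ≤ B r) hms).1 ?_
      -- At `r = t` the remaining time would be zero, where the induction hypothesis says nothing.
      have hne : ∀ᵐ r : ℝ, r ≠ t := by simp [ae_iff]
      filter_upwards [ae_restrict_mem measurableSet_Ioc, ae_restrict_of_ae hne] with r hr hrt
      have hr' : t - r ∈ Ioc 0 T :=
        ⟨sub_pos.2 (lt_of_le_of_ne hr.2 hrt), by linarith [hr.1, ht.2]⟩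
      filter_upwards [ih hr' (hb.isBddMeas_corrOp hp hθ hf r) (hb.abs_corrOp_le hM r)] with x hx
      simp only [hH, hB, hS]
      rw [clampTime_of_mem (Ioc_subset_Icc_self hr')]
      refine hx.trans (le_of_eq ?_)
      rw [ENNReal.ofReal_mul hM0]
      ring
    have hSint : ∀ k x, Integrable fun r => S k r x := by
      intro k x
      have m1 : Measurable fun r : ℝ => ((r, x) : ℝ × Rd d) := by fun_prop
      refine ⟨((hSm k).comp m1).aestronglyMeasurable, ?_⟩
      rw [HasFiniteIntegral]
      refine lt_of_le_of_lt (lintegral_mono fun r => ?_)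
        ((KernelBounds.lintegral_laplace_le hker.measurable_rate hl
          (ENNReal.ofReal M * ENNReal.ofReal K) t k).trans_lt (by finiteness))
      refine (enorm_integral_le_lintegral_enorm _).trans
        ((lintegral_enorm_mul_le (hb.abs_corrOp_le hM r)).trans
          ((mul_le_mul_right (hker.lintegral_enorm_seriesTerm_row_le hl0 hl k _ x) _).trans
            (le_of_eq ?_)))
      rw [ENNReal.ofReal_mul hM0]
      ring
    -- The integral over the line reduces to `(0, t]` because one of the two kernels vanishes
    -- elsewhere.
    have hSset : ∀ k x, ∫ y, f y * W (k + 1) t x y = ∫ r in Ioc 0 t, S k r x := by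
      intro k x
      rw [hW, hker.integral_mul_seriesTerm_succ k t x hf]
      refine (setIntegral_eq_integral_of_forall_compl_eq_zero fun r hr => ?_).symm
      simp only [mem_Ioc, not_and_or, not_lt, not_le] at hr
      rcases hr with hr | hr
      · simp [hker.right_zero r hr]
      · simp [hker.seriesTerm_of_nonpos k (sub_nonpos.2 hr.le)]
    filter_upwards [duhamel hT hP hp hL hreg hθ hb hf ht, hswap] with x hx hxH
    have hint := integrableOn_op_corrOp hT hP hp hθ hb hf ht.2 x
    have key : op P t f x - ∑ k ∈ Finset.range (n + 1), ∫ y, f y * W k t x y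
        = ∫ r in Ioc 0 t, H r x := by
      rw [Finset.sum_range_succ']
      simp_rw [hSset]
      rw [← integral_finsetSum _ fun k _ => (hSint k x).integrableOn, hx]
      have e0 : ∫ y, f y * W 0 t x y = diagOp T p t f x := rfl
      rw [e0]
      have e1 : ∫ r in Ioc 0 t, H r x = ∫ r in Ioc 0 t, (op P (t - r) (corrOp T p θ r f) x
          - ∑ k ∈ Finset.range n, S k r x) := by
        refine setIntegral_congr_fun measurableSet_Ioc fun r hr => ?_
        simp only [hH]
        rw [clampTime_of_mem ⟨by linarith [hr.2], by linarith [hr.1, ht.2]⟩]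
      rw [e1, integral_sub hint (integrable_finsetSum _ fun k _ => (hSint k x).integrableOn)]
      ring
    rw [key]
    calc ‖∫ r in Ioc 0 t, H r x‖ₑ ≤ ∫⁻ r in Ioc 0 t, ‖H r x‖ₑ :=
          enorm_integral_le_lintegral_enorm _
      _ ≤ ∫⁻ r in Ioc 0 t, B r := lintegral_mono_ae hxH
      _ ≤ ∫⁻ r, B r := setLIntegral_le_lintegral _ _
      _ ≤ _ := KernelBounds.lintegral_laplace_le hker.measurable_rate hl (ENNReal.ofReal M) t n

/-- For almost every `x`, the measure `P_t(x, ·)` integrates bounded functions like the density given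
by the parametrix series. -/
theorem ae_op_eq_integral_tsum {t : ℝ} (ht : t ∈ Ioc 0 T) {f : Rd d → ℝ} (hf : IsBddMeas f) :
    ∀ᵐ x, op P t f x
      = ∫ y, f y * ∑' k, seriesTerm (diagDensity T p) (corrKernel T p θ) k t x y := by
  have hker := hb.kernelBounds hT hp hθ hK
  obtain ⟨l, hl0, hl⟩ := hker.exists_laplace_le
  obtain ⟨M, hM⟩ := hf.2
  have hM0 : 0 ≤ M := (abs_nonneg _).trans (hM 0)
  filter_upwards [ae_all_iff.2 fun n =>
    enorm_op_sub_sum_le hT hP hp hL hreg hθ hb hK hl0 hl n ht hf hM] with x hx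
  set W := seriesTerm (diagDensity T p) (corrKernel T p θ) with hW
  have hlim : Tendsto (fun n => ENNReal.ofReal M * ENNReal.ofReal (Real.exp (l * t)) * 2⁻¹ ^ n)
      atTop (𝓝 0) := by
    have h1 : Tendsto (fun n : ℕ => (2⁻¹ : ℝ≥0∞) ^ n) atTop (𝓝 0) :=
      ENNReal.tendsto_pow_atTop_nhds_zero_of_lt_one (by simp)
    have h2 := ENNReal.Tendsto.const_mul
      (a := ENNReal.ofReal M * ENNReal.ofReal (Real.exp (l * t))) h1
      (Or.inr (by finiteness))
    rwa [mul_zero] at h2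
  have hm : ∀ k, Measurable fun y => W k t x y := fun k => by
    have m1 : Measurable fun y : Rd d => ((t, x, y) : ℝ × Rd d × Rd d) := by fun_prop
    exact (hker.measurable_seriesTerm k).comp m1
  have hsum : HasSum (fun k => ∫ y, f y * W k t x y) (∫ y, ∑' k, f y * W k t x y) := by
    have hfin : ∀ k, ∫⁻ y, ‖f y * W k t x y‖ₑ ≤ ENNReal.ofReal M *
        (ENNReal.ofReal K * ENNReal.ofReal (Real.exp (l * t)) * 2⁻¹ ^ k) := fun k =>
      (lintegral_enorm_mul_le hM).trans
        (mul_le_mul_right (hker.lintegral_enorm_seriesTerm_row_le hl0 hl k t x) _)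
    refine hasSum_integral_of_summable_integral_norm (fun k => ⟨(hf.1.mul (hm k)).aestronglyMeasurable,
      (hfin k).trans_lt (by finiteness)⟩) ?_
    have e : ∀ k, ∫ y, ‖f y * W k t x y‖ = (∫⁻ y, ‖f y * W k t x y‖ₑ).toReal := fun k =>
      integral_norm_eq_lintegral_enorm (hf.1.mul (hm k)).aestronglyMeasurable
    simp_rw [e]
    refine ENNReal.summable_toReal (ne_top_of_le_ne_top ?_ (ENNReal.tsum_le_tsum hfin))
    rw [ENNReal.tsum_mul_left, ENNReal.tsum_mul_left, ENNReal.tsum_geometric]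
    simp only [ENNReal.one_sub_inv_two, inv_inv]
    finiteness
  simp_rw [tsum_mul_left] at hsum
  refine tendsto_nhds_unique ?_ hsum.tendsto_sum_nat
  rw [tendsto_iff_edist_tendsto_0]
  refine tendsto_of_tendsto_of_tendsto_of_le_of_le tendsto_const_nhds hlim (fun _ => zero_le)
    fun n => ?_
  rw [edist_comm, edist_eq_enorm_sub]
  exact hx n

omit hP hL hreg in
theorem integrable_tsum_seriesTerm (t : ℝ) (x : Rd d) :
    Integrable fun y => ∑' k, seriesTerm (diagDensity T p) (corrKernel T p θ) k t x y := by
  have hker := hb.kernelBounds hT hp hθ hK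
  obtain ⟨C, hC, hrow, -⟩ := hker.exists_tsum_bound t
  have hm : ∀ k, Measurable fun y =>
      seriesTerm (diagDensity T p) (corrKernel T p θ) k t x y := fun k => by
    have m1 : Measurable fun y : Rd d => ((t, x, y) : ℝ × Rd d × Rd d) := by fun_prop
    exact (hker.measurable_seriesTerm k).comp m1
  refine ⟨(Measurable.tsum hm).aestronglyMeasurable, ?_⟩
  refine lt_of_le_of_lt (lintegral_mono fun y => ?_) ((hrow x).trans_lt hC.lt_top)
  refine (enorm_tsum_le_tsum_enorm).trans (ENNReal.tsum_le_tsum fun k => ?_)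
  exact KernelBounds.enorm_seriesTerm_le k t x y

/-- One null set must serve all `f`. It is obtained from the indicators of a countable algebra
generating the Borel sets; at a fixed good `x` the monotone class theorem reaches every bounded
measurable function. -/
theorem ae_forall_op_eq_integral_tsum {t : ℝ} (ht : t ∈ Ioc 0 T) :
    ∀ᵐ x, ∀ f : Rd d → ℝ, IsBddMeas f → op P t f x
      = ∫ y, f y * ∑' k, seriesTerm (diagDensity T p) (corrKernel T p θ) k t x y := by
  obtain ⟨b, hbc, -, hbase⟩ := TopologicalSpace.exists_countable_basis (Rd d)
  set 𝒮 := generateSetAlgebra b with h𝒮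
  have hcount : 𝒮.Countable := countable_generateSetAlgebra hbc
  have hgen : (inferInstance : MeasurableSpace (Rd d)) = MeasurableSpace.generateFrom 𝒮 := by
    rw [h𝒮, generateFrom_generateSetAlgebra_eq, ← hbase.borel_eq_generateFrom]
    exact BorelSpace.measurable_eq
  have hpi : IsPiSystem 𝒮 := fun s hs u hu _ =>
    isSetAlgebra_generateSetAlgebra.inter_mem hs hu
  have hmeas : ∀ A ∈ 𝒮, MeasurableSet A := fun A hA => by
    have h1 : MeasurableSet[MeasurableSpace.generateFrom 𝒮] A :=
      MeasurableSpace.measurableSet_generateFrom hA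
    rwa [← hgen] at h1
  have hind : ∀ A : Set (Rd d), MeasurableSet A → IsBddMeas (A.indicator fun _ => (1 : ℝ)) :=
    fun A hA => ⟨measurable_const.indicator hA, 1, fun x => by
      by_cases hx : x ∈ A <;> simp [hx]⟩
  have hone : IsBddMeas fun _ : Rd d => (1 : ℝ) := ⟨measurable_const, 1, fun _ => by simp⟩
  filter_upwards [(ae_ball_iff hcount).2 fun A hA =>
      ae_op_eq_integral_tsum hT hP hp hL hreg hθ hb hK ht (hind A (hmeas A hA)),
    ae_op_eq_integral_tsum hT hP hp hL hreg hθ hb hK ht hone] with x hx hx1 f hf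
  set G : Rd d → ℝ := fun y =>
    ∑' k, seriesTerm (diagDensity T p) (corrKernel T p θ) k t x y with hG
  have hGi : Integrable G := integrable_tsum_seriesTerm hT hp hθ hb hK t x
  have hfG : ∀ {f : Rd d → ℝ}, Measurable f → (∃ M, ∀ x, |f x| ≤ M) →
      Integrable fun y => f y * G y := fun hf ⟨M, hM⟩ =>
    hGi.bdd_mul (c := M) hf.aestronglyMeasurable (Eventually.of_forall hM)
  refine boundedMeasurable_induction (C := fun f => op P t f x = ∫ y, f y * G y) hgen hpi
    hx1 hx ?_ ?_ ?_ f hf.1 hf.2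
  · intro f g hf hg hfb hgb ihf ihg
    rw [op_add_fun ⟨hf, hfb⟩ ⟨hg, hgb⟩, ihf, ihg, ← integral_add (hfG hf hfb) (hfG hg hgb)]
    simp only [add_mul]
  · intro k f _ _ ih
    rw [op_const_mul, ih, ← integral_const_mul]
    simp only [mul_assoc]
  · intro F f M hF hM hlim ih
    refine tendsto_nhds_unique (tendsto_op (Eventually.of_forall hF) (Eventually.of_forall hM)
      hlim) ?_
    simp_rw [ih]
    refine tendsto_integral_of_dominated_convergence (fun y => M * ‖G y‖)
      (fun n => (hfG (hF n) ⟨M, hM n⟩).aestronglyMeasurable) (hGi.norm.const_mul M)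
      (fun n => Eventually.of_forall fun y => ?_)
      (Eventually.of_forall fun y => (hlim y).mul_const _)
    rw [norm_mul]
    exact mul_le_mul_of_nonneg_right (hM n y) (norm_nonneg _)

end Density

/-! ### Signed measures with a density -/

theorem op_indicator_one {s : ℝ} {x : Rd d} {A : Set (Rd d)} (hA : MeasurableSet A) :
    op P s (A.indicator fun _ => 1) x = P s x A := by
  have h := VectorMeasure.integral_indicator_const (μ := P s x)
    (B := (ContinuousLinearMap.lsmul ℝ ℝ).flip) (1 : ℝ) hA
  refine h.trans ?_
  simp

/-- If `P_s(x, ·)` has density `G`, then it integrates every function `h` such that `h G` is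
integrable, with the expected value. -/
theorem integrable_and_op_eq_of_density {s : ℝ} {x : Rd d} {G : Rd d → ℝ} (hG : Integrable G)
    (hop : ∀ f : Rd d → ℝ, IsBddMeas f → op P s f x = ∫ y, f y * G y) {h : Rd d → ℝ}
    (hh : AEStronglyMeasurable h) (hhG : Integrable fun y => h y * G y) :
    (P s x).Integrable h ∧ op P s h x = ∫ y, h y * G y := by
  have hset : ∀ A : Set (Rd d), MeasurableSet A → P s x A = ∫ y in A, G y := by
    intro A hA
    rw [← op_indicator_one hA, hop _ ⟨measurable_const.indicator hA, 1, fun x => by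
      by_cases hx : x ∈ A <;> simp [hx]⟩, ← integral_indicator hA]
    refine integral_congr_ae (Eventually.of_forall fun y => ?_)
    by_cases hy : y ∈ A <;> simp [hy]
  -- Domination by `|G| dy` makes Lebesgue null sets null for the variation, and reduces
  -- integrability of `h` to that of `h G`.
  have hvar : (P s x).variation ≤ volume.withDensity fun y => ‖G y‖ₑ := by
    refine VectorMeasure.variation_le_of_forall_enorm_le fun A hA => ?_
    rw [withDensity_apply _ hA, hset A hA]
    exact enorm_integral_le_lintegral_enorm _
  have hac : (P s x).variation ≪ volume :=
    (Measure.absolutelyContinuous_of_le hvar).trans (withDensity_absolutelyContinuous _ _)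
  have main : ∀ h : Rd d → ℝ, Measurable h → Integrable (fun y => h y * G y) →
      (P s x).Integrable h ∧ op P s h x = ∫ y, h y * G y := by
    intro h hm hi
    have hint : (P s x).Integrable h := by
      refine ⟨hm.aestronglyMeasurable, ?_⟩
      refine (lintegral_mono' hvar le_rfl).trans_lt ?_
      rw [lintegral_withDensity_eq_lintegral_mul₀ hG.1.enorm hm.enorm.aemeasurable]
      refine lt_of_le_of_lt (lintegral_mono fun y => ?_) hi.2
      simp only [Pi.mul_apply, enorm_mul, mul_comm, le_refl]
    refine ⟨hint, ?_⟩
    -- The density formula is only given for bounded functions, so `h` is truncated and dominated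
    -- convergence is applied on both sides.
    set clip : ℕ → Rd d → ℝ := fun n y => max (-(n : ℝ)) (min n (h y)) with hclip
    have hcm : ∀ n, Measurable (clip n) := fun n => measurable_const.max (measurable_const.min hm)
    have hcb : ∀ n y, |clip n y| ≤ n := fun n y => by
      have hn : (0 : ℝ) ≤ n := Nat.cast_nonneg n
      rw [abs_le]
      exact ⟨le_max_left _ _, max_le (by linarith) (min_le_left _ _)⟩
    have hch : ∀ n y, ‖clip n y‖ ≤ ‖h y‖ := fun n y => by
      have hn : (0 : ℝ) ≤ n := Nat.cast_nonneg n
      rw [Real.norm_eq_abs, Real.norm_eq_abs, abs_le]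
      refine ⟨le_max_of_le_right (le_min ?_ (neg_abs_le _)), max_le ?_ ?_⟩
      · linarith [abs_nonneg (h y)]
      · linarith [abs_nonneg (h y)]
      · exact (min_le_right _ _).trans (le_abs_self _)
    have hcl : ∀ y, Tendsto (fun n => clip n y) atTop (𝓝 (h y)) := fun y => by
      refine tendsto_const_nhds.congr' ?_
      filter_upwards [eventually_ge_atTop ⌈|h y|⌉₊] with n hn
      have h1 : |h y| ≤ n := (Nat.le_ceil _).trans (by exact_mod_cast hn)
      rw [abs_le] at h1
      simp only [hclip]
      rw [min_eq_right h1.2, max_eq_right h1.1]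
    have l1 : Tendsto (fun n => op P s (clip n) x) atTop (𝓝 (op P s h x)) := by
      obtain ⟨σ, hσ, hσ1, hσop⟩ := exists_sign_integral_eq (P s x)
      simp only [op, hσop]
      refine tendsto_integral_of_dominated_convergence (fun y => ‖h y‖)
        (fun n => ((hcm n).mul hσ).aestronglyMeasurable) hint.norm
        (fun n => Eventually.of_forall fun y => ?_)
        (Eventually.of_forall fun y => (hcl y).mul_const _)
      rw [norm_mul, Real.norm_eq_abs (σ y), hσ1, mul_one]
      exact hch n y
    refine tendsto_nhds_unique l1 ?_
    simp_rw [fun n => hop (clip n) ⟨hcm n, n, hcb n⟩]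
    refine tendsto_integral_of_dominated_convergence (fun y => ‖h y * G y‖)
      (fun n => (hcm n).aestronglyMeasurable.mul hG.1) hi.norm
      (fun n => Eventually.of_forall fun y => ?_)
      (Eventually.of_forall fun y => (hcl y).mul_const _)
    rw [norm_mul, norm_mul]
    exact mul_le_mul_of_nonneg_right (hch n y) (norm_nonneg _)
  -- Absolute continuity of the variation transfers the replacement of `h` by a measurable version
  -- from Lebesgue measure to `P_s(x,·)`.
  have he := hh.ae_eq_mk
  have he' := hac.ae_eq he
  obtain ⟨h1, h2⟩ := main (hh.mk h) hh.stronglyMeasurable_mk.measurable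
    (hhG.congr (he.mono fun y hy => by simp only [hy]))
  refine ⟨h1.congr he'.symm, ?_⟩
  rw [op, VectorMeasure.integral_congr_ae he']
  exact h2.trans (integral_congr_ae (he.mono fun y hy => by simp only [hy]))

end Parametrix

namespace Parametrix

variable {d : ℕ}

/-! ### Sequences of independent exponential waiting times -/

instance isProbabilityMeasure_expMeasure_one : IsProbabilityMeasure (expMeasure 1) :=
  isProbabilityMeasure_expMeasure one_pos

/-- The law of a sequence of independent exponential random variables of parameter one. -/
noncomputable def expSeq : Measure (ℕ → ℝ) := Measure.infinitePi fun _ => expMeasure 1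

instance : IsProbabilityMeasure expSeq := by
  unfold expSeq
  infer_instance

/-- The sequence `s, e 0, e 1, …`. -/
def consSeq (q : ℝ × (ℕ → ℝ)) : ℕ → ℝ
  | 0 => q.1
  | n + 1 => q.2 n

@[simp] theorem consSeq_zero (q : ℝ × (ℕ → ℝ)) : consSeq q 0 = q.1 := rfl

@[simp] theorem consSeq_succ (q : ℝ × (ℕ → ℝ)) (n : ℕ) : consSeq q (n + 1) = q.2 n := rfl

theorem measurable_consSeq : Measurable consSeq := by
  refine measurable_pi_iff.2 fun n => ?_
  cases n with
  | zero => exact measurable_fst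
  | succ n => exact (measurable_pi_apply n).comp measurable_snd

/-- An independent exponential time put in front leaves the product law unchanged. Expectations can
then be computed by conditioning on the first waiting time, which matches the recursion of
`pathTerm`. -/
theorem map_consSeq : ((expMeasure 1).prod expSeq).map consSeq = expSeq := by
  refine Measure.eq_infinitePi _ fun s t ht => ?_
  classical
  obtain ⟨N, hN⟩ : ∃ N, s ⊆ Finset.range (N + 1) := by
    obtain ⟨N, hN⟩ := s.exists_nat_subset_range
    exact ⟨N, hN.trans (Finset.range_mono N.le_succ)⟩
  -- Padding with the whole line turns an arbitrary finite index set into an initial segment, from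
  -- which index `0` splits off.
  set u : ℕ → Set ℝ := fun i => if i ∈ s then t i else univ with hu
  have hum : ∀ i, MeasurableSet (u i) := fun i => by
    by_cases hi : i ∈ s <;> simp [hu, hi, ht]
  have e1 : consSeq ⁻¹' (Set.pi s t) = u 0 ×ˢ Set.pi (Finset.range N) fun i => u (i + 1) := by
    ext q
    simp only [mem_preimage, Set.mem_pi, mem_prod, Finset.coe_range, mem_Iio, Finset.mem_coe]
    constructor
    · intro h
      refine ⟨?_, fun i _ => ?_⟩
      · by_cases h0 : 0 ∈ s
        · simpa [hu, h0] using h 0 h0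
        · simp [hu, h0]
      · by_cases h0 : i + 1 ∈ s
        · simpa [hu, h0] using h (i + 1) h0
        · simp [hu, h0]
    · rintro ⟨h0, h1⟩ i hi
      cases i with
      | zero => simpa [hu, hi] using h0
      | succ i =>
        have := Finset.mem_range.1 (hN hi)
        simpa [hu, hi] using h1 i (by omega)
  have e2 : ∏ i ∈ s, expMeasure 1 (t i) = ∏ i ∈ Finset.range (N + 1), expMeasure 1 (u i) := by
    rw [← Finset.prod_subset hN (f := fun i => expMeasure 1 (u i))]
    · exact Finset.prod_congr rfl fun i hi => by simp [hu, hi]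
    · intro i _ hi
      simp [hu, hi]
  rw [Measure.map_apply measurable_consSeq (MeasurableSet.pi s.countable_toSet fun i _ => ht i),
    e1, Measure.prod_prod, e2, Finset.prod_range_succ', mul_comm, expSeq,
    Measure.infinitePi_pi _ fun i _ => hum (i + 1)]

theorem lintegral_expSeq {F : (ℕ → ℝ) → ℝ≥0∞} (hF : Measurable F) :
    ∫⁻ e, F e ∂expSeq = ∫⁻ s, ∫⁻ e, F (consSeq (s, e)) ∂expSeq ∂(expMeasure 1) := by
  have h := lintegral_map (μ := (expMeasure 1).prod expSeq) hF measurable_consSeq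
  rw [map_consSeq] at h
  have hm : Measurable fun q => F (consSeq q) := hF.comp measurable_consSeq
  rw [h, lintegral_prod _ hm.aemeasurable]

theorem measurable_exponentialPDF_one : Measurable (exponentialPDF 1) :=
  (measurable_exponentialPDFReal 1).ennreal_ofReal

theorem lintegral_expMeasure {F : ℝ → ℝ≥0∞} (hF : Measurable F) :
    ∫⁻ s, F s ∂(expMeasure 1) = ∫⁻ s, exponentialPDF 1 s * F s := by
  have h : expMeasure 1 = volume.withDensity (exponentialPDF 1) := rfl
  rw [h, lintegral_withDensity_eq_lintegral_mul _ measurable_exponentialPDF_one hF]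
  rfl

theorem integral_expMeasure (F : ℝ → ℝ) :
    ∫ s, F s ∂(expMeasure 1) = ∫ s, (exponentialPDF 1 s).toReal * F s := by
  have h : expMeasure 1 = volume.withDensity (exponentialPDF 1) := rfl
  rw [h, integral_withDensity_eq_integral_toReal_smul measurable_exponentialPDF_one
    (Eventually.of_forall fun s => ENNReal.ofReal_lt_top)]
  rfl

theorem exponentialPDF_one_of_pos {s : ℝ} (hs : 0 < s) :
    exponentialPDF 1 s = ENNReal.ofReal (Real.exp (-s)) := by
  rw [exponentialPDF_of_nonneg hs.le]
  simp

/-! ### The parametrix series as an expectation over the waiting times -/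

open Classical in
/-- The contribution of the paths with `n` jumps, given the waiting times `e`, after integrating
the space variables: the remaining time is `t` and the last waiting time exceeds it. -/
noncomputable def pathTerm (D A : ℝ → Rd d → Rd d → ℝ) (x : Rd d) :
    ℕ → ℝ → (ℕ → ℝ) → Rd d → ℝ
  | 0, t, e, y => if t < e 0 then D t x y else 0
  | n + 1, t, e, y => ∫ w, pathTerm D A x n (t - e 0) (fun j => e (j + 1)) w * A (e 0) w y

open Classical in
/-- The analogue of `pathTerm` for the absolute values of the kernels. -/
noncomputable def pathAbs (D A : ℝ → Rd d → Rd d → ℝ) (x : Rd d) :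
    ℕ → ℝ → (ℕ → ℝ) → Rd d → ℝ≥0∞
  | 0, t, e, y => if t < e 0 then ‖D t x y‖ₑ else 0
  | n + 1, t, e, y => ∫⁻ w, pathAbs D A x n (t - e 0) (fun j => e (j + 1)) w * ‖A (e 0) w y‖ₑ

theorem enorm_pathTerm_le {D A : ℝ → Rd d → Rd d → ℝ} {x : Rd d} (n : ℕ) (t : ℝ) (e : ℕ → ℝ)
    (y : Rd d) : ‖pathTerm D A x n t e y‖ₑ ≤ pathAbs D A x n t e y := by
  induction n generalizing t e y with
  | zero =>
    simp only [pathTerm, pathAbs]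
    split_ifs <;> simp
  | succ n ih =>
    refine (enorm_integral_le_lintegral_enorm _).trans (lintegral_mono fun w => ?_)
    rw [enorm_mul]
    gcongr
    exact ih _ _ _

namespace KernelBounds

variable {D A : ℝ → Rd d → Rd d → ℝ} {K : ℝ≥0∞} {R : ℝ → ℝ≥0∞}

theorem measurable_pathTerm (h : KernelBounds D A K R) (x : Rd d) (n : ℕ) :
    Measurable fun q : ℝ × (ℕ → ℝ) × Rd d => pathTerm D A x n q.1 q.2.1 q.2.2 := by
  induction n with
  | zero =>
    have m1 : Measurable fun q : ℝ × (ℕ → ℝ) × Rd d => ((q.1, x, q.2.2) : ℝ × Rd d × Rd d) := by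
      fun_prop
    have m2 : Measurable fun q : ℝ × (ℕ → ℝ) × Rd d => q.2.1 0 := by fun_prop
    exact Measurable.ite (measurableSet_lt measurable_fst m2) (h.measurable_left.comp m1)
      measurable_const
  | succ n ih =>
    have m1 : Measurable fun q : (ℝ × (ℕ → ℝ) × Rd d) × Rd d =>
        ((q.1.1 - q.1.2.1 0, fun j => q.1.2.1 (j + 1), q.2) : ℝ × (ℕ → ℝ) × Rd d) := by
      fun_prop
    have m2 : Measurable fun q : (ℝ × (ℕ → ℝ) × Rd d) × Rd d =>
        ((q.1.2.1 0, q.2, q.1.2.2) : ℝ × Rd d × Rd d) := by fun_prop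
    have m3 := (ih.comp m1).mul (h.measurable_right.comp m2)
    exact m3.stronglyMeasurable.integral_prod_right'.measurable

theorem measurable_pathAbs (h : KernelBounds D A K R) (x : Rd d) (n : ℕ) :
    Measurable fun q : ℝ × (ℕ → ℝ) × Rd d => pathAbs D A x n q.1 q.2.1 q.2.2 := by
  induction n with
  | zero =>
    have m1 : Measurable fun q : ℝ × (ℕ → ℝ) × Rd d => ((q.1, x, q.2.2) : ℝ × Rd d × Rd d) := by
      fun_prop
    have m2 : Measurable fun q : ℝ × (ℕ → ℝ) × Rd d => q.2.1 0 := by fun_prop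
    exact Measurable.ite (measurableSet_lt measurable_fst m2) (h.measurable_left.enorm.comp m1)
      measurable_const
  | succ n ih =>
    have m1 : Measurable fun q : (ℝ × (ℕ → ℝ) × Rd d) × Rd d =>
        ((q.1.1 - q.1.2.1 0, fun j => q.1.2.1 (j + 1), q.2) : ℝ × (ℕ → ℝ) × Rd d) := by
      fun_prop
    have m2 : Measurable fun q : (ℝ × (ℕ → ℝ) × Rd d) × Rd d =>
        ((q.1.2.1 0, q.2, q.1.2.2) : ℝ × Rd d × Rd d) := by fun_prop
    have m3 := (ih.comp m1).mul (h.measurable_right.enorm.comp m2)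
    exact m3.lintegral_prod_right'

theorem pathAbs_of_nonpos (h : KernelBounds D A K R) (x : Rd d) (n : ℕ) {t : ℝ} (ht : t ≤ 0)
    (e : ℕ → ℝ) (y : Rd d) : pathAbs D A x n t e y = 0 := by
  induction n generalizing t e y with
  | zero => simp [pathAbs, h.left_zero t ht]
  | succ n ih =>
    have : ∀ w, pathAbs D A x n (t - e 0) (fun j => e (j + 1)) w * ‖A (e 0) w y‖ₑ = 0 := by
      intro w
      rcases le_or_gt (e 0) 0 with hq | hq
      · simp [h.right_zero _ hq]
      · rw [ih (by linarith), zero_mul]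
    simp [pathAbs, this]

theorem exp_neg_mul_exp (s t : ℝ) : Real.exp (-s) * Real.exp (-(t - s)) = Real.exp (-t) := by
  rw [← Real.exp_add]
  congr 1
  ring

theorem measure_Ioi_expMeasure {t : ℝ} (ht : 0 ≤ t) :
    expMeasure 1 (Ioi t) = ENNReal.ofReal (Real.exp (-t)) := by
  have h1 := cdf_expMeasure_eq one_pos t
  rw [cdf_eq_real, if_pos ht, one_mul] at h1
  have h2 : (expMeasure 1).real (Ioi t) = Real.exp (-t) := by
    rw [← compl_Iic, probReal_compl_eq_one_sub measurableSet_Iic, h1]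
    ring
  rw [← h2, ofReal_measureReal]

/-- A first waiting time `s` has density `e^{-s}`, the rest contributes `e^{-(t-s)}` by induction,
and the product `e^{-t}` no longer depends on `s`. The base case is the probability `e^{-t}` that
the first time exceeds `t`. -/
theorem lintegral_pathAbs (h : KernelBounds D A K R) (x : Rd d) (n : ℕ) (t : ℝ) (y : Rd d) :
    ∫⁻ e, pathAbs D A x n t e y ∂expSeq = ENNReal.ofReal (Real.exp (-t)) * seriesAbs D A n t x y := by
  have hm : ∀ n t y, Measurable fun e => pathAbs D A x n t e y := fun n t y => by
    have m1 : Measurable fun e : ℕ → ℝ => ((t, e, y) : ℝ × (ℕ → ℝ) × Rd d) := by fun_prop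
    exact (h.measurable_pathAbs x n).comp m1
  induction n generalizing t y with
  | zero =>
    rcases le_or_gt t 0 with ht | ht
    · simp [h.pathAbs_of_nonpos x 0 ht, h.seriesAbs_of_nonpos 0 ht]
    rw [lintegral_expSeq (hm 0 t y)]
    have e1 : ∀ s e, pathAbs D A x 0 t (consSeq (s, e)) y
        = (Ioi t).indicator (fun _ => ‖D t x y‖ₑ) s := by
      intro s e
      by_cases hs : t < s <;> simp [pathAbs, hs]
    simp_rw [e1, lintegral_const, measure_univ, mul_one]
    rw [lintegral_indicator measurableSet_Ioi, setLIntegral_const, measure_Ioi_expMeasure ht.le,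
      mul_comm]
    rfl
  | succ n ih =>
    rw [lintegral_expSeq (hm (n + 1) t y)]
    have m4 : Measurable fun u : (ℝ × Rd d) × (ℕ → ℝ) =>
        ((t - u.1.1, u.2, u.1.2) : ℝ × (ℕ → ℝ) × Rd d) := by fun_prop
    have e2 : ∀ s, ∫⁻ e, pathAbs D A x (n + 1) t (consSeq (s, e)) y ∂expSeq
        = ∫⁻ w, ENNReal.ofReal (Real.exp (-(t - s))) * seriesAbs D A n (t - s) x w *
          ‖A s w y‖ₑ := by
      intro s
      have m1 : Measurable fun u : (ℕ → ℝ) × Rd d =>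
          ((t - s, u.1, u.2) : ℝ × (ℕ → ℝ) × Rd d) := by fun_prop
      have m2 : Measurable fun u : (ℕ → ℝ) × Rd d => ((s, u.2, y) : ℝ × Rd d × Rd d) := by
        fun_prop
      have m3 := ((h.measurable_pathAbs x n).comp m1).mul (h.measurable_right.enorm.comp m2)
      have e3 : ∫⁻ e, pathAbs D A x (n + 1) t (consSeq (s, e)) y ∂expSeq
          = ∫⁻ e, (∫⁻ w, pathAbs D A x n (t - s) e w * ‖A s w y‖ₑ) ∂expSeq := rfl
      rw [e3, lintegral_lintegral_swap m3.aemeasurable]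
      refine lintegral_congr fun w => ?_
      rw [lintegral_mul_const' _ _ enorm_ne_top, ih]
    simp_rw [e2]
    have m5 : Measurable fun u : ℝ × Rd d => ENNReal.ofReal (Real.exp (-(t - u.1))) *
        seriesAbs D A n (t - u.1) x u.2 * ‖A u.1 u.2 y‖ₑ := by
      have m6 : Measurable fun u : ℝ × Rd d => ENNReal.ofReal (Real.exp (-(t - u.1))) := by
        fun_prop
      have m7 : Measurable fun u : ℝ × Rd d => ((t - u.1, x, u.2) : ℝ × Rd d × Rd d) := by
        fun_prop
      have m8 : Measurable fun u : ℝ × Rd d => ((u.1, u.2, y) : ℝ × Rd d × Rd d) := by fun_prop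
      exact (m6.mul ((h.measurable_seriesAbs n).comp m7)).mul (h.measurable_right.enorm.comp m8)
    have m9 : Measurable fun u : ℝ × Rd d => seriesAbs D A n (t - u.1) x u.2 * ‖A u.1 u.2 y‖ₑ := by
      have m7 : Measurable fun u : ℝ × Rd d => ((t - u.1, x, u.2) : ℝ × Rd d × Rd d) := by
        fun_prop
      have m8 : Measurable fun u : ℝ × Rd d => ((u.1, u.2, y) : ℝ × Rd d × Rd d) := by fun_prop
      exact ((h.measurable_seriesAbs n).comp m7).mul (h.measurable_right.enorm.comp m8)
    rw [lintegral_expMeasure m5.lintegral_prod_right']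
    have e4 : ∀ s, exponentialPDF 1 s * ∫⁻ w, ENNReal.ofReal (Real.exp (-(t - s))) *
          seriesAbs D A n (t - s) x w * ‖A s w y‖ₑ
        = ENNReal.ofReal (Real.exp (-t)) * ∫⁻ w, seriesAbs D A n (t - s) x w * ‖A s w y‖ₑ := by
      intro s
      rcases le_or_gt s 0 with hs | hs
      · simp [h.right_zero s hs]
      · simp_rw [mul_assoc]
        rw [lintegral_const_mul' _ _ ENNReal.ofReal_ne_top, exponentialPDF_one_of_pos hs,
          ← mul_assoc, ← ENNReal.ofReal_mul (Real.exp_pos _).le, exp_neg_mul_exp]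
    simp_rw [e4]
    rw [lintegral_const_mul' _ _ ENNReal.ofReal_ne_top]
    congr 1
    have e5 : seriesAbs D A (n + 1) t x y
        = ∫⁻ q : ℝ × Rd d, seriesAbs D A n (t - q.1) x q.2 * ‖A q.1 q.2 y‖ₑ := rfl
    rw [e5, Measure.volume_eq_prod, lintegral_prod _ m9.aemeasurable]

/-- The computation of `lintegral_pathAbs` with signs; finiteness of the absolute series term at
`(t,x,y)` justifies Fubini. -/
theorem integral_pathTerm (h : KernelBounds D A K R) (x : Rd d) (n : ℕ) (t : ℝ) (y : Rd d)
    (hfin : seriesAbs D A n t x y ≠ ∞) :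
    ∫ e, pathTerm D A x n t e y ∂expSeq = Real.exp (-t) * seriesTerm D A n t x y := by
  have hm : ∀ n t y, Measurable fun e => pathTerm D A x n t e y := fun n t y => by
    have m1 : Measurable fun e : ℕ → ℝ => ((t, e, y) : ℝ × (ℕ → ℝ) × Rd d) := by fun_prop
    exact (h.measurable_pathTerm x n).comp m1
  have hmap : ∀ F : (ℕ → ℝ) → ℝ, Measurable F →
      ∫ e, F e ∂expSeq = ∫ q, F (consSeq q) ∂((expMeasure 1).prod expSeq) := by
    intro F hF
    rw [← integral_map measurable_consSeq.aemeasurable hF.aestronglyMeasurable, map_consSeq]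
  induction n generalizing t y with
  | zero =>
    rcases le_or_gt t 0 with ht | ht
    · simp [pathTerm, seriesTerm, h.left_zero t ht]
    rw [hmap _ (hm 0 t y)]
    have e1 : ∀ q, pathTerm D A x 0 t (consSeq q) y
        = (Ioi t ×ˢ univ).indicator (fun _ => D t x y) q := by
      rintro ⟨s, e⟩
      by_cases hs : t < s <;> simp [pathTerm, hs]
    simp_rw [e1]
    rw [integral_indicator_const _ (measurableSet_Ioi.prod MeasurableSet.univ), measureReal_def,
      Measure.prod_prod, measure_Ioi_expMeasure ht.le, measure_univ, mul_one,
      ENNReal.toReal_ofReal (Real.exp_pos _).le, smul_eq_mul]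
    rfl
  | succ n ih =>
    have m5 : Measurable fun u : (ℝ × (ℕ → ℝ)) × Rd d =>
        pathTerm D A x n (t - u.1.1) u.1.2 u.2 * A u.1.1 u.2 y := by
      have m6 : Measurable fun u : (ℝ × (ℕ → ℝ)) × Rd d =>
          ((t - u.1.1, u.1.2, u.2) : ℝ × (ℕ → ℝ) × Rd d) := by fun_prop
      have m7 : Measurable fun u : (ℝ × (ℕ → ℝ)) × Rd d =>
          ((u.1.1, u.2, y) : ℝ × Rd d × Rd d) := by fun_prop
      exact ((h.measurable_pathTerm x n).comp m6).mul (h.measurable_right.comp m7)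
    have hint : Integrable (fun u : (ℝ × (ℕ → ℝ)) × Rd d =>
        pathTerm D A x n (t - u.1.1) u.1.2 u.2 * A u.1.1 u.2 y)
        (((expMeasure 1).prod expSeq).prod volume) := by
      refine ⟨m5.aestronglyMeasurable, ?_⟩
      rw [HasFiniteIntegral, lintegral_prod _ m5.enorm.aemeasurable]
      have hle : ∀ q : ℝ × (ℕ → ℝ), ∫⁻ w, ‖pathTerm D A x n (t - q.1) q.2 w * A q.1 w y‖ₑ
          ≤ pathAbs D A x (n + 1) t (consSeq q) y := by
        intro q
        refine lintegral_mono fun w => ?_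
        rw [enorm_mul]
        exact mul_le_mul_left (enorm_pathTerm_le _ _ _ _) _
      refine (lintegral_mono hle).trans_lt ?_
      have m8 : Measurable fun e => pathAbs D A x (n + 1) t e y := by
        have m1 : Measurable fun e : ℕ → ℝ => ((t, e, y) : ℝ × (ℕ → ℝ) × Rd d) := by fun_prop
        exact (h.measurable_pathAbs x (n + 1)).comp m1
      rw [← lintegral_map m8 measurable_consSeq, map_consSeq, h.lintegral_pathAbs]
      exact ENNReal.mul_lt_top ENNReal.ofReal_lt_top hfin.lt_top
    have hfin' : ∀ᵐ s : ℝ, ∀ᵐ w : Rd d, seriesAbs D A n (t - s) x w * ‖A s w y‖ₑ ≠ ∞ := by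
      have m9 : Measurable fun u : ℝ × Rd d =>
          seriesAbs D A n (t - u.1) x u.2 * ‖A u.1 u.2 y‖ₑ := by
        have m7 : Measurable fun u : ℝ × Rd d => ((t - u.1, x, u.2) : ℝ × Rd d × Rd d) := by
          fun_prop
        have m8 : Measurable fun u : ℝ × Rd d => ((u.1, u.2, y) : ℝ × Rd d × Rd d) := by fun_prop
        exact ((h.measurable_seriesAbs n).comp m7).mul (h.measurable_right.enorm.comp m8)
      have h1 : ∀ᵐ q : ℝ × Rd d, seriesAbs D A n (t - q.1) x q.2 * ‖A q.1 q.2 y‖ₑ < ∞ :=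
        ae_lt_top m9 hfin
      rw [Measure.volume_eq_prod] at h1
      filter_upwards [Measure.ae_ae_of_ae_prod h1] with s hs
      filter_upwards [hs] with w hw using hw.ne
    have hint2 : Integrable (fun q : ℝ × Rd d => seriesTerm D A n (t - q.1) x q.2 * A q.1 q.2 y)
        ((volume : Measure ℝ).prod (volume : Measure (Rd d))) := by
      have m9 : Measurable fun u : ℝ × Rd d =>
          seriesTerm D A n (t - u.1) x u.2 * A u.1 u.2 y := by
        have m7 : Measurable fun u : ℝ × Rd d => ((t - u.1, x, u.2) : ℝ × Rd d × Rd d) := by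
          fun_prop
        have m8 : Measurable fun u : ℝ × Rd d => ((u.1, u.2, y) : ℝ × Rd d × Rd d) := by fun_prop
        exact ((h.measurable_seriesTerm n).comp m7).mul (h.measurable_right.comp m8)
      refine ⟨m9.aestronglyMeasurable, ?_⟩
      rw [HasFiniteIntegral]
      refine lt_of_le_of_lt (lintegral_mono fun q => ?_) hfin.lt_top
      rw [enorm_mul]
      gcongr
      exact enorm_seriesTerm_le _ _ _ _
    have hac : expMeasure 1 ≪ volume := withDensity_absolutelyContinuous _ _
    have e1 : ∫ e, pathTerm D A x (n + 1) t e y ∂expSeq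
        = ∫ s, (∫ e, (∫ w, pathTerm D A x n (t - s) e w * A s w y) ∂expSeq) ∂(expMeasure 1) := by
      rw [hmap _ (hm (n + 1) t y)]
      exact integral_prod _ hint.integral_prod_left
    have e2 : ∀ᵐ s ∂(expMeasure 1), ∫ e, (∫ w, pathTerm D A x n (t - s) e w * A s w y) ∂expSeq
        = Real.exp (-(t - s)) * ∫ w, seriesTerm D A n (t - s) x w * A s w y := by
      -- Reassociating the triple product isolates `s`, so that for almost every `s` the remaining
      -- two integrals may be exchanged.
      have hass : ∀ᵐ s ∂(expMeasure 1), Integrable (fun u : (ℕ → ℝ) × Rd d =>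
          pathTerm D A x n (t - s) u.1 u.2 * A s u.2 y) (expSeq.prod volume) := by
        have h3 : Integrable (fun u : ℝ × ((ℕ → ℝ) × Rd d) =>
            pathTerm D A x n (t - u.1) u.2.1 u.2.2 * A u.1 u.2.2 y)
            ((expMeasure 1).prod (expSeq.prod volume)) := by
          have h4 := (measurePreserving_prodAssoc (expMeasure 1) expSeq
            (volume : Measure (Rd d))).symm
          exact h4.integrable_comp_of_integrable hint
        exact h3.prod_right_ae
      filter_upwards [hass, hac.ae_le hfin'] with s hs hs'
      have h5 := integral_integral_swap (f := fun (e : ℕ → ℝ) (w : Rd d) =>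
        pathTerm D A x n (t - s) e w * A s w y) hs
      rw [h5, ← integral_const_mul]
      refine integral_congr_ae ?_
      filter_upwards [hs'] with w hw
      rw [integral_mul_const, ← mul_assoc]
      -- Finiteness is known only for the product with `‖A‖`; it passes to the series term when `A`
      -- is nonzero, and otherwise both sides vanish.
      by_cases hA : A s w y = 0
      · rw [hA, mul_zero, mul_zero]
      · rw [ih]
        intro htop
        rw [htop, ENNReal.top_mul (by simpa using hA)] at hw
        exact hw rfl
    rw [e1, integral_congr_ae e2, integral_expMeasure]
    have e3 : ∀ s, (exponentialPDF 1 s).toReal * (Real.exp (-(t - s)) *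
          ∫ w, seriesTerm D A n (t - s) x w * A s w y)
        = Real.exp (-t) * ∫ w, seriesTerm D A n (t - s) x w * A s w y := by
      intro s
      rcases le_or_gt s 0 with hs | hs
      · simp [h.right_zero s hs]
      · rw [exponentialPDF_one_of_pos hs, ENNReal.toReal_ofReal (Real.exp_pos _).le, ← mul_assoc,
          exp_neg_mul_exp]
    simp_rw [e3]
    rw [integral_const_mul]
    congr 1
    exact (integral_prod _ hint2).symm

end KernelBounds

end Parametrix

namespace Parametrix

variable {d : ℕ}

/-! ### Disintegration along a conditional density -/

section Transition

variable {Ω S : Type*} {m mΩ : MeasurableSpace Ω} [MeasurableSpace S] {μ : Measure Ω}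
  [IsProbabilityMeasure μ] {U : Ω → S} {Y : Ω → Rd d} {κ : S → Rd d → ℝ≥0∞} {B : Set Ω}

/-- If, on an event `B` of the σ-algebra `m`, the conditional law of `Y` given `m` has density
`κ (U ·)`, where `U` is `m`-measurable, then the joint law of `(U, Y)` on `B` is given by `κ`. -/
theorem map_prodMk_eq_withDensity (hm : m ≤ mΩ) (hU : Measurable[m] U) (hY : Measurable Y)
    (hB : MeasurableSet[m] B) (hκ : Measurable (Function.uncurry κ))
    (hκ1 : ∀ u, ∫⁻ w, κ u w ≤ 1)
    (hcond : ∀ A : Set (Rd d), MeasurableSet A →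
      μ[fun ω => A.indicator (fun _ => (1 : ℝ)) (Y ω) | m]
        =ᵐ[μ.restrict B] fun ω => (∫⁻ w in A, κ (U ω) w).toReal) :
    (μ.restrict B).map (fun ω => (U ω, Y ω))
      = (((μ.restrict B).map U).prod volume).withDensity (Function.uncurry κ) := by
  have hU' : Measurable U := hU.mono hm le_rfl
  refine Measure.ext_prod fun {s A} hs hA => ?_
  have hfin : ∀ u, ∫⁻ w in A, κ u w ≤ 1 := fun u =>
    (setLIntegral_le_lintegral _ _).trans (hκ1 u)
  have hmκ : Measurable fun u => ∫⁻ w in A, κ u w := hκ.lintegral_prod_right'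
  have hsm : MeasurableSet[m] (B ∩ U ⁻¹' s) := hB.inter (hU hs)
  have hint : Integrable (fun ω => A.indicator (fun _ => (1 : ℝ)) (Y ω)) μ := by
    refine Integrable.of_bound (C := 1) ((measurable_const.indicator hA).comp hY).aestronglyMeasurable
      (Eventually.of_forall fun ω => ?_)
    by_cases h : Y ω ∈ A <;> simp [h]
  have hsub : B ∩ U ⁻¹' s ⊆ B := inter_subset_left
  have e1 : ((μ.restrict B).map fun ω => (U ω, Y ω)) (s ×ˢ A)
      = μ ((B ∩ U ⁻¹' s) ∩ Y ⁻¹' A) := by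
    rw [Measure.map_apply (hU'.prodMk hY) (hs.prod hA),
      Measure.restrict_apply ((hU'.prodMk hY) (hs.prod hA))]
    congr 1
    ext ω
    simp only [mem_inter_iff, mem_preimage, mem_prod]
    tauto
  have e2 : μ.real ((B ∩ U ⁻¹' s) ∩ Y ⁻¹' A)
      = ∫ ω in B ∩ U ⁻¹' s, (∫⁻ w in A, κ (U ω) w).toReal ∂μ := by
    have h1 : ∫ ω in B ∩ U ⁻¹' s, A.indicator (fun _ => (1 : ℝ)) (Y ω) ∂μ
        = μ.real ((B ∩ U ⁻¹' s) ∩ Y ⁻¹' A) := by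
      have : (fun ω => A.indicator (fun _ => (1 : ℝ)) (Y ω))
          = (Y ⁻¹' A).indicator fun _ => (1 : ℝ) := rfl
      rw [this, setIntegral_indicator (hY hA), setIntegral_const, smul_eq_mul, mul_one]
    rw [← h1, ← setIntegral_condExp hm hint hsm]
    exact integral_congr_ae (ae_restrict_of_ae_restrict_of_subset hsub (hcond A hA))
  have e3 : ∫ ω in B ∩ U ⁻¹' s, (∫⁻ w in A, κ (U ω) w).toReal ∂μ
      = (∫⁻ ω in B ∩ U ⁻¹' s, (∫⁻ w in A, κ (U ω) w) ∂μ).toReal :=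
    integral_toReal (hmκ.comp hU').aemeasurable
      (Eventually.of_forall fun ω => (hfin _).trans_lt ENNReal.one_lt_top)
  have hfin2 : ∫⁻ ω in B ∩ U ⁻¹' s, (∫⁻ w in A, κ (U ω) w) ∂μ ≠ ∞ := by
    refine ((lintegral_mono fun ω => hfin (U ω)).trans_lt ?_).ne
    rw [setLIntegral_const, one_mul]
    exact measure_lt_top _ _
  have e4 : μ ((B ∩ U ⁻¹' s) ∩ Y ⁻¹' A) = ∫⁻ ω in B ∩ U ⁻¹' s, (∫⁻ w in A, κ (U ω) w) ∂μ := by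
    rw [← ENNReal.toReal_eq_toReal_iff' (measure_ne_top _ _) hfin2, ← e3, ← e2]
    rfl
  rw [e1, e4, withDensity_apply _ (hs.prod hA), ← Measure.prod_restrict,
    lintegral_prod _ hκ.aemeasurable]
  simp only [Function.uncurry]
  rw [setLIntegral_map hs hmκ hU', Measure.restrict_restrict (hU' hs), inter_comm]

omit [IsProbabilityMeasure μ] in
-- Used with `U` the state after `k` steps and `Y` the next grid point: the next position is
-- averaged out with the past held fixed.
theorem setLIntegral_transition (hU : Measurable U) (hY : Measurable Y)
    (hκ : Measurable (Function.uncurry κ))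
    (hmap : (μ.restrict B).map (fun ω => (U ω, Y ω))
      = (((μ.restrict B).map U).prod volume).withDensity (Function.uncurry κ))
    {F : S × Rd d → ℝ≥0∞} (hF : Measurable F) :
    ∫⁻ ω in B, F (U ω, Y ω) ∂μ = ∫⁻ ω in B, (∫⁻ w, κ (U ω) w * F (U ω, w)) ∂μ := by
  have hm : Measurable fun q : S × Rd d => κ q.1 q.2 * F q := hκ.mul hF
  rw [← lintegral_map (μ := μ.restrict B) (g := fun ω => (U ω, Y ω)) hF (hU.prodMk hY), hmap,
    lintegral_withDensity_eq_lintegral_mul _ hκ hF]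
  have e : ∫⁻ q, (Function.uncurry κ * F) q ∂(((μ.restrict B).map U).prod volume)
      = ∫⁻ q : S × Rd d, κ q.1 q.2 * F q ∂(((μ.restrict B).map U).prod volume) := rfl
  rw [e, lintegral_prod _ hm.aemeasurable, lintegral_map hm.lintegral_prod_right' hU]

theorem setIntegral_transition (hU : Measurable U) (hY : Measurable Y)
    (hκ : Measurable (Function.uncurry κ)) (hκt : ∀ u w, κ u w ≠ ∞)
    (hmap : (μ.restrict B).map (fun ω => (U ω, Y ω))
      = (((μ.restrict B).map U).prod volume).withDensity (Function.uncurry κ))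
    {F : S × Rd d → ℝ} (hF : Measurable F) (hfin : ∫⁻ ω in B, ‖F (U ω, Y ω)‖ₑ ∂μ ≠ ∞) :
    ∫ ω in B, F (U ω, Y ω) ∂μ = ∫ ω in B, (∫ w, (κ (U ω) w).toReal * F (U ω, w)) ∂μ := by
  have hm : Measurable fun q : S × Rd d => (κ q.1 q.2).toReal * F q := hκ.ennreal_toReal.mul hF
  have hint : Integrable (fun q : S × Rd d => (κ q.1 q.2).toReal * F q)
      (((μ.restrict B).map U).prod volume) := by
    refine ⟨hm.aestronglyMeasurable, ?_⟩
    have hme : Measurable fun q : S × Rd d => ‖(κ q.1 q.2).toReal * F q‖ₑ := hm.enorm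
    rw [HasFiniteIntegral, lintegral_prod _ hme.aemeasurable,
      lintegral_map hme.lintegral_prod_right' hU]
    rw [setLIntegral_transition hU hY hκ hmap hF.enorm] at hfin
    refine lt_of_le_of_lt (lintegral_mono fun ω => lintegral_mono fun w => ?_) hfin.lt_top
    simp only [enorm_mul]
    rw [Real.enorm_of_nonneg ENNReal.toReal_nonneg, ENNReal.ofReal_toReal (hκt _ _)]
  rw [← integral_map (μ := μ.restrict B) (φ := fun ω => (U ω, Y ω)) (hU.prodMk hY).aemeasurable
      hF.aestronglyMeasurable, hmap,
    integral_withDensity_eq_integral_toReal_smul hκ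
      (Eventually.of_forall fun q => (hκt q.1 q.2).lt_top)]
  have e : ∫ q, (Function.uncurry κ q).toReal • F q ∂(((μ.restrict B).map U).prod volume)
      = ∫ q : S × Rd d, (κ q.1 q.2).toReal * F q ∂(((μ.restrict B).map U).prod volume) := rfl
  rw [e, integral_prod _ hint, integral_map hU.aemeasurable]
  exact hm.stronglyMeasurable.integral_prod_right'.aestronglyMeasurable

end Transition

/-! ### The transition density and the weights of the backward scheme -/

variable {T : ℝ} {P : ℝ → Rd d → SignedMeasure (Rd d)}
  {p : ℝ → Rd d → Rd d → Rd d → ℝ} {θ : ℝ → Rd d → Rd d → ℝ} {K : ℝ}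

/-- The mass `C_t(y)`, extended by zero outside `(0, T]`. -/
noncomputable def massExt (T : ℝ) (p : ℝ → Rd d → Rd d → Rd d → ℝ) (t : ℝ) (y : Rd d) : ℝ :=
  ∫ z, diagDensity T p t z y

open Classical in
/-- The weight `θ̂_t(w, y)`, extended by zero outside `(0, T]`. -/
noncomputable def weightExt (T : ℝ) (θ : ℝ → Rd d → Rd d → ℝ) (t : ℝ) (w y : Rd d) : ℝ :=
  if t ∈ Ioc 0 T then θ t w y else 0

/-- The transition density `C_t(y)⁻¹ φ_t^y(w)`, extended by zero outside `(0, T]`. -/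
noncomputable def moveDensity (T : ℝ) (p : ℝ → Rd d → Rd d → Rd d → ℝ) (t : ℝ) (y w : Rd d) : ℝ :=
  (massExt T p t y)⁻¹ * diagDensity T p t w y

theorem massExt_of_mem {t : ℝ} (ht : t ∈ Ioc 0 T) (y : Rd d) :
    massExt T p t y = massC p t y := by
  simp only [massExt, diagDensity_of_mem ht, massC]

theorem weightExt_mul_diagDensity (t : ℝ) (w y : Rd d) :
    weightExt T θ t w y * diagDensity T p t w y = corrKernel T p θ t w y := by
  by_cases ht : t ∈ Ioc 0 T
  · rw [weightExt, if_pos ht, diagDensity_of_mem ht, corrKernel_of_mem ht]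
  · rw [weightExt, if_neg ht, corrKernel_of_notMem ht, zero_mul]

theorem IsFrozenFamily.measurable_massExt (hp : IsFrozenFamily T p) :
    Measurable fun q : ℝ × Rd d => massExt T p q.1 q.2 := by
  have m1 : Measurable fun q : (ℝ × Rd d) × Rd d => ((q.1.1, q.2, q.1.2) : ℝ × Rd d × Rd d) := by
    fun_prop
  exact (hp.measurable_diagDensity.comp m1).stronglyMeasurable.integral_prod_right'.measurable

theorem IsBackwardWeight.measurable_weightExt (hθ : IsBackwardWeight T P p θ) :
    Measurable fun q : ℝ × Rd d × Rd d => weightExt T θ q.1 q.2.1 q.2.2 := by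
  have hs : MeasurableSet {q : ℝ × Rd d × Rd d | q.1 ∈ Ioc 0 T} :=
    measurable_fst measurableSet_Ioc
  have hset : {q : ℝ × Rd d × Rd d | q.1 ∈ Ioc 0 T} = Ioc 0 T ×ˢ univ := by
    ext q; simp
  refine measurable_of_restrict_of_restrict_compl hs ?_ ?_
  · have h1 := hθ.continuous
    rw [← hset] at h1
    convert (continuousOn_iff_continuous_domRestrict.1 h1).measurable using 1
    ext q
    exact if_pos q.2
  · convert (measurable_const : Measurable fun _ : ↥{q : ℝ × Rd d × Rd d | q.1 ∈ Ioc 0 T}ᶜ =>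
      (0 : ℝ)) using 1
    ext q
    exact if_neg q.2

theorem IsFrozenFamily.measurable_moveDensity (hp : IsFrozenFamily T p) :
    Measurable fun q : ℝ × Rd d × Rd d => moveDensity T p q.1 q.2.1 q.2.2 := by
  have m1 : Measurable fun q : ℝ × Rd d × Rd d => (q.1, q.2.1) := by fun_prop
  have m2 : Measurable fun q : ℝ × Rd d × Rd d => ((q.1, q.2.2, q.2.1) : ℝ × Rd d × Rd d) := by
    fun_prop
  exact (hp.measurable_massExt.comp m1).inv.mul (hp.measurable_diagDensity.comp m2)

theorem massExt_nonneg (hp : IsFrozenFamily T p) (t : ℝ) (y : Rd d) : 0 ≤ massExt T p t y :=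
  integral_nonneg fun z => hp.diagDensity_nonneg t z y

theorem moveDensity_nonneg (hp : IsFrozenFamily T p) (t : ℝ) (y w : Rd d) :
    0 ≤ moveDensity T p t y w :=
  mul_nonneg (inv_nonneg.2 (massExt_nonneg hp t y)) (hp.diagDensity_nonneg t w y)

/-- `φ_t^y` is nonnegative and continuous, so a zero integral makes it vanish identically. Hence the
convention `0⁻¹ = 0` is harmless wherever `C_t(y)` is inverted. -/
theorem diagDensity_eq_zero_of_massExt (hp : IsFrozenFamily T p) (hK : DiagBound T p K) {t : ℝ}
    {y : Rd d} (h : massExt T p t y = 0) (w : Rd d) : diagDensity T p t w y = 0 := by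
  by_cases ht : t ∈ Ioc 0 T
  · rw [massExt, integral_eq_zero_iff_of_nonneg (fun z => hp.diagDensity_nonneg t z y)
      (hK.integrable_col hp t y)] at h
    have hc : Continuous fun z => diagDensity T p t z y := by
      have : (fun z => diagDensity T p t z y) = phi p t y := by
        ext z
        exact diagDensity_of_mem ht z y
      rw [this]
      exact hp.continuous_phi ht y
    exact congrFun (hc.ae_eq_iff_eq volume continuous_const |>.1 h) w
  · exact diagDensity_of_notMem ht w y

theorem massExt_mul_moveDensity (hp : IsFrozenFamily T p) (hK : DiagBound T p K) (t : ℝ)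
    (y w : Rd d) : massExt T p t y * moveDensity T p t y w = diagDensity T p t w y := by
  by_cases h : massExt T p t y = 0
  · rw [h, zero_mul, diagDensity_eq_zero_of_massExt hp hK h]
  · rw [moveDensity, mul_inv_cancel_left₀ h]

/-- Only an inequality, because the transition density is zero when the mass vanishes. -/
theorem lintegral_moveDensity_le (hp : IsFrozenFamily T p) (hK : DiagBound T p K) (t : ℝ)
    (y : Rd d) : ∫⁻ w, ENNReal.ofReal (moveDensity T p t y w) ≤ 1 := by
  have hi : Integrable fun w => moveDensity T p t y w := (hK.integrable_col hp t y).const_mul _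
  rw [← ofReal_integral_eq_lintegral_ofReal hi
    (Eventually.of_forall fun w => moveDensity_nonneg hp t y w), ENNReal.ofReal_le_one]
  simp only [moveDensity]
  rw [integral_const_mul]
  exact inv_mul_le_one

end Parametrix

namespace Parametrix

variable {d : ℕ} {T : ℝ} {P : ℝ → Rd d → SignedMeasure (Rd d)}
  {p : ℝ → Rd d → Rd d → Rd d → ℝ} {θ : ℝ → Rd d → Rd d → ℝ} {K : ℝ}
  {Ω : Type*} [mΩ : MeasurableSpace Ω] {μ : Measure Ω} {τ : ℕ → Ω → ℝ} {X : ℝ → Ω → Rd d}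

/-! ### One step of the backward scheme -/

/-- The waiting times after the `k`-th point of the sequence `s`. -/
def shiftGaps (k : ℕ) (s : ℕ → ℝ) : ℕ → ℝ := fun j => s (k + j + 1) - s (k + j)

theorem shiftGaps_succ (k : ℕ) (s : ℕ → ℝ) :
    (fun j => shiftGaps k s (j + 1)) = shiftGaps (k + 1) s := by
  ext j
  simp only [shiftGaps]
  congr 2 <;> omega

theorem measurable_shiftGaps (k : ℕ) : Measurable (shiftGaps k) := by
  unfold shiftGaps
  fun_prop

/-- The product of the weights over the first `k` steps. -/
noncomputable def pathWeight (T : ℝ) (p : ℝ → Rd d → Rd d → Rd d → ℝ)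
    (θ : ℝ → Rd d → Rd d → ℝ) (τ : ℕ → Ω → ℝ) (X : ℝ → Ω → Rd d) (k : ℕ) (ω : Ω) : ℝ :=
  ∏ j ∈ Finset.range k,
    massExt T p (τ (j + 1) ω - τ j ω) (atGrid τ T X j ω) *
      weightExt T θ (τ (j + 1) ω - τ j ω) (atGrid τ T X (j + 1) ω) (atGrid τ T X j ω)

/-- The jump times, the weight and the position after `k` steps. -/
noncomputable def pathState (T : ℝ) (p : ℝ → Rd d → Rd d → Rd d → ℝ)
    (θ : ℝ → Rd d → Rd d → ℝ) (τ : ℕ → Ω → ℝ) (X : ℝ → Ω → Rd d) (k : ℕ) (ω : Ω) :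
    (ℕ → ℝ) × ℝ × Rd d :=
  (fun j => τ j ω, pathWeight T p θ τ X k ω, atGrid τ T X k ω)

/-- The transition density of the scheme at step `k`, as a function of the state. -/
noncomputable def stepKernel (T : ℝ) (p : ℝ → Rd d → Rd d → Rd d → ℝ) (k : ℕ)
    (s : (ℕ → ℝ) × ℝ × Rd d) (w : Rd d) : ℝ≥0∞ :=
  ENNReal.ofReal (moveDensity T p (min (s.1 (k + 1)) T - s.1 k) s.2.2 w)

theorem IsFrozenFamily.measurable_stepKernel (hp : IsFrozenFamily T p) (k : ℕ) :
    Measurable (Function.uncurry (stepKernel T p k)) := by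
  have m1 : Measurable fun q : ((ℕ → ℝ) × ℝ × Rd d) × Rd d =>
      ((min (q.1.1 (k + 1)) T - q.1.1 k, q.1.2.2, q.2) : ℝ × Rd d × Rd d) := by fun_prop
  exact (hp.measurable_moveDensity.comp m1).ennreal_ofReal

theorem history_le (hτ : IsPoissonJumpTimes μ τ) (hX : IsBackwardScheme μ τ T p X) (k : ℕ) :
    history τ T X k ≤ mΩ :=
  sup_le (iSup_le fun j => (hτ.measurable j).comap_le) (iSup_le fun i => (hX.measurable i).comap_le)

omit mΩ in
theorem measurable_history_time (k j : ℕ) : Measurable[history τ T X k] (τ j) :=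
  (comap_measurable (τ j)).mono (le_sup_of_le_left (le_iSup_of_le j le_rfl)) le_rfl

omit mΩ in
theorem measurable_history_atGrid {k j : ℕ} (hj : j ≤ k) :
    Measurable[history τ T X k] (atGrid τ T X j) :=
  (comap_measurable (atGrid τ T X j)).mono
    (le_sup_of_le_right (le_iSup_of_le (⟨j, Nat.lt_succ_of_le hj⟩ : Fin (k + 1)) le_rfl)) le_rfl

omit mΩ in
theorem measurable_history_pathWeight (hp : IsFrozenFamily T p) (hθ : IsBackwardWeight T P p θ)
    (k : ℕ) : Measurable[history τ T X k] (pathWeight T p θ τ X k) := by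
  unfold pathWeight
  refine Finset.measurable_prod _ fun j hj => ?_
  have hj := Finset.mem_range.1 hj
  have m1 : Measurable[history τ T X k] fun ω => τ (j + 1) ω - τ j ω :=
    (measurable_history_time k (j + 1)).sub (measurable_history_time k j)
  have m2 : Measurable[history τ T X k] (atGrid τ T X j) := measurable_history_atGrid hj.le
  have m3 : Measurable[history τ T X k] (atGrid τ T X (j + 1)) := measurable_history_atGrid hj
  exact (hp.measurable_massExt.comp (m1.prodMk m2)).mul
    (hθ.measurable_weightExt.comp (m1.prodMk (m3.prodMk m2)))

omit mΩ in
theorem measurable_history_pathState (hp : IsFrozenFamily T p) (hθ : IsBackwardWeight T P p θ)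
    (k : ℕ) : Measurable[history τ T X k] (pathState T p θ τ X k) :=
  (@measurable_pi_lambda _ _ _ (history τ T X k) _ _ fun j => measurable_history_time k j).prodMk
    ((measurable_history_pathWeight hp hθ k).prodMk (measurable_history_atGrid le_rfl))

theorem ae_strictMono_jumpTimes (hτ : IsPoissonJumpTimes μ τ) :
    ∀ᵐ ω ∂μ, StrictMono fun j => τ j ω := by
  have h1 : ∀ᵐ ω ∂μ, ∀ j, 0 < τ (j + 1) ω - τ j ω := by
    refine ae_all_iff.2 fun j => ?_
    have hm : Measurable fun ω => τ (j + 1) ω - τ j ω :=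
      (hτ.measurable (j + 1)).sub (hτ.measurable j)
    have h2 : ∀ᵐ s ∂(expMeasure 1), (0 : ℝ) < s := by
      have h3 : expMeasure 1 (Ioi 0) = 1 := by
        rw [KernelBounds.measure_Ioi_expMeasure le_rfl]
        simp
      exact (mem_ae_iff_prob_eq_one measurableSet_Ioi).2 h3
    rw [← hτ.law j] at h2
    exact ae_of_ae_map hm.aemeasurable h2
  filter_upwards [h1] with ω hω
  exact strictMono_nat_of_lt_succ fun j => sub_pos.1 (hω j)

section Step

variable [IsProbabilityMeasure μ] (hT : 0 < T) (hp : IsFrozenFamily T p)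
  (hθ : IsBackwardWeight T P p θ) (hK : DiagBound T p K) (hτ : IsPoissonJumpTimes μ τ)
  (hX : IsBackwardScheme μ τ T p X)

include hp hθ hK hτ hX

/-- On `{τ_k < T}` the next time increment lies in `(0, T]` almost surely, where the extensions by
zero agree with the original objects; the transition property on indicators is then a conditional
density. The state records all jump times because the kernel involves `τ_{k+1}`. -/
theorem map_pathState (k : ℕ) :
    (μ.restrict {ω | τ k ω < T}).map
        (fun ω => (pathState T p θ τ X k ω, atGrid τ T X (k + 1) ω))
      = (((μ.restrict {ω | τ k ω < T}).map (pathState T p θ τ X k)).prod volume).withDensity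
        (Function.uncurry (stepKernel T p k)) := by
  have hB : MeasurableSet[history τ T X k] {ω | τ k ω < T} :=
    measurable_history_time k k measurableSet_Iio
  refine map_prodMk_eq_withDensity (history_le hτ hX k) (measurable_history_pathState hp hθ k)
    (hX.measurable (k + 1)) hB (hp.measurable_stepKernel k)
    (fun u => lintegral_moveDensity_le hp hK _ _) fun A hA => ?_
  have hind : IsBddMeas (A.indicator fun _ => (1 : ℝ)) :=
    ⟨measurable_const.indicator hA, 1, fun x => by by_cases hx : x ∈ A <;> simp [hx]⟩
  refine (hX.transition k _ hind).trans ?_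
  filter_upwards [ae_restrict_of_ae (ae_strictMono_jumpTimes hτ),
    ae_restrict_mem (history_le hτ hX k _ hB)] with ω hmono hω
  have hk0 : 0 ≤ τ k ω := by
    have := hmono.monotone (Nat.zero_le k)
    simpa only [hτ.zero ω] using this
  have hδ : min (τ (k + 1) ω) T - τ k ω ∈ Ioc 0 T := by
    have h1 : τ k ω < τ (k + 1) ω := hmono k.lt_succ_self
    have h2 : τ k ω < T := hω
    exact ⟨sub_pos.2 (lt_min h1 h2), by linarith [min_le_right (τ (k + 1) ω) T]⟩
  set δ := min (τ (k + 1) ω) T - τ k ω with hδ'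
  set y := atGrid τ T X k ω with hy
  have e1 : ∫⁻ w in A, stepKernel T p k (pathState T p θ τ X k ω) w
      = ∫⁻ w in A, ENNReal.ofReal (moveDensity T p δ y w) := rfl
  have hi : Integrable fun w => moveDensity T p δ y w := (hK.integrable_col hp δ y).const_mul _
  rw [e1, ← ofReal_integral_eq_lintegral_ofReal hi.integrableOn
      (Eventually.of_forall fun w => moveDensity_nonneg hp δ y w),
    ENNReal.toReal_ofReal (integral_nonneg fun w => moveDensity_nonneg hp δ y w)]
  simp only [moveDensity, diagDensity_of_mem hδ]
  rw [integral_const_mul, massExt_of_mem hδ, ← integral_indicator hA]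
  congr 1
  refine integral_congr_ae (Eventually.of_forall fun w => ?_)
  by_cases hw : w ∈ A <;> simp [hw]

end Step

omit mΩ in
theorem pathWeight_succ (k : ℕ) (ω : Ω) :
    pathWeight T p θ τ X (k + 1) ω = pathWeight T p θ τ X k ω *
      (massExt T p (τ (k + 1) ω - τ k ω) (atGrid τ T X k ω) *
        weightExt T θ (τ (k + 1) ω - τ k ω) (atGrid τ T X (k + 1) ω) (atGrid τ T X k ω)) :=
  Finset.prod_range_succ _ _

/-- The weight of one step against the transition density gives the correction kernel. -/
theorem moveDensity_mul_weight (hp : IsFrozenFamily T p) (hK : DiagBound T p K) (t π : ℝ)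
    (y w : Rd d) :
    moveDensity T p t y w * (π * (massExt T p t y * weightExt T θ t w y))
      = π * corrKernel T p θ t w y := by
  rw [← weightExt_mul_diagDensity, ← massExt_mul_moveDensity hp hK]
  ring

/-! ### Exchange of a random step for an integrated one. -/

section Step

variable [IsProbabilityMeasure μ] {x : Rd d} {R : ℝ → ℝ≥0∞} {C : ℝ≥0∞}
  (hp : IsFrozenFamily T p)
  (hθ : IsBackwardWeight T P p θ) (hK : DiagBound T p K) (hτ : IsPoissonJumpTimes μ τ)
  (hX : IsBackwardScheme μ τ T p X)
  (hker : KernelBounds (diagDensity T p) (corrKernel T p θ) C R)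

/-- The expected absolute contribution when `k` steps are random and `m` are integrated out. -/
noncomputable def absContribution (T : ℝ) (p : ℝ → Rd d → Rd d → Rd d → ℝ)
    (θ : ℝ → Rd d → Rd d → ℝ) (τ : ℕ → Ω → ℝ) (X : ℝ → Ω → Rd d) (x : Rd d) (k m : ℕ) (ω : Ω) :
    ℝ≥0∞ :=
  ‖pathWeight T p θ τ X k ω‖ₑ * pathAbs (diagDensity T p) (corrKernel T p θ) x m (T - τ k ω)
    (shiftGaps k fun j => τ j ω) (atGrid τ T X k ω)

/-- The contribution when `k` steps are random and `m` are integrated out. -/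
noncomputable def contribution (T : ℝ) (p : ℝ → Rd d → Rd d → Rd d → ℝ)
    (θ : ℝ → Rd d → Rd d → ℝ) (τ : ℕ → Ω → ℝ) (X : ℝ → Ω → Rd d) (x : Rd d) (k m : ℕ) (ω : Ω) :
    ℝ :=
  pathWeight T p θ τ X k ω * pathTerm (diagDensity T p) (corrKernel T p θ) x m (T - τ k ω)
    (shiftGaps k fun j => τ j ω) (atGrid τ T X k ω)

omit mΩ in
theorem enorm_contribution_le (k m : ℕ) (ω : Ω) :
    ‖contribution T p θ τ X x k m ω‖ₑ ≤ absContribution T p θ τ X x k m ω := by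
  rw [contribution, absContribution, enorm_mul]
  gcongr
  exact enorm_pathTerm_le _ _ _ _

omit mΩ in
include hker in
theorem absContribution_of_le {k m : ℕ} {ω : Ω} (h : T ≤ τ k ω) :
    absContribution T p θ τ X x k m ω = 0 := by
  rw [absContribution, hker.pathAbs_of_nonpos x m (sub_nonpos.2 h), mul_zero]

omit mΩ in
include hker in
theorem contribution_of_le {k m : ℕ} {ω : Ω} (h : T ≤ τ k ω) :
    contribution T p θ τ X x k m ω = 0 := by
  have := enorm_contribution_le (T := T) (p := p) (θ := θ) (τ := τ) (X := X) (x := x) k m ω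
  rw [absContribution_of_le hker h] at this
  simpa using this

omit [IsProbabilityMeasure μ] in
include hker hp hθ in
theorem measurable_contribution (hτ : IsPoissonJumpTimes μ τ) (hX : IsBackwardScheme μ τ T p X)
    (k m : ℕ) : Measurable (contribution T p θ τ X x k m) := by
  have m1 := (measurable_history_pathState (τ := τ) (X := X) hp hθ k).mono (history_le hτ hX k) le_rfl
  have m2 : Measurable fun s : (ℕ → ℝ) × ℝ × Rd d =>
      ((T - s.1 k, shiftGaps k s.1, s.2.2) : ℝ × (ℕ → ℝ) × Rd d) := by
    have m3 : Measurable fun s : (ℕ → ℝ) × ℝ × Rd d => T - s.1 k := by fun_prop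
    have m4 : Measurable fun s : (ℕ → ℝ) × ℝ × Rd d => shiftGaps k s.1 :=
      (measurable_shiftGaps k).comp measurable_fst
    have m5 : Measurable fun s : (ℕ → ℝ) × ℝ × Rd d => s.2.2 := by fun_prop
    exact m3.prodMk (m4.prodMk m5)
  have m3 : Measurable fun s : (ℕ → ℝ) × ℝ × Rd d => s.2.1 *
      pathTerm (diagDensity T p) (corrKernel T p θ) x m (T - s.1 k) (shiftGaps k s.1) s.2.2 :=
    (measurable_fst.comp measurable_snd).mul ((hker.measurable_pathTerm x m).comp m2)
  exact m3.comp m1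

include hp hθ hK hτ hX hker

/-- Averaging over the position after step `k + 1` pairs `C⁻¹ φ` with `C θ̂` and leaves the kernel
`A`, which is the outermost integration in `pathAbs` at index `m + 1`. When `τ_k ≥ T` both sides
vanish. -/
theorem lintegral_absContribution_step (k m : ℕ) :
    ∫⁻ ω, absContribution T p θ τ X x (k + 1) m ω ∂μ
      = ∫⁻ ω, absContribution T p θ τ X x k (m + 1) ω ∂μ := by
  set B : Set Ω := {ω | τ k ω < T} with hB
  have hBm : MeasurableSet B := hτ.measurable k measurableSet_Iio
  have hU : Measurable (pathState T p θ τ X k) :=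
    (measurable_history_pathState hp hθ k).mono (history_le hτ hX k) le_rfl
  set F : ((ℕ → ℝ) × ℝ × Rd d) × Rd d → ℝ≥0∞ := fun q =>
    ‖q.1.2.1 * (massExt T p (q.1.1 (k + 1) - q.1.1 k) q.1.2.2 *
      weightExt T θ (q.1.1 (k + 1) - q.1.1 k) q.2 q.1.2.2)‖ₑ *
    pathAbs (diagDensity T p) (corrKernel T p θ) x m (T - q.1.1 (k + 1))
      (shiftGaps (k + 1) q.1.1) q.2 with hF
  have hFm : Measurable F := by
    have m1 : Measurable fun q : ((ℕ → ℝ) × ℝ × Rd d) × Rd d =>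
        ((q.1.1 (k + 1) - q.1.1 k, q.1.2.2) : ℝ × Rd d) := by fun_prop
    have m2 : Measurable fun q : ((ℕ → ℝ) × ℝ × Rd d) × Rd d =>
        ((q.1.1 (k + 1) - q.1.1 k, q.2, q.1.2.2) : ℝ × Rd d × Rd d) := by fun_prop
    have m3 : Measurable fun q : ((ℕ → ℝ) × ℝ × Rd d) × Rd d =>
        ((T - q.1.1 (k + 1), shiftGaps (k + 1) q.1.1, q.2) : ℝ × (ℕ → ℝ) × Rd d) := by
      have m4 : Measurable fun q : ((ℕ → ℝ) × ℝ × Rd d) × Rd d => shiftGaps (k + 1) q.1.1 :=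
        (measurable_shiftGaps (k + 1)).comp (measurable_fst.comp measurable_fst)
      have m5 : Measurable fun q : ((ℕ → ℝ) × ℝ × Rd d) × Rd d => T - q.1.1 (k + 1) := by fun_prop
      exact m5.prodMk (m4.prodMk measurable_snd)
    have m5 : Measurable fun q : ((ℕ → ℝ) × ℝ × Rd d) × Rd d => q.1.2.1 := by fun_prop
    exact ((m5.mul ((hp.measurable_massExt.comp m1).mul
      (hθ.measurable_weightExt.comp m2))).enorm).mul ((hker.measurable_pathAbs x m).comp m3)
  have e1 : ∫⁻ ω, absContribution T p θ τ X x (k + 1) m ω ∂μ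
      = ∫⁻ ω in B, F (pathState T p θ τ X k ω, atGrid τ T X (k + 1) ω) ∂μ := by
    rw [← lintegral_indicator hBm]
    refine lintegral_congr_ae ?_
    filter_upwards [ae_strictMono_jumpTimes hτ] with ω hω
    by_cases h : ω ∈ B
    · rw [indicator_of_mem h, absContribution, pathWeight_succ]
      rfl
    · rw [indicator_of_notMem h]
      refine absContribution_of_le hker ?_
      have h1 : T ≤ τ k ω := not_lt.1 h
      have h2 : τ k ω < τ (k + 1) ω := hω k.lt_succ_self
      exact h1.trans h2.le
  have e2 : ∫⁻ ω, absContribution T p θ τ X x k (m + 1) ω ∂μ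
      = ∫⁻ ω in B, (∫⁻ w, stepKernel T p k (pathState T p θ τ X k ω) w *
        F (pathState T p θ τ X k ω, w)) ∂μ := by
    rw [← lintegral_indicator hBm]
    refine lintegral_congr fun ω => ?_
    by_cases h : ω ∈ B
    · rw [indicator_of_mem h, absContribution]
      have e3 : pathAbs (diagDensity T p) (corrKernel T p θ) x (m + 1) (T - τ k ω)
          (shiftGaps k fun j => τ j ω) (atGrid τ T X k ω)
          = ∫⁻ w, pathAbs (diagDensity T p) (corrKernel T p θ) x m (T - τ (k + 1) ω)
            (shiftGaps (k + 1) fun j => τ j ω) w *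
            ‖corrKernel T p θ (τ (k + 1) ω - τ k ω) w (atGrid τ T X k ω)‖ₑ := by
        rw [← shiftGaps_succ, pathAbs]
        have e4 : shiftGaps k (fun j => τ j ω) 0 = τ (k + 1) ω - τ k ω := rfl
        rw [e4, sub_sub_sub_cancel_right]
      rw [e3, ← lintegral_const_mul' _ _ enorm_ne_top]
      refine lintegral_congr fun w => ?_
      have e5 : F (pathState T p θ τ X k ω, w) = ‖pathWeight T p θ τ X k ω *
          (massExt T p (τ (k + 1) ω - τ k ω) (atGrid τ T X k ω) *
            weightExt T θ (τ (k + 1) ω - τ k ω) w (atGrid τ T X k ω))‖ₑ *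
          pathAbs (diagDensity T p) (corrKernel T p θ) x m (T - τ (k + 1) ω)
            (shiftGaps (k + 1) fun j => τ j ω) w := rfl
      have e6 : stepKernel T p k (pathState T p θ τ X k ω) w = ENNReal.ofReal
          (moveDensity T p (min (τ (k + 1) ω) T - τ k ω) (atGrid τ T X k ω) w) := rfl
      rw [e5, e6]
      -- The scheme moves for the truncated time but the weight uses the full one; they differ only
      -- when `τ_{k+1} > T`, and then the remaining factor is zero.
      rcases lt_or_ge (τ (k + 1) ω) T with h1 | h1
      · rw [min_eq_left h1.le, ← Real.enorm_of_nonneg (moveDensity_nonneg hp _ _ _),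
          ← mul_assoc ‖moveDensity T p _ _ _‖ₑ, ← enorm_mul (moveDensity T p _ _ _),
          moveDensity_mul_weight hp hK, enorm_mul]
        ring
      · rw [hker.pathAbs_of_nonpos x m (sub_nonpos.2 h1)]
        simp
    · rw [indicator_of_notMem h]
      exact absContribution_of_le hker (not_lt.1 h)
  rw [e1, e2]
  exact setLIntegral_transition hU (hX.measurable (k + 1)) (hp.measurable_stepKernel k)
    (map_pathState hp hθ hK hτ hX k) hFm

/-- Signed counterpart, with the absolute contribution of the same indices guaranteeing Fubini. -/
theorem integral_contribution_step (k m : ℕ)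
    (hfin : ∫⁻ ω, absContribution T p θ τ X x (k + 1) m ω ∂μ ≠ ∞) :
    ∫ ω, contribution T p θ τ X x (k + 1) m ω ∂μ = ∫ ω, contribution T p θ τ X x k (m + 1) ω ∂μ := by
  set B : Set Ω := {ω | τ k ω < T} with hB
  have hBm : MeasurableSet B := hτ.measurable k measurableSet_Iio
  have hU : Measurable (pathState T p θ τ X k) :=
    (measurable_history_pathState hp hθ k).mono (history_le hτ hX k) le_rfl
  set F : ((ℕ → ℝ) × ℝ × Rd d) × Rd d → ℝ := fun q =>
    (q.1.2.1 * (massExt T p (q.1.1 (k + 1) - q.1.1 k) q.1.2.2 *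
      weightExt T θ (q.1.1 (k + 1) - q.1.1 k) q.2 q.1.2.2)) *
    pathTerm (diagDensity T p) (corrKernel T p θ) x m (T - q.1.1 (k + 1))
      (shiftGaps (k + 1) q.1.1) q.2 with hF
  have hFm : Measurable F := by
    have m1 : Measurable fun q : ((ℕ → ℝ) × ℝ × Rd d) × Rd d =>
        ((q.1.1 (k + 1) - q.1.1 k, q.1.2.2) : ℝ × Rd d) := by fun_prop
    have m2 : Measurable fun q : ((ℕ → ℝ) × ℝ × Rd d) × Rd d =>
        ((q.1.1 (k + 1) - q.1.1 k, q.2, q.1.2.2) : ℝ × Rd d × Rd d) := by fun_prop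
    have m3 : Measurable fun q : ((ℕ → ℝ) × ℝ × Rd d) × Rd d =>
        ((T - q.1.1 (k + 1), shiftGaps (k + 1) q.1.1, q.2) : ℝ × (ℕ → ℝ) × Rd d) := by
      have m4 : Measurable fun q : ((ℕ → ℝ) × ℝ × Rd d) × Rd d => shiftGaps (k + 1) q.1.1 :=
        (measurable_shiftGaps (k + 1)).comp (measurable_fst.comp measurable_fst)
      have m5 : Measurable fun q : ((ℕ → ℝ) × ℝ × Rd d) × Rd d => T - q.1.1 (k + 1) := by fun_prop
      exact m5.prodMk (m4.prodMk measurable_snd)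
    have m5 : Measurable fun q : ((ℕ → ℝ) × ℝ × Rd d) × Rd d => q.1.2.1 := by fun_prop
    exact (m5.mul ((hp.measurable_massExt.comp m1).mul
      (hθ.measurable_weightExt.comp m2))).mul ((hker.measurable_pathTerm x m).comp m3)
  have hFe : ∀ ω, F (pathState T p θ τ X k ω, atGrid τ T X (k + 1) ω)
      = contribution T p θ τ X x (k + 1) m ω := by
    intro ω
    rw [contribution, pathWeight_succ]
    rfl
  have hzero : ∀ (m : ℕ) (t : ℝ), t ≤ 0 → ∀ e y,
      pathTerm (diagDensity T p) (corrKernel T p θ) x m t e y = 0 := by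
    intro m t ht e y
    have := enorm_pathTerm_le (D := diagDensity T p) (A := corrKernel T p θ) (x := x) m t e y
    rw [hker.pathAbs_of_nonpos x m ht] at this
    simpa using this
  have e1 : ∫ ω, contribution T p θ τ X x (k + 1) m ω ∂μ
      = ∫ ω in B, F (pathState T p θ τ X k ω, atGrid τ T X (k + 1) ω) ∂μ := by
    rw [← integral_indicator hBm]
    refine integral_congr_ae ?_
    filter_upwards [ae_strictMono_jumpTimes hτ] with ω hω
    by_cases h : ω ∈ B
    · rw [indicator_of_mem h, hFe]
    · rw [indicator_of_notMem h]
      refine contribution_of_le hker ?_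
      have h1 : T ≤ τ k ω := not_lt.1 h
      have h2 : τ k ω < τ (k + 1) ω := hω k.lt_succ_self
      exact h1.trans h2.le
  have e2 : ∫ ω, contribution T p θ τ X x k (m + 1) ω ∂μ
      = ∫ ω in B, (∫ w, (stepKernel T p k (pathState T p θ τ X k ω) w).toReal *
        F (pathState T p θ τ X k ω, w)) ∂μ := by
    rw [← integral_indicator hBm]
    refine integral_congr_ae (Eventually.of_forall fun ω => ?_)
    by_cases h : ω ∈ B
    · rw [indicator_of_mem h]
      simp only [contribution]
      have e3 : pathTerm (diagDensity T p) (corrKernel T p θ) x (m + 1) (T - τ k ω)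
          (shiftGaps k fun j => τ j ω) (atGrid τ T X k ω)
          = ∫ w, pathTerm (diagDensity T p) (corrKernel T p θ) x m (T - τ (k + 1) ω)
            (shiftGaps (k + 1) fun j => τ j ω) w *
            corrKernel T p θ (τ (k + 1) ω - τ k ω) w (atGrid τ T X k ω) := by
        rw [← shiftGaps_succ, pathTerm]
        have e4 : shiftGaps k (fun j => τ j ω) 0 = τ (k + 1) ω - τ k ω := rfl
        rw [e4, sub_sub_sub_cancel_right]
      rw [e3, ← integral_const_mul]
      refine integral_congr_ae (Eventually.of_forall fun w => ?_)
      simp only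
      have e5 : F (pathState T p θ τ X k ω, w) = (pathWeight T p θ τ X k ω *
          (massExt T p (τ (k + 1) ω - τ k ω) (atGrid τ T X k ω) *
            weightExt T θ (τ (k + 1) ω - τ k ω) w (atGrid τ T X k ω))) *
          pathTerm (diagDensity T p) (corrKernel T p θ) x m (T - τ (k + 1) ω)
            (shiftGaps (k + 1) fun j => τ j ω) w := rfl
      have e6 : stepKernel T p k (pathState T p θ τ X k ω) w = ENNReal.ofReal
          (moveDensity T p (min (τ (k + 1) ω) T - τ k ω) (atGrid τ T X k ω) w) := rfl
      rw [e5, e6, ENNReal.toReal_ofReal (moveDensity_nonneg hp _ _ _)]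
      rcases lt_or_ge (τ (k + 1) ω) T with h1 | h1
      · rw [min_eq_left h1.le, ← mul_assoc (moveDensity T p _ _ _), moveDensity_mul_weight hp hK]
        ring
      · rw [hzero m _ (sub_nonpos.2 h1)]
        simp
    · rw [indicator_of_notMem h]
      exact contribution_of_le hker (not_lt.1 h)
  rw [e1, e2]
  refine setIntegral_transition hU (hX.measurable (k + 1)) (hp.measurable_stepKernel k)
    (fun u w => ENNReal.ofReal_ne_top) (map_pathState hp hθ hK hτ hX k) hFm ?_
  refine ne_top_of_le_ne_top hfin ((setLIntegral_le_lintegral _ _).trans (lintegral_mono fun ω => ?_))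
  rw [hFe]
  exact enorm_contribution_le _ _ _

theorem lintegral_absContribution_eq (n m : ℕ) :
    ∫⁻ ω, absContribution T p θ τ X x n m ω ∂μ
      = ∫⁻ ω, absContribution T p θ τ X x 0 (m + n) ω ∂μ := by
  induction n generalizing m with
  | zero => rfl
  | succ n ih =>
    rw [lintegral_absContribution_step hp hθ hK hτ hX hker, ih]
    congr! 3
    omega

/-- The exchange is repeated until no step is random; `m + n` is invariant, so finiteness has to be
checked only for index zero. -/
theorem integral_contribution_eq (n m : ℕ)
    (hfin : ∫⁻ ω, absContribution T p θ τ X x 0 (m + n) ω ∂μ ≠ ∞) :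
    ∫ ω, contribution T p θ τ X x n m ω ∂μ = ∫ ω, contribution T p θ τ X x 0 (m + n) ω ∂μ := by
  induction n generalizing m with
  | zero => rfl
  | succ n ih =>
    have e : m + 1 + n = m + (n + 1) := by omega
    rw [integral_contribution_step hp hθ hK hτ hX hker, ih, e]
    · rwa [e]
    · rwa [lintegral_absContribution_eq hp hθ hK hτ hX hker]

end Step

end Parametrix

namespace Parametrix

variable {d : ℕ} {T : ℝ} {P : ℝ → Rd d → SignedMeasure (Rd d)}
  {p : ℝ → Rd d → Rd d → Rd d → ℝ} {θ : ℝ → Rd d → Rd d → ℝ} {K : ℝ}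
  {Ω : Type*} [mΩ : MeasurableSpace Ω] {μ : Measure Ω} {τ : ℕ → Ω → ℝ} {X : ℝ → Ω → Rd d}

/-! ### The jump times -/

/-- The exponential law has no atoms. This rules out a jump exactly at `T`, so strict and weak
inequalities in counting jumps agree almost surely. -/
theorem ae_expSeq_sum_ne (n : ℕ) (t : ℝ) : ∀ᵐ e ∂expSeq, ∑ j ∈ Finset.range (n + 1), e j ≠ t := by
  have hne : ∀ t : ℝ, ∀ᵐ s ∂(expMeasure 1), s ≠ t := fun t => by
    have hac : expMeasure 1 ≪ volume := withDensity_absolutelyContinuous _ _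
    exact hac.ae_le (Measure.ae_ne volume t)
  have hms : ∀ (n : ℕ) (t : ℝ),
      MeasurableSet {e : ℕ → ℝ | ∑ j ∈ Finset.range (n + 1), e j ≠ t} := fun n t => by
    have hm : Measurable fun e : ℕ → ℝ => ∑ j ∈ Finset.range (n + 1), e j := by fun_prop
    exact hm (measurableSet_singleton t).compl
  have hmc : ∀ (n : ℕ) (t : ℝ), MeasurableSet
      {q : ℝ × (ℕ → ℝ) | ∑ j ∈ Finset.range (n + 1), consSeq q j ≠ t} :=
    fun n t => measurable_consSeq (hms n t)
  induction n generalizing t with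
  | zero =>
    rw [← map_consSeq, ae_map_iff measurable_consSeq.aemeasurable (hms _ t),
      Measure.ae_prod_iff_ae_ae (hmc _ t)]
    filter_upwards [hne t] with s hs
    exact Eventually.of_forall fun e => by simpa using hs
  | succ n ih =>
    rw [← map_consSeq, ae_map_iff measurable_consSeq.aemeasurable (hms _ t),
      Measure.ae_prod_iff_ae_ae (hmc _ t)]
    refine Eventually.of_forall fun s => ?_
    filter_upwards [ih (t - s)] with e he heq
    rw [Finset.sum_range_succ'] at heq
    simp only [consSeq_succ, consSeq_zero] at heq
    exact he (by linarith)

/-- The first `n` waiting times all stay below the level with probability `q^n`, where `q < 1`. This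
is what makes the number of jumps before `T` finite. -/
theorem ae_expSeq_exists_lt (t : ℝ) : ∀ᵐ e ∂expSeq, ∃ j, t < e j := by
  -- The maximum with zero is there because the tail formula needs a nonnegative level.
  set q : ℝ≥0∞ := expMeasure 1 (Iic (max t 0)) with hq
  have hq1 : q < 1 := by
    have h1 : q + expMeasure 1 (Ioi (max t 0)) = 1 := by
      rw [hq, ← compl_Iic, measure_add_measure_compl measurableSet_Iic, measure_univ]
    rw [KernelBounds.measure_Ioi_expMeasure (le_max_right _ _)] at h1
    refine lt_of_le_of_ne (h1 ▸ le_self_add) fun h => ?_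
    rw [h] at h1
    have h2 : ENNReal.ofReal (Real.exp (-(max t 0))) = 0 := by
      have h3 : (1 : ℝ≥0∞) + ENNReal.ofReal (Real.exp (-(max t 0))) = 1 + 0 := by rw [h1, add_zero]
      exact (ENNReal.add_right_inj ENNReal.one_ne_top).1 h3
    rw [ENNReal.ofReal_eq_zero] at h2
    exact absurd (Real.exp_pos (-(max t 0))) (not_lt.2 h2)
  have hle : ∀ n : ℕ, expSeq {e | ¬ ∃ j, t < e j} ≤ q ^ n := by
    intro n
    have h1 : {e : ℕ → ℝ | ¬ ∃ j, t < e j}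
        ⊆ Set.pi (Finset.range n) fun _ => Iic (max t 0) := by
      intro e he j _
      exact (not_lt.1 fun h => he ⟨j, h⟩).trans (le_max_left _ _)
    refine (measure_mono h1).trans ?_
    rw [expSeq, Measure.infinitePi_pi _ fun i _ => measurableSet_Iic]
    simp [hq]
  exact le_antisymm (ge_of_tendsto' (ENNReal.tendsto_pow_atTop_nhds_zero_of_lt_one hq1) hle)
    zero_le

theorem map_shiftGaps_zero (hτ : IsPoissonJumpTimes μ τ) :
    μ.map (fun ω => shiftGaps 0 fun j => τ j ω) = expSeq := by
  have hm : ∀ j, Measurable fun ω => τ (j + 1) ω - τ j ω := fun j =>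
    (hτ.measurable (j + 1)).sub (hτ.measurable j)
  have h1 : (fun ω => shiftGaps 0 fun j => τ j ω) = fun ω j => τ (j + 1) ω - τ j ω := by
    ext ω j
    simp [shiftGaps]
  rw [h1, hτ.indep.map_fun_eq_infinitePi_map hm, expSeq]
  simp_rw [hτ.law]

theorem measurable_jumpTimes (hτ : IsPoissonJumpTimes μ τ) : Measurable fun ω j => τ j ω :=
  measurable_pi_iff.2 hτ.measurable

theorem sum_shiftGaps_zero (hτ : IsPoissonJumpTimes μ τ) (n : ℕ) (ω : Ω) :
    ∑ j ∈ Finset.range n, shiftGaps 0 (fun j => τ j ω) j = τ n ω := by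
  have h := Finset.sum_range_sub (fun j => τ j ω) n
  simp only [hτ.zero ω, sub_zero] at h
  rw [← h]
  simp [shiftGaps]

/-- Almost surely, exactly one `n` satisfies `τ n < T < τ (n + 1)`. -/
theorem ae_exists_jumpTimes_lt (hT : 0 < T) (hτ : IsPoissonJumpTimes μ τ) :
    ∀ᵐ ω ∂μ, ∃ n, τ n ω < T ∧ T < τ (n + 1) ω := by
  have hm : Measurable fun ω => shiftGaps 0 fun j => τ j ω :=
    (measurable_shiftGaps 0).comp (measurable_jumpTimes hτ)
  have h1 : ∀ᵐ e ∂expSeq, (∃ j, T < e j) ∧ ∀ n, ∑ j ∈ Finset.range (n + 1), e j ≠ T :=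
    (ae_expSeq_exists_lt T).and (ae_all_iff.2 fun n => ae_expSeq_sum_ne n T)
  rw [← map_shiftGaps_zero hτ] at h1
  filter_upwards [ae_of_ae_map hm.aemeasurable h1, ae_strictMono_jumpTimes hτ] with ω hω hmono
  obtain ⟨⟨j, hj⟩, hne⟩ := hω
  have h0 : 0 ≤ τ j ω := by
    have := hmono.monotone (Nat.zero_le j)
    simpa only [hτ.zero ω] using this
  have hex : ∃ n, T < τ n ω := by
    refine ⟨j + 1, ?_⟩
    simp only [shiftGaps, zero_add] at hj
    linarith
  classical
  have hpos : Nat.find hex ≠ 0 := by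
    intro h
    have := Nat.find_spec hex
    rw [h, hτ.zero] at this
    exact this.not_gt hT
  obtain ⟨n, hn⟩ := Nat.exists_eq_succ_of_ne_zero hpos
  refine ⟨n, ?_, ?_⟩
  -- `n + 1` is the first index beyond `T`, so `τ_n ≤ T`; equality is excluded because `τ_n` is a
  -- partial sum of waiting times, or zero.
  · refine lt_of_le_of_ne (not_lt.1 (Nat.find_min hex (by omega))) ?_
    cases n with
    | zero => rw [hτ.zero]; exact hT.ne
    | succ n => rw [← sum_shiftGaps_zero hτ]; exact hne n
  · have := Nat.find_spec hex
    rwa [hn] at this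

omit mΩ in
-- The index set counts jumps from `τ_1` on, so it is `{0, …, n - 1}` and its cardinality is `n`.
theorem jumpCount_eq {ω : Ω} (hmono : StrictMono fun j => τ j ω) {n : ℕ} (h1 : τ n ω < T)
    (h2 : T < τ (n + 1) ω) : jumpCount τ T ω = n := by
  have h : {j : ℕ | τ (j + 1) ω ≤ T} = Finset.range n := by
    ext j
    simp only [mem_ofPred_eq, Finset.coe_range, mem_Iio]
    constructor
    · intro hj
      have h3 : τ (j + 1) ω < τ (n + 1) ω := hj.trans_lt h2
      have := hmono.lt_iff_lt.1 h3
      omega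
    · intro hj
      exact (hmono.monotone (show j + 1 ≤ n from hj)).trans h1.le
  rw [jumpCount, h, Set.ncard_coe_finset, Finset.card_range]

/-! ### The law of the waiting times and of the initial point -/

section Law

variable [IsProbabilityMeasure μ] {x : Rd d} {R : ℝ → ℝ≥0∞} {C : ℝ≥0∞}
  (hp : IsFrozenFamily T p)
  (hθ : IsBackwardWeight T P p θ) (hK : DiagBound T p K) (hτ : IsPoissonJumpTimes μ τ)
  (hX : IsBackwardScheme μ τ T p X)
  (hker : KernelBounds (diagDensity T p) (corrKernel T p θ) C R)

omit mΩ in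
theorem atGrid_zero (hT : 0 < T) (h0 : ∀ ω, τ 0 ω = 0) : atGrid τ T X 0 = X 0 := by
  ext1 ω
  rw [atGrid, h0, min_eq_left hT.le]

omit [IsProbabilityMeasure μ] in
theorem IsBackwardScheme.measurable_initial (hT : 0 < T) (hτ : IsPoissonJumpTimes μ τ)
    (hX : IsBackwardScheme μ τ T p X) : Measurable (X 0) := by
  rw [← atGrid_zero (X := X) hT hτ.zero]
  exact hX.measurable 0

theorem map_initial_shiftGaps (hT : 0 < T) (hτ : IsPoissonJumpTimes μ τ)
    (hX : IsBackwardScheme μ τ T p X) :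
    μ.map (fun ω => (X 0 ω, shiftGaps 0 fun j => τ j ω)) = (μ.map (X 0)).prod expSeq := by
  have hind : IndepFun (X 0) (fun ω => shiftGaps 0 fun j => τ j ω) μ :=
    hX.indep.comp measurable_id (measurable_shiftGaps 0)
  have hm : Measurable fun ω => shiftGaps 0 fun j => τ j ω :=
    (measurable_shiftGaps 0).comp (measurable_jumpTimes hτ)
  rw [(indepFun_iff_map_prod_eq_prod_map_map (hX.measurable_initial hT hτ).aemeasurable
    hm.aemeasurable).1 hind, map_shiftGaps_zero hτ]

include hτ hX hker

/-- At index zero the weight is an empty product, so only the initial point and the waiting times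
occur; they are independent and the clock integrates out to `e^{-T}`. -/
theorem lintegral_absContribution_zero (hT : 0 < T) (n : ℕ) :
    ∫⁻ ω, absContribution T p θ τ X x 0 n ω ∂μ = ENNReal.ofReal (Real.exp (-T)) *
      ∫⁻ y, seriesAbs (diagDensity T p) (corrKernel T p θ) n T x y ∂(μ.map (X 0)) := by
  have hm : Measurable fun ω => (X 0 ω, shiftGaps 0 fun j => τ j ω) :=
    (hX.measurable_initial hT hτ).prodMk
      ((measurable_shiftGaps 0).comp (measurable_jumpTimes hτ))
  have m1 : Measurable fun q : Rd d × (ℕ → ℝ) => ((T, q.2, q.1) : ℝ × (ℕ → ℝ) × Rd d) := by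
    fun_prop
  have m2 := (hker.measurable_pathAbs x n).comp m1
  have e1 : ∀ ω, absContribution T p θ τ X x 0 n ω
      = pathAbs (diagDensity T p) (corrKernel T p θ) x n T (shiftGaps 0 fun j => τ j ω)
        (X 0 ω) := by
    intro ω
    simp [absContribution, pathWeight, hτ.zero, atGrid_zero (X := X) hT hτ.zero]
  simp_rw [e1]
  have e2 := lintegral_map (μ := μ) m2 hm
  simp only [Function.comp_def] at e2
  have hprob : IsProbabilityMeasure (μ.map (X 0)) :=
    Measure.isProbabilityMeasure_map (hX.measurable_initial hT hτ).aemeasurable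
  have e3 := lintegral_prod (μ := μ.map (X 0)) (ν := expSeq) _ m2.aemeasurable
  simp only [Function.comp_def, hker.lintegral_pathAbs] at e3
  rw [← e2, map_initial_shiftGaps hT hτ hX, e3, lintegral_const_mul' _ _ ENNReal.ofReal_ne_top]

theorem integral_contribution_zero (hT : 0 < T) (n : ℕ)
    (hfin : ∫⁻ y, seriesAbs (diagDensity T p) (corrKernel T p θ) n T x y ∂(μ.map (X 0)) ≠ ∞) :
    ∫ ω, contribution T p θ τ X x 0 n ω ∂μ = Real.exp (-T) *
      ∫ y, seriesTerm (diagDensity T p) (corrKernel T p θ) n T x y ∂(μ.map (X 0)) := by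
  have hm : Measurable fun ω => (X 0 ω, shiftGaps 0 fun j => τ j ω) :=
    (hX.measurable_initial hT hτ).prodMk
      ((measurable_shiftGaps 0).comp (measurable_jumpTimes hτ))
  have m1 : Measurable fun q : Rd d × (ℕ → ℝ) => ((T, q.2, q.1) : ℝ × (ℕ → ℝ) × Rd d) := by
    fun_prop
  have m2 := (hker.measurable_pathTerm x n).comp m1
  have m3 := (hker.measurable_pathAbs x n).comp m1
  have m4 : Measurable fun y : Rd d => ((T, x, y) : ℝ × Rd d × Rd d) := by fun_prop
  have e1 : ∀ ω, contribution T p θ τ X x 0 n ω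
      = pathTerm (diagDensity T p) (corrKernel T p θ) x n T (shiftGaps 0 fun j => τ j ω)
        (X 0 ω) := by
    intro ω
    simp [contribution, pathWeight, hτ.zero, atGrid_zero (X := X) hT hτ.zero]
  have hprob : IsProbabilityMeasure (μ.map (X 0)) :=
    Measure.isProbabilityMeasure_map (hX.measurable_initial hT hτ).aemeasurable
  have hint : Integrable (fun q : Rd d × (ℕ → ℝ) =>
      pathTerm (diagDensity T p) (corrKernel T p θ) x n T q.2 q.1)
      ((μ.map (X 0)).prod expSeq) := by
    refine ⟨m2.aestronglyMeasurable, ?_⟩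
    rw [HasFiniteIntegral]
    refine (lintegral_mono fun q => enorm_pathTerm_le _ _ _ _).trans_lt ?_
    have e3 := lintegral_prod (μ := μ.map (X 0)) (ν := expSeq) _ m3.aemeasurable
    simp only [Function.comp_def, hker.lintegral_pathAbs] at e3
    rw [e3, lintegral_const_mul' _ _ ENNReal.ofReal_ne_top]
    exact ENNReal.mul_lt_top ENNReal.ofReal_lt_top hfin.lt_top
  simp_rw [e1]
  have e2 := integral_map (μ := μ) hm.aemeasurable
    (m2.aestronglyMeasurable (μ := μ.map fun ω => (X 0 ω, shiftGaps 0 fun j => τ j ω)))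
  simp only [Function.comp_def] at e2
  rw [← e2, map_initial_shiftGaps hT hτ hX, integral_prod _ hint, ← integral_const_mul]
  refine integral_congr_ae ?_
  filter_upwards [ae_lt_top ((hker.measurable_seriesAbs n).comp m4) hfin] with y hy
  exact hker.integral_pathTerm x n T y hy.ne

end Law

end Parametrix

namespace Parametrix

variable {d : ℕ} {T : ℝ} {P : ℝ → Rd d → SignedMeasure (Rd d)}
  {p : ℝ → Rd d → Rd d → Rd d → ℝ} {θ : ℝ → Rd d → Rd d → ℝ} {K : ℝ}
  {Ω : Type*} [mΩ : MeasurableSpace Ω] {μ : Measure Ω} {τ : ℕ → Ω → ℝ} {X : ℝ → Ω → Rd d}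
  {x : Rd d} {R : ℝ → ℝ≥0∞} {C : ℝ≥0∞}

/-! ### The random variable as a sum over the number of jumps -/

omit mΩ in
/-- On a path with `n` jumps the random variable is the contribution of index `n`. -/
theorem bwdIntegrand_eq_contribution (hp : IsFrozenFamily T p) (hK : DiagBound T p K) {ω : Ω}
    (hmono : StrictMono fun j => τ j ω) (h0 : τ 0 ω = 0) {n : ℕ} (h1 : τ n ω < T)
    (h2 : T < τ (n + 1) ω) :
    bwdIntegrand τ T p θ X x ω = contribution T p θ τ X x n 0 ω := by
  have hnonneg : ∀ j, 0 ≤ τ j ω := fun j => by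
    have := hmono.monotone (Nat.zero_le j)
    simpa only [h0] using this
  have hgrid : ∀ j ≤ n, X (τ j ω) ω = atGrid τ T X j ω := fun j hj => by
    rw [atGrid, min_eq_left ((hmono.monotone hj).trans h1.le)]
  have ht : T - τ n ω ∈ Ioc 0 T := ⟨sub_pos.2 h1, by linarith [hnonneg n]⟩
  have hprod : ∏ j ∈ Finset.range n, massC p (τ (j + 1) ω - τ j ω) (X (τ j ω) ω) *
        θ (τ (j + 1) ω - τ j ω) (X (τ (j + 1) ω) ω) (X (τ j ω) ω)
      = pathWeight T p θ τ X n ω := by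
    refine Finset.prod_congr rfl fun j hj => ?_
    have hj := Finset.mem_range.1 hj
    have hδ : τ (j + 1) ω - τ j ω ∈ Ioc 0 T := by
      have h3 : τ j ω < τ (j + 1) ω := hmono j.lt_succ_self
      have h4 : τ (j + 1) ω ≤ τ n ω := hmono.monotone hj
      exact ⟨sub_pos.2 h3, by linarith [hnonneg j]⟩
    rw [massExt_of_mem hδ, weightExt, if_pos hδ, hgrid j hj.le, hgrid (j + 1) hj]
  have hgap : T - τ n ω < shiftGaps n (fun j => τ j ω) 0 := by
    simp only [shiftGaps, add_zero]
    linarith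
  rw [bwdIntegrand, GammaStar, jumpCount_eq hmono h1 h2, hprod, hgrid n le_rfl, contribution,
    pathTerm, if_pos hgap]
  have hD : diagDensity T p (T - τ n ω) x (atGrid τ T X n ω)
      = p (T - τ n ω) (atGrid τ T X n ω) x (atGrid τ T X n ω) := diagDensity_of_mem ht _ _
  -- `C⁻¹` cancels the leading factor of `Γ*`; if that factor is zero, the frozen density next to it
  -- vanishes as well.
  by_cases hC : massC p (T - τ n ω) (atGrid τ T X n ω) = 0
  · rw [diagDensity_eq_zero_of_massExt hp hK (by rw [massExt_of_mem ht, hC]), hC]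
    simp
  · rw [hD]
    field_simp

omit mΩ in
-- For `k < n` the next jump still occurs before `T`, so the terminal indicator is zero; for `k > n`
-- no time remains.
theorem contribution_zero_eq_zero
    (hker : KernelBounds (diagDensity T p) (corrKernel T p θ) C R) {ω : Ω}
    (hmono : StrictMono fun j => τ j ω) {n k : ℕ} (h1 : τ n ω < T)
    (h2 : T < τ (n + 1) ω) (hk : k ≠ n) : contribution T p θ τ X x k 0 ω = 0 := by
  rcases lt_or_gt_of_ne hk with hk | hk
  · have h3 : τ (k + 1) ω ≤ τ n ω := hmono.monotone hk
    have hgap : ¬ T - τ k ω < shiftGaps k (fun j => τ j ω) 0 := by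
      simp only [shiftGaps, add_zero]
      linarith
    rw [contribution, pathTerm, if_neg hgap, mul_zero]
  · have h3 : τ (n + 1) ω ≤ τ k ω := hmono.monotone hk
    exact contribution_of_le hker (h2.le.trans h3)

theorem bwdIntegrand_ae_eq_tsum (hT : 0 < T) (hp : IsFrozenFamily T p) (hK : DiagBound T p K)
    (hτ : IsPoissonJumpTimes μ τ)
    (hker : KernelBounds (diagDensity T p) (corrKernel T p θ) C R) :
    bwdIntegrand τ T p θ X x =ᵐ[μ] fun ω => ∑' n, contribution T p θ τ X x n 0 ω := by
  filter_upwards [ae_exists_jumpTimes_lt hT hτ, ae_strictMono_jumpTimes hτ] with ω hω hmono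
  obtain ⟨n, h1, h2⟩ := hω
  rw [bwdIntegrand_eq_contribution hp hK hmono (hτ.zero ω) h1 h2]
  exact (tsum_eq_single n fun k hk => contribution_zero_eq_zero hker hmono h1 h2 hk).symm

variable [IsProbabilityMeasure μ] in
/-- The expectation of the weighted path functional is the parametrix series, integrated against
the law of the initial point. -/
theorem integrable_and_integral_bwdIntegrand (hT : 0 < T) (hp : IsFrozenFamily T p)
    (hθ : IsBackwardWeight T P p θ) (hK : DiagBound T p K) (hτ : IsPoissonJumpTimes μ τ)
    (hX : IsBackwardScheme μ τ T p X)
    (hker : KernelBounds (diagDensity T p) (corrKernel T p θ) C R)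
    (hfin : ∫⁻ y, ∑' n, seriesAbs (diagDensity T p) (corrKernel T p θ) n T x y ∂(μ.map (X 0)) ≠ ∞) :
    Integrable (bwdIntegrand τ T p θ X x) μ ∧
      Real.exp T * ∫ ω, bwdIntegrand τ T p θ X x ω ∂μ
        = ∫ y, ∑' n, seriesTerm (diagDensity T p) (corrKernel T p θ) n T x y ∂(μ.map (X 0)) := by
  set D := diagDensity T p with hD
  set A := corrKernel T p θ with hA
  have hmS : ∀ n, Measurable fun y => seriesAbs D A n T x y := fun n => by
    have m4 : Measurable fun y : Rd d => ((T, x, y) : ℝ × Rd d × Rd d) := by fun_prop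
    exact (hker.measurable_seriesAbs n).comp m4
  have hmT : ∀ n, Measurable fun y => seriesTerm D A n T x y := fun n => by
    have m4 : Measurable fun y : Rd d => ((T, x, y) : ℝ × Rd d × Rd d) := by fun_prop
    exact (hker.measurable_seriesTerm n).comp m4
  rw [lintegral_tsum fun n => (hmS n).aemeasurable] at hfin
  have hfin1 : ∀ n, ∫⁻ y, seriesAbs D A n T x y ∂(μ.map (X 0)) ≠ ∞ := fun n =>
    ENNReal.ne_top_of_tsum_ne_top hfin n
  have hmc : ∀ n, Measurable (contribution T p θ τ X x n 0) := fun n =>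
    measurable_contribution hp hθ hker hτ hX n 0
  have habs : ∀ n, ∫⁻ ω, absContribution T p θ τ X x n 0 ω ∂μ
      = ENNReal.ofReal (Real.exp (-T)) * ∫⁻ y, seriesAbs D A n T x y ∂(μ.map (X 0)) := fun n => by
    rw [lintegral_absContribution_eq hp hθ hK hτ hX hker, zero_add,
      lintegral_absContribution_zero hτ hX hker hT]
  have habs0 : ∀ n, ∫⁻ ω, absContribution T p θ τ X x 0 (0 + n) ω ∂μ ≠ ∞ := fun n => by
    rw [zero_add, lintegral_absContribution_zero hτ hX hker hT]
    exact ENNReal.mul_ne_top ENNReal.ofReal_ne_top (hfin1 n)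
  have hsum : ∑' n, ∫⁻ ω, ‖contribution T p θ τ X x n 0 ω‖ₑ ∂μ ≠ ∞ := by
    refine ne_top_of_le_ne_top (ENNReal.mul_ne_top ENNReal.ofReal_ne_top hfin)
      (b := ENNReal.ofReal (Real.exp (-T)) * _) ?_
    rw [← ENNReal.tsum_mul_left]
    refine ENNReal.tsum_le_tsum fun n => ?_
    rw [← habs]
    exact lintegral_mono fun ω => enorm_contribution_le n 0 ω
  have hsum' : ∑' n, ∫⁻ y, ‖seriesTerm D A n T x y‖ₑ ∂(μ.map (X 0)) ≠ ∞ :=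
    ne_top_of_le_ne_top hfin (ENNReal.tsum_le_tsum fun n =>
      lintegral_mono fun y => KernelBounds.enorm_seriesTerm_le n T x y)
  have hae := bwdIntegrand_ae_eq_tsum (X := X) (x := x) hT hp hK hτ hker
  have hval : ∀ n, ∫ ω, contribution T p θ τ X x n 0 ω ∂μ
      = Real.exp (-T) * ∫ y, seriesTerm D A n T x y ∂(μ.map (X 0)) := fun n => by
    rw [integral_contribution_eq hp hθ hK hτ hX hker n 0 (habs0 n), zero_add,
      integral_contribution_zero hτ hX hker hT n (hfin1 n)]
  refine ⟨Integrable.congr ?_ hae.symm, ?_⟩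
  · refine ⟨(Measurable.tsum hmc).aestronglyMeasurable, ?_⟩
    rw [HasFiniteIntegral]
    refine lt_of_le_of_lt (lintegral_mono fun ω => enorm_tsum_le_tsum_enorm) ?_
    rw [lintegral_tsum fun n => (hmc n).enorm.aemeasurable]
    exact hsum.lt_top
  · rw [integral_congr_ae hae, integral_tsum (fun n => (hmc n).aestronglyMeasurable) hsum,
      integral_tsum (fun n => (hmT n).aestronglyMeasurable) hsum']
    simp_rw [hval]
    rw [tsum_mul_left, ← mul_assoc, ← Real.exp_add]
    simp

/-! ### Main theorem -/

/-- The column bound makes `∫∫ h(y) ∑ W_n^{abs}(x,y) dy dx` finite, so the inner integral is finite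
for almost every `x`. The scheme enters only through the law of its initial value, so schemes
started at different deterministic points need not be glued together measurably. -/
theorem ae_integrable_bwdIntegrand_of_density [IsProbabilityMeasure μ] (hT : 0 < T)
    (hP : IsSemigroup T P) (hp : IsFrozenFamily T p) (hL : GeneratorsAgree T P p)
    (hreg : BackwardRegular T P p) (hθ : IsBackwardWeight T P p θ) {ρ c : ℝ}
    (hb : CorrBound T p θ ρ c) (hK : DiagBound T p K) (hτ : IsPoissonJumpTimes μ τ)
    (hX : IsBackwardScheme μ τ T p X) {h : Rd d → ℝ} (hh : Integrable h) (hh0 : ∀ y, 0 ≤ h y)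
    (hlaw : μ.map (X 0) = volume.withDensity fun y => ENNReal.ofReal (h y)) :
    ∀ᵐ x : Rd d, (P T x).Integrable h ∧ Integrable (bwdIntegrand τ T p θ X x) μ ∧
      op P T h x = Real.exp T * ∫ ω, bwdIntegrand τ T p θ X x ω ∂μ := by
  have hker := hb.kernelBounds hT hp hθ hK
  set D := diagDensity T p with hD
  set A := corrKernel T p θ with hA
  obtain ⟨C, hC, -, hcol⟩ := hker.exists_tsum_bound T
  have hmS : Measurable fun q : Rd d × Rd d => ∑' n, seriesAbs D A n T q.1 q.2 := by
    refine Measurable.tsum fun n => ?_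
    have m4 : Measurable fun q : Rd d × Rd d => ((T, q.1, q.2) : ℝ × Rd d × Rd d) := by fun_prop
    exact (hker.measurable_seriesAbs n).comp m4
  have hho : AEMeasurable (fun y => ENNReal.ofReal (h y)) := hh.1.aemeasurable.ennreal_ofReal
  have hmP : AEMeasurable (fun q : Rd d × Rd d =>
      ENNReal.ofReal (h q.2) * ∑' n, seriesAbs D A n T q.1 q.2) (volume.prod volume) :=
    hho.comp_snd.mul hmS.aemeasurable
  have hfin : ∫⁻ x, ∫⁻ y, ENNReal.ofReal (h y) * ∑' n, seriesAbs D A n T x y ≠ ∞ := by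
    rw [lintegral_lintegral_swap hmP]
    have h1 : ∀ y, ∫⁻ x, ENNReal.ofReal (h y) * ∑' n, seriesAbs D A n T x y
        ≤ ENNReal.ofReal (h y) * C := fun y => by
      rw [lintegral_const_mul' _ _ ENNReal.ofReal_ne_top]
      gcongr
      exact hcol y
    refine ne_top_of_le_ne_top ?_ (lintegral_mono h1)
    rw [lintegral_mul_const'' _ hho]
    refine ENNReal.mul_ne_top ?_ hC
    rw [← ofReal_integral_eq_lintegral_ofReal hh (Eventually.of_forall hh0)]
    exact ENNReal.ofReal_ne_top
  filter_upwards [ae_lt_top' hmP.lintegral_prod_right' hfin,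
    ae_forall_op_eq_integral_tsum hT hP hp hL hreg hθ hb hK (right_mem_Ioc.2 hT)] with x hx hop
  have hmx : Measurable fun y => ∑' n, seriesAbs D A n T x y :=
    hmS.comp (measurable_const.prodMk measurable_id)
  have hGi := integrable_tsum_seriesTerm (P := P) hT hp hθ hb hK T x
  have hint : Integrable fun y => h y * ∑' n, seriesTerm D A n T x y := by
    refine ⟨hh.1.mul hGi.1, ?_⟩
    refine lt_of_le_of_lt (lintegral_mono fun y => ?_) hx
    rw [enorm_mul, Real.enorm_of_nonneg (hh0 y)]
    gcongr
    exact enorm_tsum_le_tsum_enorm.trans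
      (ENNReal.tsum_le_tsum fun n => KernelBounds.enorm_seriesTerm_le n T x y)
  have hop' := integrable_and_op_eq_of_density hGi hop hh.1 hint
  have hlaw' : ∫⁻ y, ∑' n, seriesAbs D A n T x y ∂(μ.map (X 0)) ≠ ∞ := by
    rw [hlaw, lintegral_withDensity_eq_lintegral_mul₀ hho hmx.aemeasurable]
    exact hx.ne
  obtain ⟨h1, h2⟩ := integrable_and_integral_bwdIntegrand hT hp hθ hK hτ hX hker hlaw'
  refine ⟨hop'.1, h1, ?_⟩
  rw [hop'.2, h2, hlaw, integral_withDensity_eq_integral_toReal_smul₀ hho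
    (Eventually.of_forall fun y => ENNReal.ofReal_lt_top)]
  refine integral_congr_ae (Eventually.of_forall fun y => ?_)
  simp only [ENNReal.toReal_ofReal (hh0 y), smul_eq_mul]

/-- The row bound holds for every `x` and makes the absolute series finite at almost every `y`; a
Dirac initial law evaluates the series there. No exceptional `x` appears, since the semigroup is not
involved. -/
theorem ae_integrable_bwdIntegrand_of_dirac [IsProbabilityMeasure μ] (hT : 0 < T)
    (hp : IsFrozenFamily T p) (hθ : IsBackwardWeight T P p θ) (hK : DiagBound T p K)
    (hker : KernelBounds (diagDensity T p) (corrKernel T p θ) C R) (hτ : IsPoissonJumpTimes μ τ)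
    {X : Rd d → ℝ → Ω → Rd d} (hX : ∀ y, IsBackwardScheme μ τ T p (X y))
    (hX0 : ∀ y, ∀ᵐ ω ∂μ, X y 0 ω = y) (x : Rd d) :
    ∀ᵐ y, Integrable (bwdIntegrand τ T p θ (X y) x) μ ∧
      Real.exp T * ∫ ω, bwdIntegrand τ T p θ (X y) x ω ∂μ
        = ∑' n, seriesTerm (diagDensity T p) (corrKernel T p θ) n T x y := by
  obtain ⟨C, hC, hrow, -⟩ := hker.exists_tsum_bound T
  have hmS : Measurable fun y =>
      ∑' n, seriesAbs (diagDensity T p) (corrKernel T p θ) n T x y := by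
    refine Measurable.tsum fun n => ?_
    have m4 : Measurable fun y : Rd d => ((T, x, y) : ℝ × Rd d × Rd d) := by fun_prop
    exact (hker.measurable_seriesAbs n).comp m4
  filter_upwards [ae_lt_top hmS (ne_top_of_le_ne_top hC (hrow x))] with y hy
  have hlaw : μ.map (X y 0) = Measure.dirac y := by
    rw [Measure.map_congr (hX0 y), Measure.map_const, measure_univ, one_smul]
  have h := integrable_and_integral_bwdIntegrand (x := x) hT hp hθ hK hτ (hX y) hker
  rw [hlaw, lintegral_dirac, integral_dirac] at h
  exact h hy.ne

end Parametrix

theorem mainTheorem5 {d : ℕ} {T : ℝ} (hT : 0 < T)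
    (P : ℝ → Parametrix.Rd d → SignedMeasure (Parametrix.Rd d))
    (p : ℝ → Parametrix.Rd d → Parametrix.Rd d → Parametrix.Rd d → ℝ)
    (θ : ℝ → Parametrix.Rd d → Parametrix.Rd d → ℝ)
    (hP : Parametrix.IsSemigroup T P)
    (hp : Parametrix.IsFrozenFamily T p)
    (hL : Parametrix.GeneratorsAgree T P p)
    (hreg : Parametrix.BackwardRegular T P p)
    (hθ : Parametrix.IsBackwardWeight T P p θ)
    (hker : Parametrix.HasBackwardKernelBound T p θ)
    {Ω : Type*} [MeasurableSpace Ω] (μ : Measure Ω) [IsProbabilityMeasure μ]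
    (τ : ℕ → Ω → ℝ) (hτ : Parametrix.IsPoissonJumpTimes μ τ)
    (X : Parametrix.Rd d → ℝ → Ω → Parametrix.Rd d)
    (hX : ∀ y, Parametrix.IsBackwardScheme μ τ T p (X y))
    (hX0 : ∀ y, ∀ᵐ ω ∂μ, X y 0 ω = y) :
    ((∀ x, ∀ᵐ y, Integrable (Parametrix.bwdIntegrand τ T p θ (X y) x) μ) ∧
      ∀ᵐ x : Parametrix.Rd d,
        Integrable (fun y => Real.exp T * ∫ ω, Parametrix.bwdIntegrand τ T p θ (X y) x ω ∂μ) ∧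
        ∀ A : Set (Parametrix.Rd d), MeasurableSet A →
          P T x A = ∫ y in A, Real.exp T * ∫ ω, Parametrix.bwdIntegrand τ T p θ (X y) x ω ∂μ) ∧
    (∀ (h : Parametrix.Rd d → ℝ), Integrable h → (∀ y, 0 ≤ h y) →
      ∀ (Z : Ω → Parametrix.Rd d), Measurable Z →
        μ.map Z = volume.withDensity (fun y => ENNReal.ofReal (h y)) →
      ∀ (XZ : ℝ → Ω → Parametrix.Rd d), Parametrix.IsBackwardScheme μ τ T p XZ →
        (∀ᵐ ω ∂μ, XZ 0 ω = Z ω) →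
      ∀ᵐ x : Parametrix.Rd d,
        (P T x).Integrable h ∧
        Integrable (Parametrix.bwdIntegrand τ T p θ XZ x) μ ∧
        Parametrix.op P T h x
          = Real.exp T * ∫ ω, Parametrix.bwdIntegrand τ T p θ XZ x ω ∂μ) := by
  obtain ⟨ρ, c, hb⟩ := Parametrix.exists_corrBound hp hθ hker
  obtain ⟨K, hK⟩ := Parametrix.exists_diagBound hp hreg
  have hkb := hb.kernelBounds hT hp hθ hK
  have hpt := Parametrix.ae_integrable_bwdIntegrand_of_dirac hT hp hθ hK hkb hτ hX hX0
  refine ⟨⟨fun x => (hpt x).mono fun y hy => hy.1, ?_⟩, ?_⟩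
  -- The null set of `x` enters here, through the identification of the series with `P_T(x,·)`.
  · filter_upwards [Parametrix.ae_forall_op_eq_integral_tsum hT hP hp hL hreg hθ hb hK
      (right_mem_Ioc.2 hT)] with x hop
    have hGi := Parametrix.integrable_tsum_seriesTerm (P := P) hT hp hθ hb hK T x
    have hae := (hpt x).mono fun y hy => hy.2
    refine ⟨hGi.congr (hae.mono fun y hy => hy.symm), fun A hA => ?_⟩
    have hind : Parametrix.IsBddMeas (A.indicator fun _ => (1 : ℝ)) :=
      ⟨measurable_const.indicator hA, 1, fun y => by by_cases hy : y ∈ A <;> simp [hy]⟩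
    rw [← Parametrix.op_indicator_one hA, hop _ hind,
      setIntegral_congr_ae hA (hae.mono fun y hy _ => hy), ← integral_indicator hA]
    refine integral_congr_ae (Eventually.of_forall fun y => ?_)
    by_cases hy : y ∈ A <;> simp [hy]
  · intro h hh hh0 Z hZ hlaw XZ hXZ hXZ0
    refine Parametrix.ae_integrable_bwdIntegrand_of_density hT hP hp hL hreg hθ hb hK hτ hXZ hh
      hh0 ?_
    rw [← hlaw]
    exact Measure.map_congr hXZ0
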